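/- Fix $\ell>0$ and a base point $a\in\mathbb R$. **Phase space.** Let $\mathcal P$ be the set of all pairs $(u,\mu)$ such that $u$ is an $\ell$-periodic, real-valued function in $H^1_{\mathrm{loc}}(\mathbb R)$ (identified with its continuous representative), $\mu$ is an $\ell$-periodic, non-negative, locally finite Borel measure on $\mathbb R$ with $\mu(B)\ge\int_B u^2+u'^2\,dx$ for every Borel set $B$, and the topological supports of the distribution $\omega=u-u''$, i.e. $\omega(h)=\int uh\,dx+\int u'h'\,dx$ for $h\in H^1_{\mathrm c}(\mathbb R)$, and of the Borel measure $\upsilon$ given by $\mu(B)=\upsilon(B)+\int_B u^2+u'^2\,dx$ are discrete sets. For such pairs $\omega$ is a sum of point masses; let $\Sigma$ be the union of the two supports. **Spectral quantities of a pair $(u,\mu)\in\mathcal P$.** For $z\in\mathbb C$, a solution of $-f''+\frac14f=z\,\omega f+z^2\upsilon f$ is a continuous function $f:\mathbb R\to\mathbb C$ with $-f''+\frac14 f=0$ on $\mathbb R\setminus\Sigma$ and $f'(x-)=\bigl(z\,\omega(\{x\})+z^2\upsilon(\{x\})\bigr)f(x)+f'(x+)$ for $x\in\Sigma$; the derivative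 $f'$ is extended to $\mathbb R$ by left-continuity. Let $c(z,\cdot)$, $s(z,\cdot)$ be the solutions with $c(z,a)=s'(z,a)=1$, $c'(z,a)=s(z,a)=0$. The Floquet discriminant of $(u,\mu)$ is $z\mapsto\frac12\bigl(c(z,a+\ell)+s'(z,a+\ell)\bigr)$. The Dirichlet spectrum $\sigma$ is the set of all $z\in\mathbb C$ for which there is a nontrivial solution with $f(a)=f(a+\ell)=0$. **Gaps and torus.** Let $\Delta$ be a real polynomial with only real, nonzero and simple roots, with $\Delta(0)=\cosh(\ell/2)$, and such that $\dot\Delta(\lambda)=0$ implies $|\Delta(\lambda)|\ge1$. Label the zeros of $\Delta^2-1$, repeated according to multiplicity, in non-decreasing order as $\lambda_{-2I_-},\dots,\lambda_{-1},\lambda_1,\dots,\lambda_{2I_+}$ so that each zero has the same sign as its index. Put $\mathcal I=\{-I_-,\dots,-1\}\cup\{1,\dots,I_+\}$ and $$\Gamma_i=\begin{cases}[-\infty,\lambda_{2i}],&i=-I_-,\\ [\lambda_{2i-1},\lambda_{2i}],&-I_-<i\le-1,\\ [\lambda_{2i},\lambda_{2i+1}],&1\le i<I_+,\\ [\lambda_{2i},\infty],&i=I_+,\end{cases}\qquad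 i\in\mathcal I,$$ $$\mathcal T=\prod_{i\in\mathcal I}\mathcal T_i,\qquad \mathcal T_i=\{(z,\zeta)\in\Gamma_i\times\mathbb R\mid \zeta^2=\Delta(z)^2-1\},$$ with the convention $\Delta(\pm\infty)=1$. If $(u,\mu)\in\mathcal P$ has Floquet discriminant $\Delta$, its Dirichlet divisors are the family indexed by $\mathcal I$ whose $i$-th member is $\hat\kappa_i=\bigl(\kappa_i,\Delta(\kappa_i)-s'(\kappa_i,a+\ell)\bigr)$, where $\kappa_i$ is the Dirichlet eigenvalue in $\Gamma_i$, if there is one; if there is none (which can happen only in the outermost gaps), then $\hat\kappa_i=(\infty,0)$ for $i=I_+$ and $\hat\kappa_i=(-\infty,0)$ for $i=-I_-$. **Theorem.** For every $\hat\kappa\in\mathcal T$ there is a unique pair $(u,\mu)\in\mathcal P$ whose Floquet discriminant is $\Delta$ and whose Dirichlet divisors are $\hat\kappa$. -/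

import Mathlib

open MeasureTheory Filter Topology Polynomial

noncomputable section

namespace MultiPeakon

/-! ### The phase spaces -/

/-- `f ∈ H¹_loc(ℝ)`, where `f` is the continuous representative: `f` is locally absolutely
continuous and its (almost everywhere defined) derivative is locally square integrable. -/
def MemH1loc (f : ℝ → ℝ) : Prop :=
  (∀ x y : ℝ, AbsolutelyContinuousOnInterval f x y) ∧
    LocallyIntegrable (fun x => deriv f x ^ 2)

/-- `h ∈ H¹_c(ℝ)`: the functions in `H¹_loc(ℝ)` with compact support. -/
def MemH1c (h : ℝ → ℝ) : Prop :=
  MemH1loc h ∧ HasCompactSupport h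

/-- The Borel measure `B ↦ ∫_B u² + u'² dx`. -/
def energyMeasure (u : ℝ → ℝ) : Measure ℝ :=
  volume.withDensity fun x => ENNReal.ofReal (u x ^ 2 + deriv u x ^ 2)

/-- The set `𝒟` of all pairs `(u, μ)` of an `ℓ`-periodic, real-valued function `u` in `H¹_loc(ℝ)`
and an `ℓ`-periodic (locally finite) Borel measure `μ` with `∫_B u² + u'² dx ≤ μ(B)` for every
Borel set `B`. -/
def bigPhaseSpace (ℓ : ℝ) : Set ((ℝ → ℝ) × Measure ℝ) :=
  {p | Function.Periodic p.1 ℓ ∧ MemH1loc p.1 ∧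
    IsLocallyFiniteMeasure p.2 ∧ p.2.map (fun x => x + ℓ) = p.2 ∧
    ∀ B : Set ℝ, MeasurableSet B → energyMeasure p.1 B ≤ p.2 B}

/-- The distribution `ω = u - u''`, as a functional on `H¹_c(ℝ)`. -/
def omega (u h : ℝ → ℝ) : ℝ :=
  (∫ x, u x * h x) + ∫ x, deriv u x * deriv h x

/-- The topological support of the distribution `ω`. -/
def omegaSupport (u : ℝ → ℝ) : Set ℝ :=
  {x | ∀ U : Set ℝ, IsOpen U → x ∈ U → ∃ h, MemH1c h ∧ tsupport h ⊆ U ∧ omega u h ≠ 0}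

/-- The Borel measure `υ` with `μ = υ + (u² + u'²) dx`, see `upsilon_add_energyMeasure`. -/
def upsilon (u : ℝ → ℝ) (μ : Measure ℝ) : Measure ℝ :=
  μ - energyMeasure u

theorem upsilon_add_energyMeasure {ℓ : ℝ} {p : (ℝ → ℝ) × Measure ℝ} (hp : p ∈ bigPhaseSpace ℓ) :
    upsilon p.1 p.2 + energyMeasure p.1 = p.2 := by
  obtain ⟨-, -, hfin, -, hle⟩ := hp
  have hle' : energyMeasure p.1 ≤ p.2 := Measure.le_iff.2 hle
  refine (Measure.ext_iff_of_iUnion_eq_univ (iUnion_spanningSets p.2)).2 fun n => ?_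
  have hS := measurableSet_spanningSets p.2 n
  have hlt := measure_spanningSets_lt_top p.2 n
  have : IsFiniteMeasure ((energyMeasure p.1).restrict (spanningSets p.2 n)) :=
    ⟨by simpa using (hle _ hS).trans_lt hlt⟩
  rw [Measure.restrict_add, upsilon, Measure.restrict_sub_eq_restrict_sub_restrict hS]
  exact Measure.sub_add_cancel_of_le (Measure.restrict_mono subset_rfl hle')

/-- The multi-peakon phase space `𝒫`: all pairs in `𝒟` such that the topological supports of the
distribution `ω` and of the Borel measure `υ` are discrete sets. -/
def phaseSpace (ℓ : ℝ) : Set ((ℝ → ℝ) × Measure ℝ) :=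
  {p | p ∈ bigPhaseSpace ℓ ∧ IsDiscrete (omegaSupport p.1) ∧
    IsDiscrete (upsilon p.1 p.2).support}

/-! ### The differential equation `-f'' + f/4 = z ω f + z² υ f` -/

/-- The distribution `ω` coincides with `w δ_x` in a neighborhood of `x`. -/
def IsOmegaMass (u : ℝ → ℝ) (x w : ℝ) : Prop :=
  ∃ U : Set ℝ, IsOpen U ∧ x ∈ U ∧ ∀ h, MemH1c h → tsupport h ⊆ U → omega u h = w * h x

/-- The number `ω({x})`. For pairs in `𝒫`, the distribution `ω` is a sum of point masses without
accumulation points, so near every `x` it is a multiple of the Dirac measure `δ_x`. -/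
def omegaMass (u : ℝ → ℝ) (x : ℝ) : ℝ :=
  Classical.epsilon (IsOmegaMass u x)

theorem omegaMass_eq {u : ℝ → ℝ} {x w : ℝ} (h : IsOmegaMass u x w) : omegaMass u x = w := by
  obtain ⟨U, hU, hxU, hw⟩ := h
  obtain ⟨V, hV, hxV, hv⟩ : IsOmegaMass u x (omegaMass u x) :=
    Classical.epsilon_spec (p := IsOmegaMass u x) ⟨w, U, hU, hxU, hw⟩
  obtain ⟨g, hgs, hg, hgc, -, hgx⟩ := exists_contDiff_tsupport_subset (n := 1)
    ((hU.inter hV).mem_nhds ⟨hxU, hxV⟩)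
  have hH : MemH1c g := by
    refine ⟨⟨fun x y => ?_, ?_⟩, hg⟩
    · exact hgc.contDiffOn.absolutelyContinuousOnInterval
    · exact ((hgc.continuous_deriv le_rfl).pow 2).locallyIntegrable
  have h1 := hw g hH fun y hy => (hgs hy).1
  have h2 := hv g hH fun y hy => (hgs hy).2
  rw [hgx, mul_one] at h1 h2
  exact h2.symm.trans h1

/-- The support `Σ` of `|ω| + υ`. -/
def singularSet (u : ℝ → ℝ) (μ : Measure ℝ) : Set ℝ :=
  omegaSupport u ∪ (upsilon u μ).support

/-- `f` is a solution of the differential equation `-f'' + f/4 = z ω f + z² υ f`, and `f'` is its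
spatial derivative, extended to all of `ℝ` by left-continuity: `-f'' + f/4 = 0` away from `Σ`, and
`f(x-) = f(x+)`, `f'(x-) = (z ω({x}) + z² υ({x})) f(x+) + f'(x+)` at every `x ∈ Σ`. -/
structure IsSolution (u : ℝ → ℝ) (μ : Measure ℝ) (z : ℂ) (f f' : ℝ → ℂ) : Prop where
  continuous : Continuous f
  hasDerivAt : ∀ x ∉ singularSet u μ, HasDerivAt f (f' x) x
  hasDerivAt' : ∀ x ∉ singularSet u μ, HasDerivAt f' (1 / 4 * f x) x
  left : ∀ x ∈ singularSet u μ, Tendsto f' (𝓝[<] x) (𝓝 (f' x))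
  right : ∀ x ∈ singularSet u μ, Tendsto f' (𝓝[>] x)
    (𝓝 (f' x - (z * omegaMass u x + z ^ 2 * (upsilon u μ).real {x}) * f x))

/-- The solution `f`, together with its derivative `f'`, of the initial value problem
`f(a) = α`, `f'(a) = β`. -/
def solutionIVP (u : ℝ → ℝ) (μ : Measure ℝ) (a : ℝ) (z α β : ℂ) : (ℝ → ℂ) × (ℝ → ℂ) :=
  Classical.epsilon fun F => IsSolution u μ z F.1 F.2 ∧ F.1 a = α ∧ F.2 a = β

/-- The monodromy matrix `M(z)` with entries `c(z,a+ℓ)`, `s(z,a+ℓ)`, `c'(z,a+ℓ)`, `s'(z,a+ℓ)`, where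
`c(z,a) = s'(z,a) = 1` and `c'(z,a) = s(z,a) = 0`. -/
def monodromy (ℓ a : ℝ) (u : ℝ → ℝ) (μ : Measure ℝ) (z : ℂ) : Matrix (Fin 2) (Fin 2) ℂ :=
  let c := solutionIVP u μ a z 1 0
  let s := solutionIVP u μ a z 0 1
  !![c.1 (a + ℓ), s.1 (a + ℓ); c.2 (a + ℓ), s.2 (a + ℓ)]

/-- The Floquet discriminant `tr M(z) / 2` of the pair `(u, μ)`. -/
def floquetDiscriminant (ℓ a : ℝ) (u : ℝ → ℝ) (μ : Measure ℝ) (z : ℂ) : ℂ :=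
  (monodromy ℓ a u μ z).trace / 2

/-- The Dirichlet spectrum `σ` on `[a, a+ℓ)`. -/
def dirichletSpectrum (ℓ a : ℝ) (u : ℝ → ℝ) (μ : Measure ℝ) : Set ℂ :=
  {z | ∃ f f' : ℝ → ℂ, IsSolution u μ z f f' ∧ f ≠ 0 ∧ f a = 0 ∧ f (a + ℓ) = 0}

/-! ### Gaps and the torus of a polynomial -/

/-- The positive zeros of `Δ² - 1`, repeated according to multiplicity, in non-decreasing order. -/
def posZeros (Δ : ℝ[X]) : List ℝ :=
  ((Δ ^ 2 - 1).roots.filter fun x => 0 < x).sort (· ≤ ·)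

/-- The negative zeros of `Δ² - 1`, repeated according to multiplicity, in non-increasing order. -/
def negZeros (Δ : ℝ[X]) : List ℝ :=
  ((Δ ^ 2 - 1).roots.filter fun x => x < 0).sort (· ≥ ·)

/-- The number `I₊`; there are `2 I₊` positive zeros of `Δ² - 1`. -/
def numPos (Δ : ℝ[X]) : ℕ := (posZeros Δ).length / 2

/-- The number `I₋`; there are `2 I₋` negative zeros of `Δ² - 1`. -/
def numNeg (Δ : ℝ[X]) : ℕ := (negZeros Δ).length / 2

/-- The zeros `λ_{-2I₋} ≤ ⋯ ≤ λ_{-1} < 0 < λ_1 ≤ ⋯ ≤ λ_{2I₊}` of `Δ² - 1`, labelled so that each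
zero has the same sign as its index. -/
def lam (Δ : ℝ[X]) (j : ℤ) : ℝ :=
  if 0 < j then (posZeros Δ).getD (j.natAbs - 1) 0 else (negZeros Δ).getD (j.natAbs - 1) 0

/-- The index set `{-I₋, …, -1} ∪ {1, …, I₊}`. -/
def gapIndex (Δ : ℝ[X]) : Set ℤ :=
  {i | i ≠ 0 ∧ -(numNeg Δ : ℤ) ≤ i ∧ i ≤ (numPos Δ : ℤ)}

/-- The gap `Γ_i`, as an interval of extended real numbers. -/
def gap (Δ : ℝ[X]) (i : ℤ) : Set EReal :=
  if i = -(numNeg Δ : ℤ) then Set.Icc ⊥ (lam Δ (2 * i) : EReal)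
  else if i = (numPos Δ : ℤ) then Set.Icc (lam Δ (2 * i) : EReal) ⊤
  else if i < 0 then Set.Icc (lam Δ (2 * i - 1) : EReal) (lam Δ (2 * i) : EReal)
  else Set.Icc (lam Δ (2 * i) : EReal) (lam Δ (2 * i + 1) : EReal)

/-- The value of `Δ` on the extended real line, with the convention `Δ(-∞) = Δ(∞) = 1`. -/
def evalExt (Δ : ℝ[X]) (z : EReal) : ℝ :=
  if z = ⊥ ∨ z = ⊤ then 1 else Δ.eval z.toReal

/-- The set `𝒯_i = {(z, ζ) ∈ Γ_i × ℝ | ζ² = Δ(z)² - 1}`. -/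
def torusComponent (Δ : ℝ[X]) (i : ℤ) : Set (EReal × ℝ) :=
  {p | p.1 ∈ gap Δ i ∧ p.2 ^ 2 = evalExt Δ p.1 ^ 2 - 1}

/-- The torus `𝒯 = ∏ 𝒯_i`. -/
def torus (Δ : ℝ[X]) : Set (gapIndex Δ → EReal × ℝ) :=
  {κ | ∀ i : gapIndex Δ, κ i ∈ torusComponent Δ i}

/-- `κ` is the family of Dirichlet divisors of the pair `(u, μ)` with Floquet discriminant `Δ`: if
the gap `Γ_i` contains a Dirichlet eigenvalue `κ_i`, then the `i`-th divisor is
`(κ_i, Δ(κ_i) - s'(κ_i, a+ℓ))`; if it contains none, then `Γ_i` is an outermost gap and the `i`-th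
divisor is `(∞, 0)` for the positive and `(-∞, 0)` for the negative outermost gap. -/
def IsDirichletDivisors (ℓ a : ℝ) (u : ℝ → ℝ) (μ : Measure ℝ) (Δ : ℝ[X])
    (κ : gapIndex Δ → EReal × ℝ) : Prop :=
  ∀ i : gapIndex Δ,
    (∃ k : ℝ, (k : ℂ) ∈ dirichletSpectrum ℓ a u μ ∧ (k : EReal) ∈ gap Δ i ∧ (κ i).1 = (k : EReal) ∧
      ((κ i).2 : ℂ) = ((Δ.eval k : ℝ) : ℂ) - monodromy ℓ a u μ (k : ℂ) 1 1) ∨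
    ((∀ k : ℝ, (k : ℂ) ∈ dirichletSpectrum ℓ a u μ → (k : EReal) ∉ gap Δ i) ∧
      (((i : ℤ) = (numPos Δ : ℤ) ∧ κ i = (⊤, 0)) ∨ ((i : ℤ) = -(numNeg Δ : ℤ) ∧ κ i = (⊥, 0))))

end MultiPeakon

end

open MeasureTheory Filter Topology Polynomial

noncomputable section

namespace MultiPeakon

/-! ### Transfer matrices -/

/-! A pair in the phase space amounts to finitely many point masses (w, v) = (ω({x}), υ({x})) in one
period [a, a+ℓ): u is recovered from ω by the periodic Green function, and μ from u and υ. The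
monodromy matrix is then a product of constant propagators and unipotent jumps, hence polynomial in
z. The mass at a acts first and does not affect the second column (A, B) = (s(·, a+ℓ), s'(·, a+ℓ));
the masses in (a, a+ℓ) form a string with transfer matrix of determinant 1.

The Dirichlet eigenvalues are the zeros of A. At such a zero the two diagonal entries are reciprocal
and add up to 2Δ, so Δ - B is a square root of Δ² - 1. A point of the torus therefore prescribes the
zeros of A and the values of B there. As A(0) = 2 sinh(ℓ/2), B(0) = cosh(ℓ/2) and deg B ≤ deg A,
interpolation determines both polynomials.

It remains to solve an inverse problem. The second columns of strings are exactly the pairs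
satisfying `IsWeylPair`: A has only real zeros, and x A'(x) B(x) > 0 at each of them. Necessity
comes from a kernel that is positive and grows along the string (`diagKernel_transfer_pos`,
`im_transfer_neg`). For sufficiency, partial fractions of B/A show that a last interval and a last
mass can be split off so that a pair of smaller degree with the same properties remains
(`IsWeylPair.exists_step`). Leading coefficients give uniqueness (`transfer_injective`).

The mass at a is read off from the trace: 2Δ minus the trace of the string is divisible by A, and
the quotient vanishes at 0 and has degree at most the number of infinite divisors, which is at most
2. Its coefficients are -w and -v, and v ≥ 0 because the outermost zeros of Δ have opposite signs
(`exists_string`).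

The gaps enter only through signs. Each zero T i of Δ lies between 0 and its gap Γ_i, and the other
gaps and zeros interlace accordingly (`GapData`). This makes the interpolated pair a Weyl pair.
Conversely, for an arbitrary pair with discriminant Δ, A has at most one zero in each gap and none
outside the gaps, because zA(z) cannot cross zero twice in the direction dictated by Δ on an
interval where |Δ| ≥ 1 (`false_of_two_roots`). -/

/-- The matrix that propagates `(f, f')` over a distance `d` when `-f'' + f/4 = 0`. -/
def propagator (d : ℝ) : Matrix (Fin 2) (Fin 2) ℝ[X] :=
  !![C (Real.cosh (d / 2)), C (2 * Real.sinh (d / 2));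
     C (Real.sinh (d / 2) / 2), C (Real.cosh (d / 2))]

/-- The coefficient `z w + z² v` of a point mass, as a polynomial in `z`. -/
def jumpPoly (w v : ℝ) : ℝ[X] := C w * X + C v * X ^ 2

/-- The matrix of the jump condition at a point mass. -/
def jump (w v : ℝ) : Matrix (Fin 2) (Fin 2) ℝ[X] := !![1, 0; -jumpPoly w v, 1]

/-- The transfer matrix from `b` to `t`, where the list enumerates the point masses
`(x, w, v)` between `b` and `t` from right to left. -/
def transfer (b : ℝ) : List (ℝ × ℝ × ℝ) → ℝ → Matrix (Fin 2) (Fin 2) ℝ[X]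
  | [], t => propagator (t - b)
  | (x, w, v) :: L, t => propagator (t - x) * jump w v * transfer b L x

/-- The list enumerates nontrivial point masses in the open interval `(b, t)` from right to
left. -/
def IsString (b : ℝ) : List (ℝ × ℝ × ℝ) → ℝ → Prop
  | [], t => b < t
  | (x, w, v) :: L, t => x < t ∧ 0 ≤ v ∧ (w ≠ 0 ∨ v ≠ 0) ∧ IsString b L x

theorem IsString.lt {b : ℝ} : ∀ {L : List (ℝ × ℝ × ℝ)} {t : ℝ}, IsString b L t → b < t
  | [], _, h => h
  | (_, _, _) :: _, _, h => (IsString.lt h.2.2.2).trans h.1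

theorem transfer_cons_zero (b x w v t : ℝ) (L : List (ℝ × ℝ × ℝ)) (j : Fin 2) :
    transfer b ((x, w, v) :: L) t 0 j =
      C (Real.cosh ((t - x) / 2)) * transfer b L x 0 j + C (2 * Real.sinh ((t - x) / 2)) *
        (transfer b L x 1 j - jumpPoly w v * transfer b L x 0 j) := by
  simp [transfer, propagator, jump, Matrix.mul_apply, Fin.sum_univ_two]
  ring

theorem transfer_cons_one (b x w v t : ℝ) (L : List (ℝ × ℝ × ℝ)) (j : Fin 2) :
    transfer b ((x, w, v) :: L) t 1 j =
      C (Real.sinh ((t - x) / 2) / 2) * transfer b L x 0 j + C (Real.cosh ((t - x) / 2)) *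
        (transfer b L x 1 j - jumpPoly w v * transfer b L x 0 j) := by
  simp [transfer, propagator, jump, Matrix.mul_apply, Fin.sum_univ_two]
  ring

theorem det_propagator (d : ℝ) : (propagator d).det = 1 := by
  have h := Real.cosh_sq (d / 2)
  rw [propagator, Matrix.det_fin_two_of, ← C_mul, ← C_mul, ← C_sub, ← C_1]
  congr 1
  linarith

theorem det_jump (w v : ℝ) : (jump w v).det = 1 := by
  simp [jump, Matrix.det_fin_two_of]

theorem det_transfer (b : ℝ) : ∀ (L : List (ℝ × ℝ × ℝ)) (t : ℝ), (transfer b L t).det = 1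
  | [], t => det_propagator _
  | (x, w, v) :: L, t => by
    simp [transfer, det_propagator, det_jump, det_transfer b L x]

theorem propagator_add (d e : ℝ) : propagator (d + e) = propagator d * propagator e := by
  have h : (d + e) / 2 = d / 2 + e / 2 := by ring
  ext i j : 2
  fin_cases i <;> fin_cases j <;>
    simp only [propagator, Matrix.mul_apply, Fin.sum_univ_two, h, Real.cosh_add, Real.sinh_add] <;>
    simp [-map_mul, -map_add, ← C_mul, ← C_add] <;> ring_nf

theorem propagator_zero : propagator 0 = 1 := by
  ext i j : 2
  fin_cases i <;> fin_cases j <;> simp [propagator]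

/-! ### Positivity of the kernel along a string -/

/-- Positivity of the quadratic form that occurs in propagation. -/
theorem propagation_form_nonneg {d : ℝ} (hd : 0 < d) (a b : ℝ) :
    0 ≤ Real.cosh d * Real.sinh d / 2 * a ^ 2 + 2 * Real.cosh d * Real.sinh d * b ^ 2
      + 2 * Real.sinh d ^ 2 * (a * b) := by
  have hs : 0 < Real.sinh d := Real.sinh_pos_iff.2 hd
  have hc : Real.sinh d < Real.cosh d := Real.sinh_lt_cosh d
  have h1 : 0 ≤ Real.cosh d * Real.sinh d - Real.sinh d ^ 2 := by nlinarith
  have h2 : 0 ≤ Real.sinh d ^ 2 := sq_nonneg _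
  -- With c = cosh d and s = sinh d, the form equals (cs - s²)(a²/2 + 2b²) + (s²/2)(a + 2b)².
  nlinarith [mul_nonneg h1 (sq_nonneg a), mul_nonneg h1 (sq_nonneg b),
    mul_nonneg h2 (sq_nonneg (a + 2 * b))]

/-- The diagonal of the reproducing kernel attached to a pair of polynomials. -/
def diagKernel (A B : ℝ[X]) : ℝ[X] := A * B + X * (derivative A * B - A * derivative B)

/-- For q = wX + vX² the kernel changes by (Xq' - q)A² = vX²A². The mass w drops out, which is why
it may have either sign whereas v may not. -/
theorem diagKernel_jump (A B : ℝ[X]) (w v : ℝ) :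
    diagKernel A (B - jumpPoly w v * A) = diagKernel A B + C v * X ^ 2 * A ^ 2 := by
  simp [diagKernel, jumpPoly]
  ring

/-- The propagator is constant with determinant 1, so the Wronskian part of the kernel is preserved
and only the product AB changes. -/
theorem diagKernel_propagator (A B : ℝ[X]) {c s : ℝ} (h : c ^ 2 = s ^ 2 + 1) :
    diagKernel (C c * A + C (2 * s) * B) (C (s / 2) * A + C c * B) = diagKernel A B +
      (C (c * s / 2) * A ^ 2 + C (2 * c * s) * B ^ 2 + C (2 * s ^ 2) * (A * B)) := by
  refine Polynomial.funext fun x => ?_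
  simp [diagKernel]
  linear_combination (eval x A * eval x B + x * (eval x (derivative A) * eval x B
    - eval x A * eval x (derivative B))) * h

/-- The kernel is strictly positive on a bare interval, and every mass and every further interval
adds a nonnegative term. At a zero x of A it reduces to x A'(x) B(x), the sign condition of a Weyl
pair. -/
theorem diagKernel_transfer_pos {b : ℝ} : ∀ {L : List (ℝ × ℝ × ℝ)} {t : ℝ}, IsString b L t →
    ∀ x : ℝ, 0 < (diagKernel (transfer b L t 0 1) (transfer b L t 1 1)).eval x
  | [], t, h, x => by
    have hs : 0 < Real.sinh ((t - b) / 2) := Real.sinh_pos_iff.2 (by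
      have : b < t := h
      linarith)
    have hc := Real.cosh_pos ((t - b) / 2)
    simp [diagKernel, transfer, propagator]
    positivity
  | (y, w, v) :: L, t, h, x => by
    have hpos := diagKernel_transfer_pos h.2.2.2 x
    have h0 : 0 < (t - y) / 2 := by linarith [h.1]
    rw [transfer_cons_zero, transfer_cons_one,
      diagKernel_propagator _ _ (Real.cosh_sq _), diagKernel_jump]
    have := propagation_form_nonneg h0 ((transfer b L y 0 1).eval x)
      ((transfer b L y 1 1 - jumpPoly w v * transfer b L y 0 1).eval x)
    have h2 : 0 ≤ v * x ^ 2 * ((transfer b L y 0 1).eval x) ^ 2 := by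
      have := h.2.1
      positivity
    rw [eval_add, eval_add]
    simp only [eval_add, eval_mul, eval_pow, eval_C, eval_X] at this ⊢
    linarith

/-- The off-diagonal counterpart of `diagKernel_transfer_pos`. -/
theorem im_transfer_neg {b : ℝ} : ∀ {L : List (ℝ × ℝ × ℝ)} {t : ℝ}, IsString b L t →
    ∀ z : ℂ, z.im ≠ 0 → z.im * (aeval z (transfer b L t 1 1) *
      (starRingEnd ℂ) (aeval z (transfer b L t 0 1)) * (starRingEnd ℂ) z).im < 0
  | [], t, h, z, hz => by
    have hs : 0 < Real.sinh ((t - b) / 2) := Real.sinh_pos_iff.2 (by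
      have : b < t := h
      linarith)
    have hc := Real.cosh_pos ((t - b) / 2)
    have : 0 < z.im ^ 2 := by positivity
    simp only [transfer, propagator, Matrix.of_apply, Matrix.cons_val', Matrix.cons_val_one,
      Matrix.cons_val_zero, Matrix.cons_val_fin_one, aeval_C, Complex.coe_algebraMap,
      Complex.conj_ofReal, ← Complex.ofReal_mul, Complex.im_ofReal_mul,
      Complex.conj_im]
    have : 0 < Real.cosh ((t - b) / 2) * (2 * Real.sinh ((t - b) / 2)) * z.im ^ 2 := by positivity
    nlinarith
  | (y, w, v) :: L, t, h, z, hz => by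
    have hneg := im_transfer_neg h.2.2.2 z hz
    have h0 : 0 < (t - y) / 2 := by linarith [h.1]
    rw [transfer_cons_zero, transfer_cons_one]
    set A := transfer b L y 0 1
    set B := transfer b L y 1 1
    have hq : aeval z (jumpPoly w v) = w * z + v * z ^ 2 := by simp [jumpPoly]
    have hA : aeval z (C (Real.cosh ((t - y) / 2)) * A + C (2 * Real.sinh ((t - y) / 2)) *
        (B - jumpPoly w v * A)) = ((Real.cosh ((t - y) / 2) : ℝ) : ℂ) * aeval z A
          + ((2 * Real.sinh ((t - y) / 2) : ℝ) : ℂ) *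
            (aeval z B - (w * z + v * z ^ 2) * aeval z A) := by
      simp [hq]
    have hB : aeval z (C (Real.sinh ((t - y) / 2) / 2) * A + C (Real.cosh ((t - y) / 2)) *
        (B - jumpPoly w v * A)) = ((Real.sinh ((t - y) / 2) / 2 : ℝ) : ℂ) * aeval z A
          + ((Real.cosh ((t - y) / 2) : ℝ) : ℂ) *
            (aeval z B - (w * z + v * z ^ 2) * aeval z A) := by
      simp [hq]
    rw [hA, hB]
    clear hA hB hq
    generalize aeval z A = α at *
    generalize aeval z B = β at *
    set γ : ℂ := β - (w * z + v * z ^ 2) * α with hγ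
    -- The factor conj z turns wz into the real number w|z|² and vz² into v|z|²z, so only v
    -- contributes to the imaginary part.
    have e1 : (γ * (starRingEnd ℂ) α * (starRingEnd ℂ) z).im =
        (β * (starRingEnd ℂ) α * (starRingEnd ℂ) z).im
          - v * z.im * (z.re ^ 2 + z.im ^ 2) * (α.re ^ 2 + α.im ^ 2) := by
      simp [hγ, Complex.mul_im, Complex.mul_re, pow_two]
      ring
    have f1 := propagation_form_nonneg h0 α.re γ.re
    have f2 := propagation_form_nonneg h0 α.im γ.im
    have hcs := Real.cosh_sq ((t - y) / 2)
    generalize Real.cosh ((t - y) / 2) = c at *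
    generalize Real.sinh ((t - y) / 2) = s at *
    have e2 : ((((s / 2 : ℝ) : ℂ) * α + c * γ) * (starRingEnd ℂ) (c * α + ((2 * s : ℝ) : ℂ) * γ) *
        (starRingEnd ℂ) z).im = (γ * (starRingEnd ℂ) α * (starRingEnd ℂ) z).im
        - z.im * ((c * s / 2 * α.re ^ 2 + 2 * c * s * γ.re ^ 2 + 2 * s ^ 2 * (α.re * γ.re))
          + (c * s / 2 * α.im ^ 2 + 2 * c * s * γ.im ^ 2 + 2 * s ^ 2 * (α.im * γ.im))) := by
      simp [Complex.mul_im, Complex.mul_re]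
      linear_combination (((γ.im * α.re - γ.re * α.im) * z.re
        - (γ.re * α.re + γ.im * α.im) * z.im)) * hcs
    rw [e2, e1]
    have g1 : 0 ≤ z.im ^ 2 * ((c * s / 2 * α.re ^ 2 + 2 * c * s * γ.re ^ 2
        + 2 * s ^ 2 * (α.re * γ.re)) + (c * s / 2 * α.im ^ 2 + 2 * c * s * γ.im ^ 2
        + 2 * s ^ 2 * (α.im * γ.im))) := mul_nonneg (sq_nonneg _) (add_nonneg f1 f2)
    have g2 : 0 ≤ z.im ^ 2 * (v * (z.re ^ 2 + z.im ^ 2) * (α.re ^ 2 + α.im ^ 2)) := by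
      have := h.2.1
      positivity
    linarith

/-! ### Real-rooted polynomials -/

theorem splits_of_forall_im_eq_zero {A : ℝ[X]} (h : ∀ z : ℂ, aeval z A = 0 → z.im = 0) :
    A.Splits := by
  refine Splits.of_splits_map (algebraMap ℝ ℂ) (IsAlgClosed.splits _) fun z hz => ?_
  have h0 : aeval z A = 0 := by
    rw [← eval_map_algebraMap]
    exact (mem_roots'.1 hz).2
  exact ⟨z.re, Complex.ext (by simp) (by simp [h z h0])⟩

theorem nodup_roots_of_derivative_ne_zero {A : ℝ[X]} (hA : A ≠ 0)
    (h : ∀ x, A.eval x = 0 → (derivative A).eval x ≠ 0) : A.roots.Nodup := by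
  rw [Multiset.nodup_iff_count_le_one]
  intro x
  rw [count_roots]
  by_contra! hx
  obtain ⟨h1, h2⟩ := (one_lt_rootMultiplicity_iff_isRoot hA).1 hx
  exact h x h1 h2

theorem card_roots_toFinset_eq_natDegree {A : ℝ[X]} (hA : A ≠ 0)
    (him : ∀ z : ℂ, aeval z A = 0 → z.im = 0)
    (h : ∀ x, A.eval x = 0 → (derivative A).eval x ≠ 0) :
    A.roots.toFinset.card = A.natDegree := by
  rw [Multiset.toFinset_card_of_nodup (nodup_roots_of_derivative_ne_zero hA h),
    (splits_of_forall_im_eq_zero him).natDegree_eq_card_roots]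

theorem X_sub_C_mul_divByMonic {A : ℝ[X]} {x : ℝ} (hx : A.eval x = 0) :
    (X - C x) * (A /ₘ (X - C x)) = A :=
  mul_divByMonic_eq_iff_isRoot.2 hx

theorem eval_divByMonic_self {A : ℝ[X]} {x : ℝ} (hx : A.eval x = 0) :
    (A /ₘ (X - C x)).eval x = (derivative A).eval x := by
  conv_rhs => rw [← X_sub_C_mul_divByMonic hx]
  simp

/-- Lagrange interpolation at the roots of a polynomial with simple real roots. -/
theorem eq_sum_divByMonic {A P : ℝ[X]}
    (hcard : A.roots.toFinset.card = A.natDegree) (hP : P.degree < A.natDegree)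
    (h : ∀ x, A.eval x = 0 → (derivative A).eval x ≠ 0) :
    P = ∑ i ∈ A.roots.toFinset,
      C (P.eval i / (derivative A).eval i) * (A /ₘ (X - C i)) := by
  have hA : A ≠ 0 := by
    rintro rfl
    exact h 0 (by simp) (by simp)
  have hmem : ∀ i ∈ A.roots.toFinset, A.eval i = 0 := fun i hi =>
    (mem_roots'.1 (Multiset.mem_toFinset.1 hi)).2
  have hlt : ∀ i ∈ A.roots.toFinset, (A /ₘ (X - C i)).degree < A.natDegree := fun i hi => by
    rw [← degree_eq_natDegree hA]
    exact degree_divByMonic_lt _ _ hA (by rw [degree_X_sub_C]; exact zero_lt_one)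
  refine eq_of_degrees_lt_of_eval_finset_eq A.roots.toFinset (by rwa [hcard]) ?_ ?_
  · rw [hcard]
    refine (degree_sum_le _ _).trans_lt ?_
    rw [Finset.sup_lt_iff (WithBot.bot_lt_coe _)]
    exact fun i hi => by
      rw [← smul_eq_C_mul]
      exact (degree_smul_le _ _).trans_lt (hlt i hi)
  · intro j hj
    rw [eval_finsetSum, Finset.sum_eq_single j]
    · rw [eval_mul, eval_C, eval_divByMonic_self (hmem j hj), div_mul_cancel₀ _ (h j (hmem j hj))]
    · intro i hi hij
      have := congrArg (eval j) (X_sub_C_mul_divByMonic (hmem i hi))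
      rw [hmem j hj] at this
      simp only [eval_mul, eval_sub, eval_X, eval_C, mul_eq_zero, sub_eq_zero] at this
      rw [eval_mul, this.resolve_left (Ne.symm hij), mul_zero]
    · exact fun h => (h hj).elim

/-! ### Weyl pairs -/

/-- The second columns of transfer matrices over a distance `d`. -/
structure IsWeylPair (A B : ℝ[X]) (d : ℝ) : Prop where
  eval_zero_left : A.eval 0 = 2 * Real.sinh (d / 2)
  eval_zero_right : B.eval 0 = Real.cosh (d / 2)
  natDegree_le : B.natDegree ≤ A.natDegree
  im_eq_zero : ∀ z : ℂ, aeval z A = 0 → z.im = 0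
  sign : ∀ x : ℝ, A.eval x = 0 → 0 < x * (derivative A).eval x * B.eval x

theorem jumpPoly_eval_zero (w v : ℝ) : (jumpPoly w v).eval 0 = 0 := by simp [jumpPoly]

theorem natDegree_jumpPoly_pos {w v : ℝ} (h : w ≠ 0 ∨ v ≠ 0) : 0 < (jumpPoly w v).natDegree := by
  rcases h with h | h
  · exact Nat.lt_of_lt_of_le Nat.zero_lt_one (le_natDegree_of_ne_zero (by
      simpa [jumpPoly, coeff_X, coeff_X_pow] using h))
  · exact Nat.lt_of_lt_of_le Nat.zero_lt_two (le_natDegree_of_ne_zero (by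
      simpa [jumpPoly, coeff_X, coeff_X_pow] using h))

theorem jumpPoly_injective {w v w' v' : ℝ} (h : jumpPoly w v = jumpPoly w' v') :
    w = w' ∧ v = v' := by
  constructor
  · simpa [jumpPoly, coeff_X, coeff_X_pow] using congrArg (fun p => coeff p 1) h
  · simpa [jumpPoly, coeff_X, coeff_X_pow] using congrArg (fun p => coeff p 2) h

/-- At z = 0 the jumps are trivial and the propagators compose to one propagator over the whole
distance. -/
theorem transfer_eval_zero (b : ℝ) : ∀ (L : List (ℝ × ℝ × ℝ)) (t : ℝ),
    (evalRingHom 0).mapMatrix (transfer b L t) = (evalRingHom 0).mapMatrix (propagator (t - b))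
  | [], t => rfl
  | (x, w, v) :: L, t => by
    have h1 : (evalRingHom 0).mapMatrix (jump w v) = 1 := by
      ext i j : 2
      fin_cases i <;> fin_cases j <;> simp [jump, jumpPoly_eval_zero]
    rw [transfer, map_mul, map_mul, h1, transfer_eval_zero b L x, mul_one, ← map_mul,
      ← propagator_add, sub_add_sub_cancel]

theorem transfer_eval_zero_apply (b : ℝ) (L : List (ℝ × ℝ × ℝ)) (t : ℝ) (i j : Fin 2) :
    (transfer b L t i j).eval 0 = (propagator (t - b) i j).eval 0 :=
  congrFun (congrFun (transfer_eval_zero b L t) i) j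

/-- The effect of a point mass and subsequent propagation on degrees. -/
theorem natDegree_propagate {A B q : ℝ[X]} (hA : A ≠ 0) (hBA : B.natDegree ≤ A.natDegree)
    (hq : 0 < q.natDegree) {α β : ℝ} :
    (C α * A + C β * (B - q * A)).natDegree ≤ q.natDegree + A.natDegree ∧
    (C α * A + C β * (B - q * A)).coeff (q.natDegree + A.natDegree) =
      -(β * (q.leadingCoeff * A.leadingCoeff)) := by
  have hq0 : q ≠ 0 := by
    rintro rfl
    simp at hq
  have h1 : (q * A).natDegree = q.natDegree + A.natDegree := natDegree_mul hq0 hA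
  constructor
  · refine (natDegree_add_le _ _).trans (max_le ?_ ?_)
    · exact (natDegree_C_mul_le _ _).trans (by omega)
    · refine (natDegree_C_mul_le _ _).trans ((natDegree_sub_le _ _).trans ?_)
      rw [h1]
      omega
  · rw [coeff_add, coeff_C_mul, coeff_C_mul, coeff_sub, coeff_mul_degree_add_degree,
      coeff_eq_zero_of_natDegree_lt (show A.natDegree < _ by omega),
      coeff_eq_zero_of_natDegree_lt (show B.natDegree < _ by omega)]
    ring

/-- Each nontrivial mass raises the degree by that of its `jumpPoly`: the new top coefficient of the
first row carries the factor 2 sinh of half the following distance, which is nonzero. Both columns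
gain equally, so a single n serves for j = 0 and j = 1. -/
theorem natDegree_transfer {b : ℝ} : ∀ {L : List (ℝ × ℝ × ℝ)} {t : ℝ}, IsString b L t →
    ∃ n : ℕ, (∀ j, transfer b L t 0 j ≠ 0 ∧ (transfer b L t 0 j).natDegree = n ∧
      (transfer b L t 1 j).natDegree ≤ n)
  | [], t, h => by
    have hs : Real.sinh ((t - b) / 2) ≠ 0 := (Real.sinh_pos_iff.2 (by
      have : b < t := h
      linarith)).ne'
    have hc := (Real.cosh_pos ((t - b) / 2)).ne'
    refine ⟨0, fun j => ?_⟩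
    fin_cases j <;> simp [transfer, propagator, hc, hs, -map_mul]
  | (x, w, v) :: L, t, h => by
    obtain ⟨n, hn⟩ := natDegree_transfer h.2.2.2
    refine ⟨(jumpPoly w v).natDegree + n, fun j => ?_⟩
    obtain ⟨h1, h2, h3⟩ := hn j
    have hs : Real.sinh ((t - x) / 2) ≠ 0 := (Real.sinh_pos_iff.2 (by linarith [h.1])).ne'
    have hq := natDegree_jumpPoly_pos h.2.2.1
    rw [← h2] at h3
    rw [transfer_cons_zero, transfer_cons_one, ← h2]
    obtain ⟨e1, e2⟩ := natDegree_propagate h1 h3 hq (α := Real.cosh ((t - x) / 2))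
      (β := 2 * Real.sinh ((t - x) / 2))
    have e3 : -(2 * Real.sinh ((t - x) / 2) * ((jumpPoly w v).leadingCoeff *
        (transfer b L x 0 j).leadingCoeff)) ≠ 0 := by
      have : (jumpPoly w v) ≠ 0 := by
        intro h0
        simp [h0] at hq
      simp [hs, h1, this]
    rw [← e2] at e3
    refine ⟨fun h0 => e3 (by rw [h0, coeff_zero]), le_antisymm e1 (le_natDegree_of_ne_zero e3),
      (natDegree_propagate h1 h3 hq).1⟩

/-- Both spectral conditions come from the kernel. At a zero of A the off-diagonal form vanishes,
contradicting its strict sign off the real axis; on the axis the diagonal form leaves only x A'(x)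
B(x). -/
theorem transfer_isWeylPair {b : ℝ} {L : List (ℝ × ℝ × ℝ)} {t : ℝ} (h : IsString b L t) :
    IsWeylPair (transfer b L t 0 1) (transfer b L t 1 1) (t - b) where
  eval_zero_left := by simp [transfer_eval_zero_apply, propagator]
  eval_zero_right := by simp [transfer_eval_zero_apply, propagator]
  natDegree_le := by
    obtain ⟨n, hn⟩ := natDegree_transfer h
    rw [(hn 1).2.1]
    exact (hn 1).2.2
  im_eq_zero z hz := by
    by_contra h0
    have := im_transfer_neg h z h0
    simp [hz] at this
  sign x hx := by
    have := diagKernel_transfer_pos h x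
    simp only [diagKernel, eval_add, eval_mul, eval_sub, hx, eval_X] at this
    linarith

/-! ### Uniqueness in the inverse problem for strings -/

/-- To top order only the contribution of the last mass survives, so the top coefficients of A and B
are in the ratio 2 sinh : cosh of half the final free distance. This locates the last mass. -/
theorem coeff_transfer_ratio {b x w v t : ℝ} {L : List (ℝ × ℝ × ℝ)}
    (h : IsString b ((x, w, v) :: L) t) :
    0 < (transfer b ((x, w, v) :: L) t 0 1).natDegree ∧
    Real.cosh ((t - x) / 2) * (transfer b ((x, w, v) :: L) t 0 1).leadingCoeff =
      2 * Real.sinh ((t - x) / 2) * (transfer b ((x, w, v) :: L) t 1 1).coeff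
        (transfer b ((x, w, v) :: L) t 0 1).natDegree := by
  obtain ⟨n, hn⟩ := natDegree_transfer h.2.2.2
  obtain ⟨h1, h2, h3⟩ := hn 1
  have hs : Real.sinh ((t - x) / 2) ≠ 0 := (Real.sinh_pos_iff.2 (by linarith [h.1])).ne'
  have hq := natDegree_jumpPoly_pos h.2.2.1
  rw [← h2] at h3
  rw [transfer_cons_zero, transfer_cons_one]
  obtain ⟨e1, e2⟩ := natDegree_propagate h1 h3 hq (α := Real.cosh ((t - x) / 2))
    (β := 2 * Real.sinh ((t - x) / 2))
  have e3 : -(2 * Real.sinh ((t - x) / 2) * ((jumpPoly w v).leadingCoeff *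
      (transfer b L x 0 1).leadingCoeff)) ≠ 0 := by
    have : (jumpPoly w v) ≠ 0 := by
      intro h0
      simp [h0] at hq
    simp [hs, h1, this]
  rw [← e2] at e3
  have e4 := le_antisymm e1 (le_natDegree_of_ne_zero e3)
  rw [leadingCoeff, e4, e2, (natDegree_propagate h1 h3 hq).2]
  exact ⟨by omega, by ring⟩

/-- A string is determined by the second column of its transfer matrix. -/
theorem transfer_injective {b : ℝ} : ∀ {L L' : List (ℝ × ℝ × ℝ)} {t : ℝ}, IsString b L t →
    IsString b L' t → transfer b L t 0 1 = transfer b L' t 0 1 →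
    transfer b L t 1 1 = transfer b L' t 1 1 → L = L'
  | [], [], _, _, _, _, _ => rfl
  | [], (x, w, v) :: L, t, _, h', hA, _ => by
    have := (coeff_transfer_ratio h').1
    rw [← hA] at this
    simp [transfer, propagator, -map_mul] at this
  | (x, w, v) :: L, [], t, h, _, hA, _ => by
    have := (coeff_transfer_ratio h).1
    rw [hA] at this
    simp [transfer, propagator, -map_mul] at this
  | (x, w, v) :: L, (x', w', v') :: L', t, h, h', hA, hB => by
    obtain ⟨p1, r1⟩ := coeff_transfer_ratio h
    obtain ⟨p2, r2⟩ := coeff_transfer_ratio h'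
    have hx : x = x' := by
      rw [← hA, ← hB] at r2
      have hl : (transfer b ((x, w, v) :: L) t 0 1).leadingCoeff ≠ 0 := by
        rw [Ne, leadingCoeff_eq_zero]
        intro h0
        simp [h0] at p1
      -- Cross-multiplying the two ratios and cancelling the common leading coefficient gives equal
      -- values of tanh.
      have e : Real.sinh ((t - x') / 2 - (t - x) / 2) = 0 := by
        rw [Real.sinh_sub]
        refine mul_right_cancel₀ hl ?_
        linear_combination Real.sinh ((t - x') / 2) * r1 - Real.sinh ((t - x) / 2) * r2
      rw [Real.sinh_eq_zero] at e
      linarith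
    subst hx
    rw [transfer_cons_zero, transfer_cons_zero] at hA
    rw [transfer_cons_one, transfer_cons_one] at hB
    have hcs : C (Real.cosh ((t - x) / 2)) * C (Real.cosh ((t - x) / 2))
        - C (Real.sinh ((t - x) / 2)) * C (Real.sinh ((t - x) / 2)) = (1 : ℝ[X]) := by
      rw [← C_mul, ← C_mul, ← C_sub, ← C_1]
      congr 1
      have := Real.cosh_sq ((t - x) / 2)
      linarith
    have h2 : C (2 * Real.sinh ((t - x) / 2)) = 2 * C (Real.sinh ((t - x) / 2)) := by
      rw [C_mul]
      rfl
    have h3 : 2 * C (Real.sinh ((t - x) / 2) / 2) = C (Real.sinh ((t - x) / 2)) := by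
      rw [show (2 : ℝ[X]) = C 2 from rfl, ← C_mul]
      congr 1
      ring
    obtain ⟨n, hn⟩ := natDegree_transfer h.2.2.2
    obtain ⟨n', hn'⟩ := natDegree_transfer h'.2.2.2
    obtain ⟨d1, d2, d3⟩ := hn 1
    obtain ⟨d1', d2', d3'⟩ := hn' 1
    -- The inverse of the last propagator is applied to both columns; the jump does not alter the
    -- first row.
    have hA' : transfer b L x 0 1 = transfer b L' x 0 1 := by
      rw [h2] at hA
      linear_combination (C (Real.cosh ((t - x) / 2))) * hA - 2 * C (Real.sinh ((t - x) / 2)) * hB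
        - (transfer b L x 0 1 - transfer b L' x 0 1) * hcs + C (Real.sinh ((t - x) / 2)) *
          (transfer b L x 0 1 - transfer b L' x 0 1) * h3
    have hB' : transfer b L x 1 1 - jumpPoly w v * transfer b L x 0 1 =
        transfer b L' x 1 1 - jumpPoly w' v' * transfer b L' x 0 1 := by
      rw [hA'] at hB ⊢
      have hc : C (Real.cosh ((t - x) / 2)) ≠ (0 : ℝ[X]) := by
        simp [(Real.cosh_pos _).ne']
      refine mul_left_cancel₀ hc ?_
      linear_combination hB
    rw [← hA'] at hB' d2'
    have hq : jumpPoly w v = jumpPoly w' v' := by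
      by_contra hne
      have hne' := sub_ne_zero.2 hne
      -- The right-hand side has degree at most that of the factor `transfer b L x 0 1`, so the
      -- difference of the two jump polynomials is constant; it vanishes at 0.
      have e : (jumpPoly w v - jumpPoly w' v') * transfer b L x 0 1 =
        transfer b L x 1 1 - transfer b L' x 1 1 := by linear_combination -hB'
      have e1 := natDegree_mul hne' d1
      have e2 := natDegree_sub_le (transfer b L x 1 1) (transfer b L' x 1 1)
      rw [← e, e1] at e2
      have e3 : (jumpPoly w v - jumpPoly w' v').natDegree = 0 := by
        have : max (transfer b L x 1 1).natDegree (transfer b L' x 1 1).natDegree ≤ n :=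
          max_le d3 (by omega)
        omega
      rw [natDegree_eq_zero] at e3
      obtain ⟨c, hc⟩ := e3
      have := congrArg (eval 0) hc
      simp only [eval_C, eval_sub, jumpPoly_eval_zero, sub_zero] at this
      exact hne' (by rw [← hc, this, C_0])
    obtain ⟨rfl, rfl⟩ := jumpPoly_injective hq
    rw [transfer_injective h.2.2.2 h'.2.2.2 hA' (by linear_combination hB')]

theorem IsWeylPair.derivative_ne_zero {A B : ℝ[X]} {d : ℝ} (h : IsWeylPair A B d) (x : ℝ)
    (hx : A.eval x = 0) : (derivative A).eval x ≠ 0 := by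
  intro h0
  have := h.sign x hx
  simp [h0] at this

theorem IsWeylPair.ne_zero {A B : ℝ[X]} {d : ℝ} (h : IsWeylPair A B d) : A ≠ 0 := by
  rintro rfl
  exact h.derivative_ne_zero 0 (by simp) (by simp)

/-! ### Existence in the inverse problem for strings -/

theorem natDegree_le_of_coeff_eq_zero {P : ℝ[X]} {n : ℕ} (h : P.natDegree ≤ n + 1)
    (h0 : P.coeff (n + 1) = 0) : P.natDegree ≤ n := by
  rw [natDegree_le_iff_coeff_eq_zero]
  intro m hm
  rcases (Nat.succ_le_of_lt hm).eq_or_lt with e | e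
  · rw [← e]
    exact h0
  · exact coeff_eq_zero_of_natDegree_lt (by omega)

/-- The point mass that has to be split off from a pair of polynomials. -/
theorem exists_jumpPoly {A B : ℝ[X]} {n : ℕ} (hn : 0 < n) (hB : B.natDegree ≤ n)
    (hB0 : B.coeff n ≠ 0) (hA : A.natDegree + 1 ≤ n)
    (h : A.coeff (n - 1) ≠ 0 ∨ (A.coeff (n - 1) = 0 ∧ 2 ≤ n ∧ A.coeff (n - 2) * B.coeff n < 0)) :
    ∃ w v : ℝ, 0 ≤ v ∧ (w ≠ 0 ∨ v ≠ 0) ∧ (B + jumpPoly w v * A).natDegree ≤ A.natDegree := by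
  by_cases hC : A.coeff (n - 1) = 0
  · obtain ⟨-, h2, hneg⟩ := h.resolve_left (not_not.2 hC)
    obtain ⟨m, rfl⟩ : ∃ m, n = m + 2 := ⟨n - 2, by omega⟩
    simp only [Nat.add_sub_cancel, show m + 2 - 1 = m + 1 from rfl] at hC hneg
    have hA0 : A.coeff m ≠ 0 := by
      intro h0
      simp [h0] at hneg
    have hAm : A.natDegree = m := le_antisymm (natDegree_le_of_coeff_eq_zero (by omega) hC)
      (le_natDegree_of_ne_zero hA0)
    set v := -(B.coeff (m + 2) / A.coeff m) with hv
    have hvpos : 0 < v := by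
      rw [hv, neg_pos]
      rcases lt_or_gt_of_ne hA0 with h1 | h1
      · exact div_neg_of_pos_of_neg (by nlinarith) h1
      · exact div_neg_of_neg_of_pos (by nlinarith) h1
    -- For m = 0 the truncated index m - 1 would pick up coefficient 0 of A, which does not
    -- contribute here; the conditional removes it.
    set w := -((B.coeff (m + 1) + v * A.coeff (m - 1) * (if m = 0 then 0 else 1)) / A.coeff m)
      with hw
    refine ⟨w, v, hvpos.le, Or.inr hvpos.ne', ?_⟩
    have e : jumpPoly w v * A = C w * (A * X) + C v * (A * X ^ 2) := by
      rw [jumpPoly]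
      ring
    rw [e, hAm]
    refine natDegree_le_of_coeff_eq_zero (natDegree_le_of_coeff_eq_zero ?_ ?_) ?_
    · refine (natDegree_add_le _ _).trans (max_le hB ((natDegree_add_le _ _).trans (max_le ?_ ?_)))
      · refine (natDegree_C_mul_le _ _).trans ((natDegree_mul_le).trans ?_)
        rw [natDegree_X, hAm]
        omega
      · refine (natDegree_C_mul_le _ _).trans ((natDegree_mul_le).trans ?_)
        rw [natDegree_X_pow, hAm]
    · simp only [coeff_add, coeff_C_mul, coeff_mul_X, coeff_mul_X_pow, hC]
      rw [hv]
      field_simp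
      ring
    · simp only [coeff_add, coeff_C_mul, coeff_mul_X]
      rcases m with _ | m
      · rw [coeff_mul_X_pow', if_neg (by omega), hw]
        field_simp
        simp
      · rw [show m + 1 + 1 = m + 2 from rfl, coeff_mul_X_pow, hw, if_neg (by omega)]
        field_simp
        simp
  · obtain ⟨m, rfl⟩ : ∃ m, n = m + 1 := ⟨n - 1, by omega⟩
    simp only [Nat.add_sub_cancel] at hC
    have hAm : A.natDegree = m := le_antisymm (by omega) (le_natDegree_of_ne_zero hC)
    refine ⟨-(B.coeff (m + 1) / A.coeff m), 0, le_rfl,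
      Or.inl (neg_ne_zero.2 (div_ne_zero hB0 hC)), ?_⟩
    have e : jumpPoly (-(B.coeff (m + 1) / A.coeff m)) 0 * A =
        C (-(B.coeff (m + 1) / A.coeff m)) * (A * X) := by
      rw [jumpPoly, C_0]
      ring
    rw [e, hAm]
    refine natDegree_le_of_coeff_eq_zero ?_ ?_
    · refine (natDegree_add_le _ _).trans (max_le hB ?_)
      refine (natDegree_C_mul_le _ _).trans ((natDegree_mul_le).trans ?_)
      rw [natDegree_X, hAm]
    · simp only [coeff_add, coeff_C_mul, coeff_mul_X]
      field_simp
      ring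

/-- Splitting off the last interval and the last point mass of a string. -/
theorem IsWeylPair.exists_step {A B : ℝ[X]} {d : ℝ} (hd : 0 < d) (h : IsWeylPair A B d)
    (hn : 0 < A.natDegree) :
    ∃ e w v : ℝ, ∃ A₁ B₁ : ℝ[X], 0 < e ∧ e < d ∧ 0 ≤ v ∧ (w ≠ 0 ∨ v ≠ 0) ∧
      A₁.natDegree < A.natDegree ∧ IsWeylPair A₁ B₁ (d - e) ∧
      A = C (Real.cosh (e / 2)) * A₁ + C (2 * Real.sinh (e / 2)) * (B₁ - jumpPoly w v * A₁) ∧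
      B = C (Real.sinh (e / 2) / 2) * A₁ + C (Real.cosh (e / 2)) * (B₁ - jumpPoly w v * A₁) := by
  set n := A.natDegree with hn'
  have hA0 := h.ne_zero
  have hder := h.derivative_ne_zero
  have hcard := card_roots_toFinset_eq_natDegree hA0 h.im_eq_zero hder
  set S := A.roots.toFinset with hS
  have hroot : ∀ i ∈ S, A.eval i = 0 := fun i hi =>
    (mem_roots'.1 (Multiset.mem_toFinset.1 hi)).2
  have hSne : S.Nonempty := by
    rw [← Finset.card_pos, hcard]
    exact hn
  have hlc : A.leadingCoeff ≠ 0 := leadingCoeff_ne_zero.2 hA0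
  -- This is the limit of B/A at infinity.
  set ρ := B.coeff n / A.leadingCoeff with hρ
  have hsh : 0 < Real.sinh (d / 2) := Real.sinh_pos_iff.2 (by linarith)
  have hBi : ∀ i ∈ S, 0 < i * (B.eval i / (derivative A).eval i) := fun i hi => by
    have h1 := h.sign i (hroot i hi)
    have h2 := hder i (hroot i hi)
    have e : i * (B.eval i / (derivative A).eval i) =
        i * (derivative A).eval i * B.eval i / (derivative A).eval i ^ 2 := by
      field_simp
    rw [e]
    positivity
  have hi0 : ∀ i ∈ S, i ≠ 0 := fun i hi h0 => by simpa [h0] using hBi i hi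
  -- the cofactors of `A`
  set E : ℝ → ℝ[X] := fun i => A /ₘ (X - C i) with hE
  have hEA : ∀ i ∈ S, (X - C i) * E i = A := fun i hi => X_sub_C_mul_divByMonic (hroot i hi)
  set r : ℝ → ℝ := fun i => B.eval i / (derivative A).eval i with hr
  -- Partial fractions of ρ - B/A, multiplied by A; the numbers r i are the residues of B/A, and i ·
  -- r i > 0 by the sign condition.
  have hG : C ρ * A - B = ∑ i ∈ S, C (-r i) * E i := by
    have hdeg : (C ρ * A - B).degree < A.natDegree := by
      obtain ⟨m, hm⟩ : ∃ m, A.natDegree = m + 1 := ⟨A.natDegree - 1, by omega⟩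
      have hle : (C ρ * A - B).natDegree ≤ m := by
        refine natDegree_le_of_coeff_eq_zero ?_ ?_
        · refine (natDegree_sub_le _ _).trans (max_le ((natDegree_C_mul_le _ _).trans hm.le) ?_)
          exact h.natDegree_le.trans hm.le
        · rw [coeff_sub, coeff_C_mul, ← hm, ← hn', hρ, coeff_natDegree]
          field_simp
          simp
      exact (degree_le_natDegree).trans_lt (by exact_mod_cast (by omega))
    have := eq_sum_divByMonic hcard hdeg hder
    rw [this]
    refine Finset.sum_congr rfl fun i hi => ?_
    rw [eval_sub, eval_mul, hroot i hi, mul_zero, zero_sub, neg_div]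
  -- From X/(X - i) = 1 + i/(X - i). The weights become i · r i, which are positive, so all later
  -- sign arguments use this form.
  have hGX : X * (C ρ * A - B) = C (-∑ i ∈ S, r i) * A + ∑ i ∈ S, C (-(i * r i)) * E i := by
    rw [hG, Finset.mul_sum, ← Finset.sum_neg_distrib, map_sum, Finset.sum_mul,
      ← Finset.sum_add_distrib]
    refine Finset.sum_congr rfl fun i hi => ?_
    conv_rhs => rw [← hEA i hi]
    simp only [map_neg, map_mul]
    ring
  have hEcoeff : ∀ i ∈ S, (E i).coeff (n - 1) = A.leadingCoeff := fun i hi => by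
    have h1 := congrArg (fun p => coeff p n) (hEA i hi)
    have h2 : (E i).coeff n = 0 := by
      refine coeff_eq_zero_of_degree_lt ?_
      rw [hn', ← degree_eq_natDegree hA0]
      exact degree_divByMonic_lt _ _ hA0 (by rw [degree_X_sub_C]; exact zero_lt_one)
    obtain ⟨m, hm⟩ : ∃ m, n = m + 1 := ⟨n - 1, by omega⟩
    simp only [sub_mul, coeff_sub, coeff_C_mul, h2] at h1
    rw [hm, coeff_X_mul] at h1
    rw [leadingCoeff, ← hn', hm, ← h1]
    simp
  -- At 0 each partial fraction contributes A(0) · (i · r i)/i² > 0. This inequality makes the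
  -- interval to be split off shorter than d.
  have hG0 : B.eval 0 < ρ * A.eval 0 := by
    have h1 := congrArg (eval 0) hG
    have h2 : ∀ i ∈ S, eval 0 (C (-r i) * E i) = A.eval 0 * (i * r i) / i ^ 2 := fun i hi => by
      have := congrArg (eval 0) (hEA i hi)
      simp only [eval_mul, eval_sub, eval_X, eval_C, zero_sub] at this ⊢
      rw [← this]
      have := hi0 i hi
      field_simp
    rw [eval_finsetSum, Finset.sum_congr rfl h2] at h1
    simp only [eval_sub, eval_mul, eval_C] at h1
    have h3 : 0 < ∑ i ∈ S, A.eval 0 * (i * r i) / i ^ 2 := by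
      refine Finset.sum_pos (fun i hi => ?_) hSne
      have e1 := hBi i hi
      have e2 := hi0 i hi
      rw [h.eval_zero_left]
      exact div_pos (mul_pos (by linarith) e1) (by positivity)
    linarith
  rw [h.eval_zero_left, h.eval_zero_right] at hG0
  -- Half the length of the last interval, chosen so that coth y = 2ρ; removing that interval then
  -- cancels the top coefficient of A.
  obtain ⟨y, ⟨hy0, hyd⟩, hy⟩ : ∃ y ∈ Set.Ioo 0 (d / 2), Real.cosh y - 2 * ρ * Real.sinh y = 0 := by
    have hc : ContinuousOn (fun y => Real.cosh y - 2 * ρ * Real.sinh y) (Set.Icc 0 (d / 2)) := by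
      fun_prop
    refine intermediate_value_Ioo' (by linarith) hc ⟨?_, ?_⟩
    · linarith
    · simp
  set c := Real.cosh y with hc
  set s := Real.sinh y with hs
  have hspos : 0 < s := Real.sinh_pos_iff.2 hy0
  have hcs : c ^ 2 = s ^ 2 + 1 := Real.cosh_sq y
  -- The inverse propagator of length 2y applied to (A, B).
  set A₁ := C c * A - C (2 * s) * B with hA₁
  set B' := C c * B - C (s / 2) * A with hB'
  have hA₁G : A₁ = C (2 * s) * (C ρ * A - B) := by
    rw [hA₁, show c = 2 * s * ρ by linarith, mul_sub, ← mul_assoc, ← C_mul]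
  have hB'A : C (2 * s) * B' = A - C c * A₁ := by
    refine Polynomial.funext fun x => ?_
    simp [hB', hA₁]
    linear_combination (eval x A) * hcs
  have hA₁deg : A₁.natDegree + 1 ≤ n := by
    have : ∀ i ∈ S, (C (-r i) * E i).natDegree ≤ n - 1 := fun i hi => by
      refine (natDegree_C_mul_le _ _).trans ?_
      rw [hE, natDegree_divByMonic _ (monic_X_sub_C i), natDegree_X_sub_C]
    have h2 := natDegree_sum_le_of_forall_le S _ this
    rw [← hG] at h2
    have h3 := (natDegree_C_mul_le (2 * s) (C ρ * A - B)).trans h2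
    rw [← hA₁G] at h3
    omega
  have hB'coeff : B'.coeff n = A.leadingCoeff / (2 * s) := by
    have h1 := congrArg (fun p => coeff p n) hB'A
    simp only [coeff_C_mul, coeff_sub, coeff_eq_zero_of_natDegree_lt (show A₁.natDegree < n by omega)]
      at h1
    rw [mul_zero, sub_zero, hn', coeff_natDegree, ← hn'] at h1
    rw [← h1]
    field_simp
  have hB'deg : B'.natDegree ≤ n :=
    (natDegree_sub_le _ _).trans (max_le ((natDegree_C_mul_le _ _).trans h.natDegree_le)
      (natDegree_C_mul_le _ _))
  have hpos : 0 < ∑ i ∈ S, i * r i := Finset.sum_pos hBi hSne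
  have hA₁c : A₁.coeff (n - 1) = -(2 * s * A.leadingCoeff * ∑ i ∈ S, r i) := by
    rw [hA₁G, coeff_C_mul, hG, finsetSum_coeff, Finset.mul_sum, Finset.mul_sum,
      ← Finset.sum_neg_distrib]
    refine Finset.sum_congr rfl fun i hi => ?_
    rw [coeff_C_mul, hEcoeff i hi]
    ring
  -- The coefficient n - 1 of A₁ is a multiple of ∑ r i. If that sum is zero, the next coefficient
  -- is governed by ∑ i · r i > 0 and has sign opposite to the top coefficient of B'; hence the
  -- split-off mass has v > 0.
  have hstep : A₁.coeff (n - 1) ≠ 0 ∨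
      (A₁.coeff (n - 1) = 0 ∧ 2 ≤ n ∧ A₁.coeff (n - 2) * B'.coeff n < 0) := by
    by_cases h0 : A₁.coeff (n - 1) = 0
    · refine Or.inr ⟨h0, ?_⟩
      have hr0 : ∑ i ∈ S, r i = 0 := by
        rw [hA₁c] at h0
        simpa [hspos.ne', hA0] using h0
      have h1 : (X * A₁).coeff (n - 1) = -(2 * s * A.leadingCoeff * ∑ i ∈ S, i * r i) := by
        rw [hA₁G, mul_left_comm, hGX, hr0, neg_zero, C_0, zero_mul, zero_add, coeff_C_mul,
          finsetSum_coeff, Finset.mul_sum, Finset.mul_sum, ← Finset.sum_neg_distrib]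
        refine Finset.sum_congr rfl fun i hi => ?_
        rw [coeff_C_mul, hEcoeff i hi]
        ring
      have h2 : 2 ≤ n := by
        by_contra! hlt
        rw [show n - 1 = 0 by omega, coeff_X_mul_zero] at h1
        have : 2 * s * A.leadingCoeff * ∑ i ∈ S, i * r i ≠ 0 :=
          mul_ne_zero (mul_ne_zero (by linarith) hlc) hpos.ne'
        exact this (by linarith)
      refine ⟨h2, ?_⟩
      rw [show n - 1 = (n - 2) + 1 by omega, coeff_X_mul] at h1
      rw [h1, hB'coeff]
      have : -(2 * s * A.leadingCoeff * ∑ i ∈ S, i * r i) * (A.leadingCoeff / (2 * s)) =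
          -(A.leadingCoeff ^ 2 * ∑ i ∈ S, i * r i) := by
        field_simp
      rw [this, neg_lt_zero]
      positivity
    · exact Or.inl h0
  have hB'0 : B'.coeff n ≠ 0 := by
    rw [hB'coeff]
    exact div_ne_zero hlc (by linarith)
  obtain ⟨w, v, hv, hwv, hdeg⟩ := exists_jumpPoly hn hB'deg hB'0 hA₁deg hstep
  have hXA₁ : ∀ x : ℝ, x * A₁.eval x = 2 * s * (-(∑ i ∈ S, r i) * A.eval x
      - ∑ i ∈ S, i * r i * (E i).eval x) := fun x => by
    have := congrArg (eval x) hGX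
    rw [hA₁G]
    simp only [eval_mul, eval_add, eval_C, eval_X, eval_finsetSum, eval_sub, neg_mul,
      Finset.sum_neg_distrib] at this ⊢
    linear_combination 2 * s * this
  refine ⟨2 * y, w, v, A₁, B' + jumpPoly w v * A₁, by linarith, by linarith, hv, hwv, by omega,
    ⟨?_, ?_, hdeg, ?_, ?_⟩, ?_, ?_⟩
  · rw [hA₁]
    simp only [eval_sub, eval_mul, eval_C, h.eval_zero_left, h.eval_zero_right]
    rw [show (d - 2 * y) / 2 = d / 2 - y by ring, Real.sinh_sub]
    ring
  · rw [hB']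
    simp only [eval_add, eval_sub, eval_mul, eval_C, h.eval_zero_left, h.eval_zero_right,
      jumpPoly_eval_zero]
    rw [show (d - 2 * y) / 2 = d / 2 - y by ring, Real.cosh_sub]
    ring
  · intro z hz
    by_contra him
    have hAz : aeval z A ≠ 0 := fun h0 => him (h.im_eq_zero z h0)
    have hzi : ∀ i : ℝ, z - i ≠ 0 := fun i h0 => him (by
      have := congrArg Complex.im h0
      simpa using this)
    have h1 := congrArg (aeval z) hGX
    have h2 : aeval z (C ρ * A - B) = 0 := by
      have := congrArg (aeval z) hA₁G
      rw [hz, map_mul, aeval_C] at this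
      refine (mul_eq_zero.1 this.symm).resolve_left ?_
      simpa using hspos.ne'
    rw [map_mul, h2, mul_zero, map_add, map_mul, map_sum] at h1
    have h3 : ∀ i ∈ S, aeval z (C (-(i * r i)) * E i) =
        aeval z A * (((-(i * r i) : ℝ) : ℂ) * (z - i)⁻¹) := fun i hi => by
      have e := congrArg (aeval z) (hEA i hi)
      rw [map_mul, map_sub, aeval_X, aeval_C] at e
      rw [← e, map_mul, aeval_C]
      have := hzi i
      simp only [Complex.coe_algebraMap]
      field_simp
    -- After division by A(z) the right-hand side is a real constant plus ∑ -(i · r i)/(z - i), a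
    -- Herglotz function, whose imaginary part has the strict sign of Im z and cannot vanish.
    rw [Finset.sum_congr rfl h3, ← Finset.mul_sum, aeval_C, mul_comm, ← mul_add] at h1
    have h4 := (mul_eq_zero.1 h1.symm).resolve_left hAz
    have h5 := congrArg Complex.im h4
    rw [Complex.add_im, Complex.im_sum] at h5
    have h6 : ∀ i ∈ S, (((-(i * r i) : ℝ) : ℂ) * (z - i)⁻¹).im =
        z.im * (i * r i / Complex.normSq (z - i)) := fun i _ => by
      rw [Complex.im_ofReal_mul, Complex.inv_im]
      simp
      ring
    rw [Finset.sum_congr rfl h6, ← Finset.mul_sum] at h5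
    have h7 : 0 < ∑ i ∈ S, i * r i / Complex.normSq (z - i) :=
      Finset.sum_pos (fun i hi => div_pos (hBi i hi) (Complex.normSq_pos.2 (hzi i))) hSne
    simp [him, h7.ne'] at h5
  · intro x hx
    -- A common zero of A and A₁ would be a zero of B as well, which the sign condition excludes.
    have hAx : A.eval x ≠ 0 := fun h0 => by
      have h1 : A₁.eval x = -(2 * s * B.eval x) := by
        rw [hA₁]
        simp [h0]
      have h2 := h.sign x h0
      rw [hx] at h1
      have : B.eval x = 0 := by
        have : 2 * s * B.eval x = 0 := by linarith
        simpa [hspos.ne'] using this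
      simp [this] at h2
    have hxi : ∀ i ∈ S, x - i ≠ 0 := fun i hi h0 => hAx (by
      rw [sub_eq_zero.1 h0]
      exact hroot i hi)
    have hBx : 2 * s * (B' + jumpPoly w v * A₁).eval x = A.eval x := by
      have := congrArg (eval x) hB'A
      simp only [eval_mul, eval_C, eval_sub, eval_add, hx] at this ⊢
      linarith
    have hEx : ∀ i ∈ S, (E i).eval x = A.eval x / (x - i) := fun i hi => by
      have := congrArg (eval x) (hEA i hi)
      rw [← this, eval_mul]
      have := hxi i hi
      simp only [eval_sub, eval_X, eval_C]
      field_simp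
    have hE'x : ∀ i ∈ S, (derivative (E i)).eval x =
        (derivative A).eval x / (x - i) - A.eval x / (x - i) ^ 2 := fun i hi => by
      have := congrArg (fun p => eval x (derivative p)) (hEA i hi)
      have hne := hxi i hi
      simp only [derivative_mul, derivative_sub, derivative_X, derivative_C, sub_zero, one_mul,
        eval_add, eval_mul, eval_sub, eval_X, eval_C, hEx i hi] at this
      rw [← this]
      field_simp
      ring
    -- The equation A₁(x) = 0 for the Herglotz function; differentiating that function in `h2`
    -- leaves a sum of squares with positive weights.
    have h1 : (∑ i ∈ S, r i) + ∑ i ∈ S, i * r i / (x - i) = 0 := by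
      have e := hXA₁ x
      rw [hx, mul_zero] at e
      have e2 : ∑ i ∈ S, i * r i * (E i).eval x = A.eval x * ∑ i ∈ S, i * r i / (x - i) := by
        rw [Finset.mul_sum]
        refine Finset.sum_congr rfl fun i hi => ?_
        rw [hEx i hi]
        ring
      rw [e2] at e
      have e3 : 2 * s * A.eval x * ((∑ i ∈ S, r i) + ∑ i ∈ S, i * r i / (x - i)) = 0 := by
        linear_combination e
      exact (mul_eq_zero.1 e3).resolve_left (mul_ne_zero (by linarith) hAx)
    have h2 : x * (derivative A₁).eval x = 2 * s * (A.eval x *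
        ∑ i ∈ S, i * r i / (x - i) ^ 2) := by
      have e := congrArg (fun p => eval x (derivative p)) hGX
      have e1 := congrArg (fun p => eval x (derivative p)) hA₁G
      have e0 := congrArg (eval x) hA₁G
      simp only [derivative_mul, derivative_add, derivative_C, zero_mul, zero_add, derivative_X,
        one_mul, eval_mul, eval_add, eval_C, eval_X, derivative_sum, eval_finsetSum] at e e1 e0
      rw [hx] at e0
      have e4 : (C ρ * A - B).eval x = 0 := by
        refine (mul_eq_zero.1 e0.symm).resolve_left (by linarith)
      have e2 : ∑ i ∈ S, -(i * r i) * (derivative (E i)).eval x =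
          -(derivative A).eval x * (∑ i ∈ S, i * r i / (x - i))
            + A.eval x * ∑ i ∈ S, i * r i / (x - i) ^ 2 := by
        rw [Finset.mul_sum, Finset.mul_sum, ← Finset.sum_add_distrib]
        refine Finset.sum_congr rfl fun i hi => ?_
        rw [hE'x i hi]
        ring
      rw [e2, e4] at e
      linear_combination x * e1 + 2 * s * e - 2 * s * (derivative A).eval x * h1
    have h3 : 0 < ∑ i ∈ S, i * r i / (x - i) ^ 2 := by
      refine Finset.sum_pos (fun i hi => ?_) hSne
      have := hBi i hi
      have := hxi i hi
      positivity
    rw [h2, show 2 * s * (A.eval x * ∑ i ∈ S, i * r i / (x - i) ^ 2)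
      * (B' + jumpPoly w v * A₁).eval x = A.eval x * (∑ i ∈ S, i * r i / (x - i) ^ 2) *
        (2 * s * (B' + jumpPoly w v * A₁).eval x) by ring, hBx]
    have : 0 < A.eval x ^ 2 := by positivity
    nlinarith
  · rw [show 2 * y / 2 = y by ring]
    refine Polynomial.funext fun x => ?_
    simp [hB', hA₁]
    linear_combination (-eval x A) * hcs
  · rw [show 2 * y / 2 = y by ring]
    refine Polynomial.funext fun x => ?_
    simp [hB', hA₁]
    linear_combination (-eval x B) * hcs

/-- Every Weyl pair is the second column of the transfer matrix of a string. -/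
theorem IsWeylPair.exists_string {A B : ℝ[X]} {b t : ℝ} (hbt : b < t)
    (h : IsWeylPair A B (t - b)) :
    ∃ L, IsString b L t ∧ transfer b L t 0 1 = A ∧ transfer b L t 1 1 = B := by
  induction hn : A.natDegree using Nat.strong_induction_on generalizing A B t with
  | _ n ih =>
    subst hn
    rcases Nat.eq_zero_or_pos A.natDegree with h0 | hpos
    · refine ⟨[], hbt, ?_, ?_⟩
      · rw [eq_C_of_natDegree_eq_zero h0, coeff_zero_eq_eval_zero, h.eval_zero_left]
        rfl
      · rw [eq_C_of_natDegree_eq_zero (Nat.le_zero.1 (h.natDegree_le.trans h0.le)),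
          coeff_zero_eq_eval_zero, h.eval_zero_right]
        rfl
    · obtain ⟨e, w, v, A₁, B₁, he, hed, hv, hwv, hdeg, hW, hA, hB⟩ :=
        h.exists_step (sub_pos.2 hbt) hpos
      obtain ⟨L, hL, hL1, hL2⟩ := ih _ hdeg (t := t - e) (by linarith)
        (by rwa [show t - e - b = t - b - e by ring]) rfl
      refine ⟨(t - e, w, v) :: L, ⟨by linarith, hv, hwv, hL⟩, ?_, ?_⟩
      · rw [transfer_cons_zero, hL1, hL2, sub_sub_cancel, ← hA]
      · rw [transfer_cons_one, hL1, hL2, sub_sub_cancel, ← hB]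

/-! ### Bands and gaps -/

/-- The positive zeros `w 0 < τ 0 < w 1 ≤ w 2 < τ 1 < w 3 ≤ ⋯` of `Δ` and of `Δ² - 1`. -/
structure Bands (Δ : ℝ[X]) (p : ℕ) (τ w : ℕ → ℝ) : Prop where
  root : ∀ i < p, Δ.eval (τ i) = 0
  lt_root : ∀ i < p, w (2 * i) < τ i
  root_lt : ∀ i < p, τ i < w (2 * i + 1)
  pos : ∀ k < 2 * p, 0 < w k
  gap_le : ∀ i, i + 1 < p → w (2 * i + 1) ≤ w (2 * i + 2)
  double : ∀ i, i + 1 < p → w (2 * i + 1) = w (2 * i + 2) → (derivative Δ).eval (w (2 * i + 1)) = 0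
  sq : ∀ k < 2 * p, Δ.eval (w k) ^ 2 = 1
  mem : ∀ x, 0 < x → Δ.eval x = 0 → ∃ i < p, τ i = x

theorem exists_abs_eval_eq_one_left {Δ : ℝ[X]} {x y : ℝ} (hxy : x ≤ y) (hx : 1 ≤ |Δ.eval x|)
    (hy : Δ.eval y = 0) : ∃ z, x ≤ z ∧ z < y ∧ |Δ.eval z| = 1 := by
  have hc : ContinuousOn (fun z => |Δ.eval z|) (Set.Icc x y) := by fun_prop
  obtain ⟨z, hz, h⟩ := intermediate_value_Icc' hxy hc ⟨by simp [hy], hx⟩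
  refine ⟨z, hz.1, lt_of_le_of_ne hz.2 ?_, h⟩
  rintro rfl
  simp [hy] at h

theorem exists_abs_eval_eq_one_right {Δ : ℝ[X]} {x y : ℝ} (hxy : x ≤ y) (hx : Δ.eval x = 0)
    (hy : 1 ≤ |Δ.eval y|) : ∃ z, x < z ∧ z ≤ y ∧ |Δ.eval z| = 1 := by
  have hc : ContinuousOn (fun z => |Δ.eval z|) (Set.Icc x y) := by fun_prop
  obtain ⟨z, hz, h⟩ := intermediate_value_Icc hxy hc ⟨by simp [hx], hy⟩
  refine ⟨z, lt_of_le_of_ne hz.1 ?_, hz.2, h⟩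
  rintro rfl
  simp [hx] at h

/-- Rolle's theorem gives a critical point between consecutive positive zeros of Δ, where |Δ| ≥ 1;
beyond the last zero Δ is unbounded, and Δ(0) > 1. The intermediate value theorem yields a point
with |Δ| = 1 on either side of each zero. That these are all the solutions is only seen later, by
counting. -/
theorem exists_bands {Δ : ℝ[X]} (h0 : 1 < Δ.eval 0)
    (hcrit : ∀ x : ℝ, (derivative Δ).eval x = 0 → 1 ≤ |Δ.eval x|) :
    ∃ p τ w, Bands Δ p τ w := by
  have hΔ : Δ ≠ 0 := by
    rintro rfl
    simp at h0
    linarith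
  set S := Δ.roots.toFinset.filter (0 < ·) with hS
  have hmem : ∀ x, x ∈ S ↔ 0 < x ∧ Δ.eval x = 0 := fun x => by
    simp [hS, hΔ, and_comm]
  set p := S.card
  set τ : ℕ → ℝ := fun i => if h : i < p then S.orderEmbOfFin rfl ⟨i, h⟩ else 0 with hτ
  have hτS : ∀ i < p, τ i ∈ S := fun i hi => by
    simp only [hτ, dif_pos hi]
    exact S.orderEmbOfFin_mem rfl _
  have hτlt : ∀ i j, i < j → j < p → τ i < τ j := fun i j hij hj => by
    simp only [hτ, dif_pos hj, dif_pos (hij.trans hj)]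
    exact (S.orderEmbOfFin rfl).strictMono hij
  have hsep : ∀ i, i < p → ∃ c, τ i ≤ c ∧ 1 ≤ |Δ.eval c| ∧
      (i + 1 < p → c ≤ τ (i + 1) ∧ (derivative Δ).eval c = 0) := fun i hi => by
    by_cases hi' : i + 1 < p
    · obtain ⟨c, hc, hc'⟩ := exists_deriv_eq_zero (f := fun x => Δ.eval x)
        (hτlt i (i + 1) (Nat.lt_succ_self i) hi') Δ.continuousOn
        (by rw [((hmem _).1 (hτS i hi)).2, ((hmem _).1 (hτS _ hi')).2])
      rw [Polynomial.deriv] at hc'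
      exact ⟨c, hc.1.le, hcrit c hc', fun _ => ⟨hc.2.le, hc'⟩⟩
    · have hdeg : 0 < Δ.degree := by
        rw [← natDegree_pos_iff_degree_pos]
        by_contra! h
        rw [Nat.le_zero] at h
        have := ((hmem _).1 (hτS i hi)).2
        rw [eq_C_of_natDegree_eq_zero h, eval_C, coeff_zero_eq_eval_zero] at this
        linarith
      obtain ⟨c, hc1, hc2⟩ := (((Δ.abs_tendsto_atTop hdeg).eventually_ge_atTop 1).and
        (eventually_ge_atTop (τ i))).exists
      exact ⟨c, hc2, hc1, fun h => (hi' h).elim⟩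
  choose! c hc1 hc2 hc3 using hsep
  have hβ : ∀ i, i < p → ∃ z, τ i < z ∧ z ≤ c i ∧ |Δ.eval z| = 1 := fun i hi =>
    exists_abs_eval_eq_one_right (hc1 i hi) ((hmem _).1 (hτS i hi)).2 (hc2 i hi)
  choose! β hβ1 hβ2 hβ3 using hβ
  have hα : ∀ i, i < p → ∃ z, (0 < z ∧ ∀ j, i = j + 1 → c j ≤ z) ∧ z < τ i ∧ |Δ.eval z| = 1 :=
      fun i hi => by
    rcases i with _ | i
    · have h1 : 1 ≤ |Δ.eval 0| := h0.le.trans (le_abs_self _)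
      obtain ⟨z, hz1, hz2, hz3⟩ := exists_abs_eval_eq_one_left ((hmem _).1 (hτS 0 hi)).1.le
        h1 ((hmem _).1 (hτS 0 hi)).2
      rcases hz1.eq_or_lt with rfl | hz1
      · rw [abs_of_pos (by linarith)] at hz3
        linarith
      · exact ⟨z, ⟨hz1, fun j hj => by omega⟩, hz2, hz3⟩
    · obtain ⟨z, hz1, hz2, hz3⟩ := exists_abs_eval_eq_one_left (hc3 i (by omega) hi).1
        (hc2 i (by omega)) ((hmem _).1 (hτS _ hi)).2
      refine ⟨z, ⟨lt_of_lt_of_le ?_ hz1, fun j hj => ?_⟩, hz2, hz3⟩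
      · exact ((hmem _).1 (hτS i (by omega))).1.trans_le (hc1 i (by omega))
      · obtain rfl : i = j := by omega
        exact hz1
  choose! α hα1 hα2 hα3 using hα
  have hw : ∀ k < 2 * p, ∃ i < p, k = 2 * i ∨ k = 2 * i + 1 := fun k hk =>
    ⟨k / 2, by omega, by omega⟩
  obtain ⟨w, e1, e2⟩ : ∃ w : ℕ → ℝ, (∀ i, w (2 * i) = α i) ∧ ∀ i, w (2 * i + 1) = β i :=
    ⟨fun k => if k % 2 = 0 then α (k / 2) else β (k / 2), fun i => by simp, fun i => by
      simp [show (2 * i + 1) / 2 = i by omega]⟩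
  refine ⟨p, τ, w,
    fun i hi => ((hmem _).1 (hτS i hi)).2, fun i hi => ?_, fun i hi => ?_, fun k hk => ?_,
    fun i hi => ?_, fun i hi => ?_, fun k hk => ?_, fun x hx hx0 => ?_⟩
  · rw [e1]
    exact hα2 i hi
  · rw [e2]
    exact hβ1 i hi
  · obtain ⟨i, hi, rfl | rfl⟩ := hw k hk
    · rw [e1]
      exact (hα1 i hi).1
    · rw [e2]
      exact ((hmem _).1 (hτS i hi)).1.trans (hβ1 i hi)
  · rw [e2, show 2 * i + 2 = 2 * (i + 1) by ring, e1]
    exact (hβ2 i (by omega)).trans ((hα1 (i + 1) hi).2 i rfl)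
  · rw [e2, show 2 * i + 2 = 2 * (i + 1) by ring, e1]
    intro h
    have h1 := hβ2 i (by omega)
    have h2 := (hα1 (i + 1) hi).2 i rfl
    -- Two coinciding edges are squeezed onto the critical point between them, so the zero of Δ² - 1
    -- is double.
    rw [le_antisymm h1 (by linarith)]
    exact (hc3 i (by omega) hi).2
  · obtain ⟨i, hi, rfl | rfl⟩ := hw k hk
    · rw [e1, ← sq_abs, hα3 i hi, one_pow]
    · rw [e2, ← sq_abs, hβ3 i hi, one_pow]
  · have : x ∈ Set.range (S.orderEmbOfFin rfl) := by
      rw [S.range_orderEmbOfFin rfl]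
      exact (hmem x).2 ⟨hx, hx0⟩
    obtain ⟨⟨i, hi⟩, rfl⟩ := this
    exact ⟨i, hi, dif_pos hi⟩

namespace Bands

variable {Δ : ℝ[X]} {p : ℕ} {τ w : ℕ → ℝ}

theorem lt (h : Bands Δ p τ w) {i : ℕ} (hi : i < p) : w (2 * i) < w (2 * i + 1) :=
  (h.lt_root i hi).trans (h.root_lt i hi)

theorem le_succ (h : Bands Δ p τ w) {k : ℕ} (hk : k + 1 < 2 * p) : w k ≤ w (k + 1) := by
  obtain ⟨i, rfl | rfl⟩ : ∃ i, k = 2 * i ∨ k = 2 * i + 1 := ⟨k / 2, by omega⟩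
  · exact (h.lt (by omega)).le
  · exact h.gap_le i (by omega)

theorem mono (h : Bands Δ p τ w) {k l : ℕ} (hkl : k ≤ l) (hl : l < 2 * p) : w k ≤ w l := by
  induction l, hkl using Nat.le_induction with
  | base => exact le_rfl
  | succ n hn ih => exact (ih (by omega)).trans (h.le_succ hl)

theorem root_strictMono (h : Bands Δ p τ w) {i j : ℕ} (hij : i < j) (hj : j < p) : τ i < τ j :=
  calc τ i < w (2 * i + 1) := h.root_lt i (by omega)
    _ ≤ w (2 * j) := h.mono (by omega) (by omega)
    _ < τ j := h.lt_root j hj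

theorem root_pos (h : Bands Δ p τ w) {i : ℕ} (hi : i < p) : 0 < τ i :=
  (h.pos (2 * i) (by omega)).trans (h.lt_root i hi)

/-- Bands are nondegenerate, so a value occurs among the edges at most twice, and twice only at a
closed gap, where the derivative vanishes too. The map g is the identity or negation, to cover both
half-axes. -/
theorem count_le (h : Bands Δ p τ w) {g : ℝ → ℝ} (hg : Function.Injective g) {Q : ℝ[X]}
    (hQ : Q ≠ 0) (hroot : ∀ k < 2 * p, Q.IsRoot (g (w k)))
    (hdouble : ∀ i, i + 1 < p → w (2 * i + 1) = w (2 * i + 2) →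
      (derivative Q).IsRoot (g (w (2 * i + 1)))) (x : ℝ) :
    ((Multiset.range (2 * p)).map fun k => g (w k)).count x ≤ Q.rootMultiplicity x := by
  rw [Multiset.count_map]
  change Multiset.card (Multiset.filter (fun k => x = g (w k)) (Finset.range (2 * p)).val) ≤ _
  rw [← Finset.filter_val, Finset.card_val]
  rcases (Finset.filter (fun k => x = g (w k)) (Finset.range (2 * p))).eq_empty_or_nonempty with h0 | h0
  · rw [h0]
    exact Nat.zero_le _
  set F := Finset.filter (fun k => x = g (w k)) (Finset.range (2 * p)) with hF
  have hFmem : ∀ k, k ∈ F ↔ k < 2 * p ∧ x = g (w k) := fun k => by simp [hF]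
  set k := F.min' h0
  obtain ⟨hk, hxk⟩ := (hFmem k).1 (F.min'_mem h0)
  have hrootx : Q.IsRoot x := hxk ▸ hroot k hk
  have hsub : ∀ l ∈ F, l = k ∨ (l = k + 1 ∧ k % 2 = 1) := fun l hl => by
    have hkl : k ≤ l := F.min'_le l hl
    obtain ⟨hl', hxl⟩ := (hFmem l).1 hl
    have hkl' : w k = w l := hg (hxk.symm.trans hxl)
    by_contra! hne
    obtain ⟨hne1, hne2⟩ := hne
    obtain ⟨i, hi⟩ : ∃ i, k = 2 * i ∨ k = 2 * i + 1 := ⟨k / 2, by omega⟩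
    rcases hi with hi | hi
    · have h1 := h.lt (show i < p by omega)
      have h2 := h.mono (show 2 * i + 1 ≤ l by omega) hl'
      rw [hi] at hkl'
      linarith
    · have h1 := h.lt (show i + 1 < p by omega)
      have h2 := h.mono (show 2 * (i + 1) + 1 ≤ l by omega) hl'
      have h3 := h.mono (show k ≤ 2 * (i + 1) by omega) (by omega)
      linarith
  by_cases hk1 : k + 1 ∈ F ∧ k % 2 = 1
  · have hcard : F.card ≤ 2 := by
      refine (Finset.card_le_card (t := {k, k + 1}) fun l hl => ?_).trans Finset.card_le_two
      rcases hsub l hl with h1 | h1 <;> simp [h1]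
    refine hcard.trans ((one_lt_rootMultiplicity_iff_isRoot hQ).2 ⟨hrootx, ?_⟩)
    obtain ⟨i, hi⟩ : ∃ i, k = 2 * i + 1 := ⟨k / 2, by omega⟩
    obtain ⟨hk2, hxk2⟩ := (hFmem _).1 hk1.1
    rw [hxk, hi]
    refine hdouble i (by omega) (hg ?_)
    rw [hi] at hxk hxk2
    rw [← hxk, hxk2]
  · have hcard : F.card ≤ 1 := by
      refine (Finset.card_le_card (t := {k}) fun l hl => ?_).trans (by simp)
      rcases hsub l hl with h1 | h1
      · simp [h1]
      · exact (hk1 ⟨h1.1 ▸ hl, h1.2⟩).elim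
    exact hcard.trans ((rootMultiplicity_pos hQ).2 hrootx)

/-- Positive points outside of the open bands. -/
theorem mul_nonneg_of_mem_gap (h : Bands Δ p τ w) {i k : ℕ} (hi : i ≤ p) (hk : k < p) {x : ℝ}
    (h1 : ∀ j, i = j + 1 → w (2 * j + 1) ≤ x) (h2 : i < p → x ≤ w (2 * i)) :
    0 ≤ (x - w (2 * k)) * (x - w (2 * k + 1)) := by
  have h3 := h.lt hk
  rcases lt_or_ge k i with hki | hki
  · obtain ⟨j, rfl⟩ : ∃ j, i = j + 1 := ⟨i - 1, by omega⟩
    have h4 := h1 j rfl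
    have h5 := h.mono (show 2 * k + 1 ≤ 2 * j + 1 by omega) (by omega)
    nlinarith
  · have h4 := h2 (by omega)
    have h5 := h.mono (show 2 * i ≤ 2 * k by omega) (by omega)
    nlinarith

/-- Index i stands for the interval between the bands i - 1 and i: the one next to the origin for i
= 0, the unbounded one for i = p. -/
theorem exists_index {x : ℝ}
    (hx : ∀ k < p, x ≤ w (2 * k) ∨ w (2 * k + 1) ≤ x) :
    ∃ i ≤ p, (∀ j, i = j + 1 → w (2 * j + 1) ≤ x) ∧ (i < p → x ≤ w (2 * i)) := by
  classical
  have hex : ∃ i, p ≤ i ∨ x < w (2 * i + 1) := ⟨p, Or.inl le_rfl⟩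
  refine ⟨Nat.find hex, Nat.find_min' hex (Or.inl le_rfl), fun j hj => ?_, fun hi => ?_⟩
  · have := Nat.find_min hex (m := j) (by omega)
    push Not at this
    exact this.2
  · have h1 := (Nat.find_spec hex).resolve_left (by omega)
    exact (hx _ hi).resolve_right (by linarith)

/-- `c ∏ (x - w k) ∏ (-x - w' k)` factorizes `Δ² - 1`. -/
def Factorizes (Δ : ℝ[X]) (p : ℕ) (w : ℕ → ℝ) (q : ℕ) (w' : ℕ → ℝ) : Prop :=
  ∃ c : ℝ, 0 < c ∧ ∀ x, Δ.eval x ^ 2 - 1 =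
    c * (∏ k ∈ Finset.range p, (x - w (2 * k)) * (x - w (2 * k + 1))) *
      ∏ k ∈ Finset.range q, (-x - w' (2 * k)) * (-x - w' (2 * k + 1))

variable {Δ' : ℝ[X]} {q : ℕ} {τ' w' : ℕ → ℝ}

theorem mirror_factor_pos (h' : Bands Δ' q τ' w') {x : ℝ} (hx : 0 ≤ x) {k : ℕ} (hk : k < q) :
    0 < (-x - w' (2 * k)) * (-x - w' (2 * k + 1)) := by
  have h1 := h'.pos (2 * k) (by omega)
  have h2 := h'.pos (2 * k + 1) (by omega)
  exact mul_pos_of_neg_of_neg (by linarith) (by linarith)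

theorem one_le_abs_eval (h : Bands Δ p τ w) (h' : Bands Δ' q τ' w')
    (hf : Factorizes Δ p w q w') {i : ℕ} (hi : i ≤ p) {x : ℝ} (hx : 0 ≤ x)
    (h1 : ∀ j, i = j + 1 → w (2 * j + 1) ≤ x) (h2 : i < p → x ≤ w (2 * i)) :
    1 ≤ |Δ.eval x| := by
  obtain ⟨c, hc, hf⟩ := hf
  have h3 : 0 ≤ Δ.eval x ^ 2 - 1 := by
    rw [hf]
    refine mul_nonneg (mul_nonneg hc.le (Finset.prod_nonneg fun k hk => ?_))
      (Finset.prod_nonneg fun k hk => ?_)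
    · exact h.mul_nonneg_of_mem_gap hi (Finset.mem_range.1 hk) h1 h2
    · exact (h'.mirror_factor_pos hx (Finset.mem_range.1 hk)).le
  exact (one_le_sq_iff_one_le_abs _).1 (by linarith)

/-- Inside an open band exactly one factor of Δ² - 1 is negative and all others are positive, so |Δ|
< 1 there. -/
theorem exists_gap_index (h : Bands Δ p τ w) (h' : Bands Δ' q τ' w')
    (hf : Factorizes Δ p w q w') {x : ℝ} (hx : 0 ≤ x) (h1 : 1 ≤ |Δ.eval x|) :
    ∃ i ≤ p, (∀ j, i = j + 1 → w (2 * j + 1) ≤ x) ∧ (i < p → x ≤ w (2 * i)) := by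
  obtain ⟨c, hc, hf⟩ := hf
  refine exists_index fun k hk => ?_
  by_contra! hcon
  have h3 : Δ.eval x ^ 2 - 1 < 0 := by
    rw [hf, ← Finset.mul_prod_erase _ _ (Finset.mem_range.2 hk)]
    have e1 : (x - w (2 * k)) * (x - w (2 * k + 1)) < 0 :=
      mul_neg_of_pos_of_neg (by linarith) (by linarith)
    have e2 : 0 < ∏ l ∈ (Finset.range p).erase k, (x - w (2 * l)) * (x - w (2 * l + 1)) := by
      refine Finset.prod_pos fun l hl => ?_
      rw [Finset.mem_erase, Finset.mem_range] at hl
      have h4 := h.lt hl.2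
      rcases lt_or_gt_of_ne hl.1 with hlk | hlk
      · have h5 := h.mono (show 2 * l + 1 ≤ 2 * k by omega) (by omega)
        exact mul_pos (by linarith) (by linarith)
      · have h5 := h.mono (show 2 * k + 1 ≤ 2 * l by omega) (by omega)
        exact mul_pos_of_neg_of_neg (by linarith) (by linarith)
    have e3 : 0 < ∏ k ∈ Finset.range q, (-x - w' (2 * k)) * (-x - w' (2 * k + 1)) :=
      Finset.prod_pos fun k hk => h'.mirror_factor_pos hx (Finset.mem_range.1 hk)
    exact mul_neg_of_neg_of_pos (mul_neg_of_pos_of_neg hc (mul_neg_of_neg_of_pos e1 e2)) e3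
  have := (one_le_sq_iff_one_le_abs _).2 h1
  linarith

end Bands

/-! ### Factorization of Δ² - 1 and labelling of the gaps -/

theorem prod_range_two_mul {M : Type*} [CommMonoid M] (f : ℕ → M) (p : ℕ) :
    ∏ k ∈ Finset.range (2 * p), f k = ∏ k ∈ Finset.range p, f (2 * k) * f (2 * k + 1) := by
  induction p with
  | zero => simp
  | succ p ih =>
    rw [show 2 * (p + 1) = 2 * p + 1 + 1 by ring, Finset.prod_range_succ, Finset.prod_range_succ,
      Finset.prod_range_succ, ih, mul_assoc]

theorem sort_coe_eq_self {r : ℝ → ℝ → Prop} [DecidableRel r] [IsTrans ℝ r] [Std.Antisymm r]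
    [Std.Total r] {l : List ℝ} (h : l.Pairwise r) : Multiset.sort (l : Multiset ℝ) r = l :=
  List.Perm.eq_of_pairwise' (Multiset.pairwise_sort _ _) h
    (Multiset.coe_eq_coe.1 (Multiset.sort_eq _ _))

/-- The polynomial `Δ(-z)`. -/
abbrev mirror (Δ : ℝ[X]) : ℝ[X] := Δ.comp (-X)

/-- A count: every zero of Δ is real, simple and nonzero and lies in one of the p + q bands, so
deg(Δ² - 1) ≤ 2(p + q). The 2(p + q) edges are zeros with at least the right multiplicity, so
nothing else is left. -/
theorem roots_sq_sub_one {Δ : ℝ[X]} (hsplit : Δ.Splits) (hnodup : Δ.roots.Nodup)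
    (h0 : 1 < Δ.eval 0) {p q : ℕ} {τ w τ' w' : ℕ → ℝ} (h : Bands Δ p τ w)
    (h' : Bands (mirror Δ) q τ' w') :
    (Δ ^ 2 - 1).roots =
      ((Multiset.range (2 * p)).map w + (Multiset.range (2 * q)).map fun k => -w' k) ∧
    (Δ ^ 2 - 1).roots.card = (Δ ^ 2 - 1).natDegree := by
  have hΔ : Δ ≠ 0 := by
    rintro rfl
    simp at h0
    linarith
  have hQ : Δ ^ 2 - 1 ≠ 0 := by
    intro hQ
    have := congrArg (eval 0) hQ
    simp at this
    nlinarith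
  have hle : (Δ ^ 2 - 1).natDegree ≤ ((Multiset.range (2 * p)).map w +
      (Multiset.range (2 * q)).map fun k => -w' k).card := by
    simp only [Multiset.card_add, Multiset.card_map, Multiset.card_range]
    have hdeg : (Δ ^ 2 - 1).natDegree ≤ 2 * Δ.natDegree := by
      refine (natDegree_sub_le _ _).trans (max_le ?_ (by simp))
      exact natDegree_pow_le
    have hcard : Δ.natDegree ≤ p + q := by
      rw [hsplit.natDegree_eq_card_roots, ← Multiset.toFinset_card_of_nodup hnodup]
      have hsub : Δ.roots.toFinset ⊆ (Finset.range p).image τ ∪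
          (Finset.range q).image fun k => -τ' k := fun x hx => by
        have hx0 : Δ.eval x = 0 := (mem_roots'.1 (Multiset.mem_toFinset.1 hx)).2
        rw [Finset.mem_union, Finset.mem_image, Finset.mem_image]
        rcases lt_trichotomy x 0 with hx' | hx' | hx'
        · obtain ⟨i, hi, hi'⟩ := h'.mem (-x) (by linarith) (by simpa using hx0)
          exact Or.inr ⟨i, Finset.mem_range.2 hi, by linarith⟩
        · rw [hx'] at hx0
          linarith
        · obtain ⟨i, hi, hi'⟩ := h.mem x hx' hx0
          exact Or.inl ⟨i, Finset.mem_range.2 hi, hi'⟩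
      refine (Finset.card_le_card hsub).trans ((Finset.card_union_le _ _).trans ?_)
      exact add_le_add (Finset.card_image_le.trans (by simp)) (Finset.card_image_le.trans (by simp))
    omega
  have heq := Multiset.eq_of_le_of_card_le (Multiset.le_iff_count.2 fun x => ?_)
    ((card_roots' _).trans hle)
  · exact ⟨heq.symm, le_antisymm (card_roots' _) (heq ▸ hle)⟩
  · rw [Multiset.count_add, count_roots]
    have h1 := h.count_le (g := id) Function.injective_id hQ (fun k hk => by
      simp [h.sq k hk]) (fun i hi hii => by
      simp [derivative_pow, h.double i hi hii]) x
    have h2 := h'.count_le (g := fun x => -x) neg_injective hQ (fun k hk => by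
      have := h'.sq k hk
      simp only [eval_comp, eval_neg, eval_X] at this
      simp [this]) (fun i hi hii => by
      have := h'.double i hi hii
      simp [derivative_comp] at this
      simp [derivative_pow, this]) x
    simp only [id] at h1
    rcases le_or_gt x 0 with hx | hx
    · rw [Multiset.count_eq_zero_of_notMem (a := x) (s := Multiset.map w _), zero_add]
      · exact h2
      · intro hm
        obtain ⟨k, hk, rfl⟩ := Multiset.mem_map.1 hm
        exact absurd (h.pos k (Multiset.mem_range.1 hk)) (not_lt.2 hx)
    · rw [Multiset.count_eq_zero_of_notMem (a := x) (s := Multiset.map (fun k => -w' k) _),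
        add_zero]
      · exact h1
      · intro hm
        obtain ⟨k, hk, rfl⟩ := Multiset.mem_map.1 hm
        have := h'.pos k (Multiset.mem_range.1 hk)
        linarith

theorem factorizes_of_roots {Δ : ℝ[X]} (h0 : 1 < Δ.eval 0) {p q : ℕ} {τ w τ' w' : ℕ → ℝ}
    (h : Bands Δ p τ w) (h' : Bands (mirror Δ) q τ' w')
    (hcard : (Δ ^ 2 - 1).roots.card = (Δ ^ 2 - 1).natDegree)
    (hroots : (Δ ^ 2 - 1).roots =
      (Multiset.range (2 * p)).map w + (Multiset.range (2 * q)).map fun k => -w' k) :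
    Bands.Factorizes Δ p w q w' := by
  have hprod : ∀ x, Δ.eval x ^ 2 - 1 = (Δ ^ 2 - 1).leadingCoeff *
      (∏ k ∈ Finset.range p, (x - w (2 * k)) * (x - w (2 * k + 1))) *
      ∏ k ∈ Finset.range q, (-x - w' (2 * k)) * (-x - w' (2 * k + 1)) := fun x => by
    have e1 := (splits_iff_card_roots.2 hcard).eval_eq_prod_roots x
    rw [hroots, Multiset.map_add, Multiset.prod_add, Multiset.map_map, Multiset.map_map] at e1
    have e2 : (Multiset.map ((fun y => x - y) ∘ w) (Multiset.range (2 * p))).prod =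
        ∏ k ∈ Finset.range (2 * p), (x - w k) := rfl
    have e3 : (Multiset.map ((fun y => x - y) ∘ fun k => -w' k) (Multiset.range (2 * q))).prod =
        ∏ k ∈ Finset.range (2 * q), (x - -w' k) := rfl
    rw [e2, e3, prod_range_two_mul, prod_range_two_mul] at e1
    simp only [eval_sub, eval_pow, eval_one] at e1
    rw [e1, mul_assoc]
    congr 2
    exact Finset.prod_congr rfl fun k _ => by ring
  refine ⟨_, ?_, hprod⟩
  have e := hprod 0
  have p1 : 0 < ∏ k ∈ Finset.range p, (0 - w (2 * k)) * (0 - w (2 * k + 1)) :=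
    Finset.prod_pos fun k hk => by
      rw [Finset.mem_range] at hk
      have h1 := h.pos (2 * k) (by omega)
      have h2 := h.pos (2 * k + 1) (by omega)
      exact mul_pos_of_neg_of_neg (by linarith) (by linarith)
  have p2 : 0 < ∏ k ∈ Finset.range q, (-0 - w' (2 * k)) * (-0 - w' (2 * k + 1)) :=
    Finset.prod_pos fun k hk => h'.mirror_factor_pos le_rfl (Finset.mem_range.1 hk)
  have p3 : 0 < Δ.eval 0 ^ 2 - 1 := by nlinarith
  rw [e, mul_assoc] at p3
  -- The sign of the leading coefficient is found at 0, where Δ² - 1 > 0 and both products are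
  -- positive.
  exact (pos_iff_pos_of_mul_pos p3).2 (mul_pos p1 p2)

/-- The position of the gaps relative to the zeros `T i` of `Δ`. -/
structure GapData (Δ : ℝ[X]) (T : ℤ → ℝ) : Prop where
  pos : ∀ i ∈ gapIndex Δ, 0 < i → 0 < T i
  neg : ∀ i ∈ gapIndex Δ, i < 0 → T i < 0
  lt_of_pos : ∀ i ∈ gapIndex Δ, 0 < i → ∀ x : ℝ, (x : EReal) ∈ gap Δ i → T i < x
  lt_of_neg : ∀ i ∈ gapIndex Δ, i < 0 → ∀ x : ℝ, (x : EReal) ∈ gap Δ i → x < T i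
  lt_next : ∀ i ∈ gapIndex Δ, 0 < i → ∀ x : ℝ, (x : EReal) ∈ gap Δ i →
    ∀ j ∈ gapIndex Δ, i < j → x < T j
  prev_lt : ∀ i ∈ gapIndex Δ, i < 0 → ∀ x : ℝ, (x : EReal) ∈ gap Δ i →
    ∀ j ∈ gapIndex Δ, j < i → T j < x
  one_le : ∀ i ∈ gapIndex Δ, ∀ x : ℝ, (x : EReal) ∈ gap Δ i → 1 ≤ |Δ.eval x|
  mem_gap : ∀ x : ℝ, 1 ≤ |Δ.eval x| →
    (∃ i ∈ gapIndex Δ, (x : EReal) ∈ gap Δ i) ∨ ∀ y ∈ Set.uIcc 0 x, 1 ≤ |Δ.eval y|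
  injOn : Set.InjOn T (gapIndex Δ)
  root_iff : ∀ x, Δ.eval x = 0 ↔ ∃ i ∈ gapIndex Δ, T i = x

/-- The edges of the bands are already monotone, so the sorted lists behind `lam` are these edges
themselves. The negative half-axis is the positive one for Δ(-z). -/
theorem exists_gapData {Δ : ℝ[X]} (hsplit : Δ.Splits) (hnodup : Δ.roots.Nodup)
    (h0 : 1 < Δ.eval 0) (hcrit : ∀ x : ℝ, (derivative Δ).eval x = 0 → 1 ≤ |Δ.eval x|) :
    ∃ T, GapData Δ T := by
  obtain ⟨p, τ, w, hb⟩ := exists_bands h0 hcrit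
  obtain ⟨q, τ', w', hb'⟩ := exists_bands (Δ := mirror Δ) (by simpa using h0) (fun x hx => by
    simpa using hcrit (-x) (by simpa [derivative_comp] using hx))
  obtain ⟨hroots, hcard⟩ := roots_sq_sub_one hsplit hnodup h0 hb hb'
  have hf := factorizes_of_roots h0 hb hb' hcard hroots
  have hf' : Bands.Factorizes (mirror Δ) q w' p w := by
    obtain ⟨c, hc, hf⟩ := hf
    refine ⟨c, hc, fun x => ?_⟩
    have := hf (-x)
    rw [neg_neg] at this
    rw [mul_right_comm, ← this]
    simp
  have hposZ : posZeros Δ = (List.range (2 * p)).map w := by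
    have e : (Δ ^ 2 - 1).roots.filter (fun x => 0 < x) =
        (((List.range (2 * p)).map w : List ℝ) : Multiset ℝ) := by
      rw [hroots, Multiset.filter_add, Multiset.filter_eq_self.2, Multiset.filter_eq_nil.2,
        add_zero]
      · rfl
      · intro x hx
        obtain ⟨k, hk, rfl⟩ := Multiset.mem_map.1 hx
        have := hb'.pos k (Multiset.mem_range.1 hk)
        linarith
      · intro x hx
        obtain ⟨k, hk, rfl⟩ := Multiset.mem_map.1 hx
        exact hb.pos k (Multiset.mem_range.1 hk)
    rw [posZeros, e]
    refine sort_coe_eq_self (List.pairwise_map.2 (List.Pairwise.imp_of_mem ?_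
      List.pairwise_lt_range))
    intro k l _ hl hkl
    exact hb.mono hkl.le (List.mem_range.1 hl)
  have hnegZ : negZeros Δ = (List.range (2 * q)).map fun k => -w' k := by
    have e : (Δ ^ 2 - 1).roots.filter (fun x => x < 0) =
        (((List.range (2 * q)).map (fun k => -w' k) : List ℝ) : Multiset ℝ) := by
      rw [hroots, Multiset.filter_add, Multiset.filter_eq_nil.2, Multiset.filter_eq_self.2,
        zero_add]
      · rfl
      · intro x hx
        obtain ⟨k, hk, rfl⟩ := Multiset.mem_map.1 hx
        have := hb'.pos k (Multiset.mem_range.1 hk)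
        linarith
      · intro x hx
        obtain ⟨k, hk, rfl⟩ := Multiset.mem_map.1 hx
        exact not_lt.2 (hb.pos k (Multiset.mem_range.1 hk)).le
    rw [negZeros, e]
    refine sort_coe_eq_self (List.pairwise_map.2 (List.Pairwise.imp_of_mem ?_
      List.pairwise_lt_range))
    intro k l _ hl hkl
    exact neg_le_neg (hb'.mono hkl.le (List.mem_range.1 hl))
  have hp : numPos Δ = p := by simp [numPos, hposZ]
  have hq : numNeg Δ = q := by simp [numNeg, hnegZ]
  have hlam : ∀ k : ℕ, k < 2 * p → lam Δ ((k : ℤ) + 1) = w k := fun k hk => by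
    rw [lam, if_pos (by omega), hposZ, show ((k : ℤ) + 1).natAbs - 1 = k by omega]
    simp [List.getD, hk]
  have hlam' : ∀ k : ℕ, k < 2 * q → lam Δ (-((k : ℤ) + 1)) = -w' k := fun k hk => by
    rw [lam, if_neg (by omega), hnegZ, show (-((k : ℤ) + 1)).natAbs - 1 = k by omega]
    simp [List.getD, hk]
  have hidx : ∀ i ∈ gapIndex Δ, (∃ n : ℕ, n < p ∧ i = n + 1) ∨ (∃ n : ℕ, n < q ∧ i = -(n + 1)) := by
    rintro i ⟨hi0, hi1, hi2⟩
    rw [hp] at hi2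
    rw [hq] at hi1
    rcases lt_or_gt_of_ne hi0 with h | h
    · exact Or.inr ⟨(-i - 1).toNat, by omega, by omega⟩
    · exact Or.inl ⟨(i - 1).toNat, by omega, by omega⟩
  have hidxp : ∀ n : ℕ, n < p → ((n : ℤ) + 1) ∈ gapIndex Δ := fun n hn =>
    ⟨by omega, by omega, by omega⟩
  have hidxq : ∀ n : ℕ, n < q → (-((n : ℤ) + 1)) ∈ gapIndex Δ := fun n hn =>
    ⟨by omega, by omega, by omega⟩
  -- Edges count from 0 and `lam` from 1, so the gap with index n + 1 starts at w (2n + 1) and ends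
  -- at w (2n + 2), or at ∞ if n + 1 = p.
  have hgap : ∀ n : ℕ, n < p → ∀ x : ℝ, (x : EReal) ∈ gap Δ ((n : ℤ) + 1) ↔
      w (2 * n + 1) ≤ x ∧ (n + 1 < p → x ≤ w (2 * (n + 1))) := fun n hn x => by
    have e1 : lam Δ (2 * ((n : ℤ) + 1)) = w (2 * n + 1) := by
      rw [← hlam (2 * n + 1) (by omega)]
      congr 1
    rw [gap, if_neg (by omega), hp]
    split_ifs with h1 h2
    · simp only [e1, Set.mem_Icc, EReal.coe_le_coe_iff, le_top, and_true]
      exact ⟨fun h => ⟨h, fun h3 => by omega⟩, fun h => h.1⟩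
    · omega
    · have e2 : lam Δ (2 * ((n : ℤ) + 1) + 1) = w (2 * (n + 1)) := by
        rw [← hlam (2 * (n + 1)) (by omega)]
        congr 1
      simp only [e1, e2, Set.mem_Icc, EReal.coe_le_coe_iff]
      exact ⟨fun h => ⟨h.1, fun _ => h.2⟩, fun h => ⟨h.1, h.2 (by omega)⟩⟩
  have hgap' : ∀ n : ℕ, n < q → ∀ x : ℝ, (x : EReal) ∈ gap Δ (-((n : ℤ) + 1)) ↔
      w' (2 * n + 1) ≤ -x ∧ (n + 1 < q → -x ≤ w' (2 * (n + 1))) := fun n hn x => by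
    have e1 : lam Δ (2 * (-((n : ℤ) + 1))) = -w' (2 * n + 1) := by
      rw [← hlam' (2 * n + 1) (by omega)]
      congr 1
    rw [gap, hq, hp]
    split_ifs with h1 h2 h3
    · simp only [e1, Set.mem_Icc, EReal.coe_le_coe_iff, bot_le, true_and]
      exact ⟨fun h => ⟨by linarith, fun h3 => by omega⟩, fun h => by linarith [h.1]⟩
    · omega
    · have e2 : lam Δ (2 * (-((n : ℤ) + 1)) - 1) = -w' (2 * (n + 1)) := by
        rw [← hlam' (2 * (n + 1)) (by omega)]
        congr 1
      simp only [e1, e2, Set.mem_Icc, EReal.coe_le_coe_iff]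
      exact ⟨fun h => ⟨by linarith [h.2], fun _ => by linarith [h.1]⟩,
        fun h => ⟨by linarith [h.2 (by omega)], by linarith [h.1]⟩⟩
    · omega
  obtain ⟨T, hT, hT'⟩ : ∃ T : ℤ → ℝ, (∀ n : ℕ, T ((n : ℤ) + 1) = τ n) ∧
      ∀ n : ℕ, T (-((n : ℤ) + 1)) = -τ' n := by
    refine ⟨fun i => if 0 < i then τ (i.natAbs - 1) else -τ' (i.natAbs - 1), fun n => ?_,
      fun n => ?_⟩
    · simp only [if_pos (show (0 : ℤ) < n + 1 by omega), show ((n : ℤ) + 1).natAbs - 1 = n by omega]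
    · simp only [if_neg (show ¬ (0 : ℤ) < -(n + 1) by omega),
        show (-((n : ℤ) + 1)).natAbs - 1 = n by omega]
  refine ⟨T, ⟨?_, ?_, ?_, ?_, ?_, ?_, ?_, ?_, ?_, ?_⟩⟩
  · intro i hi hi0
    rcases hidx i hi with ⟨n, hn, rfl⟩ | ⟨n, hn, rfl⟩
    · rw [hT]
      exact hb.root_pos hn
    · omega
  · intro i hi hi0
    rcases hidx i hi with ⟨n, hn, rfl⟩ | ⟨n, hn, rfl⟩
    · omega
    · rw [hT', neg_lt_zero]
      exact hb'.root_pos hn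
  · intro i hi hi0 x hx
    rcases hidx i hi with ⟨n, hn, rfl⟩ | ⟨n, hn, rfl⟩
    · rw [hT]
      exact (hb.root_lt n hn).trans_le ((hgap n hn x).1 hx).1
    · omega
  · intro i hi hi0 x hx
    rcases hidx i hi with ⟨n, hn, rfl⟩ | ⟨n, hn, rfl⟩
    · omega
    · rw [hT']
      linarith [(hb'.root_lt n hn).trans_le ((hgap' n hn x).1 hx).1]
  · intro i hi hi0 x hx j hj hij
    rcases hidx i hi with ⟨n, hn, rfl⟩ | ⟨n, hn, rfl⟩
    · rcases hidx j hj with ⟨m, hm, rfl⟩ | ⟨m, hm, rfl⟩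
      · rw [hT]
        calc x ≤ w (2 * (n + 1)) := ((hgap n hn x).1 hx).2 (by omega)
          _ ≤ w (2 * m) := hb.mono (by omega) (by omega)
          _ < τ m := hb.lt_root m hm
      · omega
    · omega
  · intro i hi hi0 x hx j hj hij
    rcases hidx i hi with ⟨n, hn, rfl⟩ | ⟨n, hn, rfl⟩
    · omega
    · rcases hidx j hj with ⟨m, hm, rfl⟩ | ⟨m, hm, rfl⟩
      · omega
      · rw [hT']
        have : -x < τ' m := calc -x ≤ w' (2 * (n + 1)) := ((hgap' n hn x).1 hx).2 (by omega)
          _ ≤ w' (2 * m) := hb'.mono (by omega) (by omega)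
          _ < τ' m := hb'.lt_root m hm
        linarith
  · intro i hi x hx
    rcases hidx i hi with ⟨n, hn, rfl⟩ | ⟨n, hn, rfl⟩
    · obtain ⟨h1, h2⟩ := (hgap n hn x).1 hx
      refine hb.one_le_abs_eval hb' hf (i := n + 1) (by omega)
        ((hb.pos _ (by omega)).le.trans h1) (fun j hj => ?_) h2
      obtain rfl : n = j := by omega
      exact h1
    · obtain ⟨h1, h2⟩ := (hgap' n hn x).1 hx
      have := hb'.one_le_abs_eval hb hf' (i := n + 1) (by omega)
        ((hb'.pos _ (by omega)).le.trans h1) (fun j hj => ?_) h2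
      · simpa using this
      · obtain rfl : n = j := by omega
        exact h1
  · intro x hx
    rcases le_total 0 x with h | h
    · obtain ⟨i, hi, h1, h2⟩ := hb.exists_gap_index hb' hf h hx
      rcases i with _ | n
      · refine Or.inr fun y hy => ?_
        rw [Set.uIcc_of_le h] at hy
        exact hb.one_le_abs_eval hb' hf (i := 0) (by omega) hy.1 (fun j hj => by omega)
          (fun h3 => hy.2.trans (h2 h3))
      · exact Or.inl ⟨_, hidxp n (by omega), (hgap n (by omega) x).2 ⟨h1 n rfl, h2⟩⟩
    · obtain ⟨i, hi, h1, h2⟩ := hb'.exists_gap_index hb hf' (neg_nonneg.2 h) (by simpa using hx)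
      rcases i with _ | n
      · refine Or.inr fun y hy => ?_
        rw [Set.uIcc_of_ge h] at hy
        simpa using hb'.one_le_abs_eval hb hf' (i := 0) (x := -y) (by omega)
          (neg_nonneg.2 hy.2) (fun j hj => by omega)
          (fun h3 => (neg_le_neg hy.1).trans (h2 h3))
      · exact Or.inl ⟨_, hidxq n (by omega), (hgap' n (by omega) x).2 ⟨h1 n rfl, h2⟩⟩
  · intro i hi j hj hij
    rcases hidx i hi with ⟨n, hn, rfl⟩ | ⟨n, hn, rfl⟩ <;>
    rcases hidx j hj with ⟨m, hm, rfl⟩ | ⟨m, hm, rfl⟩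
    · rw [hT, hT] at hij
      rcases lt_trichotomy n m with h | h | h
      · exact absurd hij (hb.root_strictMono h hm).ne
      · rw [h]
      · exact absurd hij (hb.root_strictMono h hn).ne'
    · rw [hT, hT'] at hij
      linarith [hb.root_pos hn, hb'.root_pos hm]
    · rw [hT, hT'] at hij
      linarith [hb.root_pos hm, hb'.root_pos hn]
    · rw [hT', hT', neg_inj] at hij
      rcases lt_trichotomy n m with h | h | h
      · exact absurd hij (hb'.root_strictMono h hm).ne
      · rw [h]
      · exact absurd hij (hb'.root_strictMono h hn).ne'
  · intro x
    constructor
    · intro hx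
      rcases lt_trichotomy x 0 with h | h | h
      · obtain ⟨n, hn, hn'⟩ := hb'.mem (-x) (by linarith) (by simpa using hx)
        exact ⟨_, hidxq n hn, by rw [hT', hn', neg_neg]⟩
      · rw [h] at hx
        linarith
      · obtain ⟨n, hn, hn'⟩ := hb.mem x h hx
        exact ⟨_, hidxp n hn, by rw [hT, hn']⟩
    · rintro ⟨i, hi, rfl⟩
      rcases hidx i hi with ⟨n, hn, rfl⟩ | ⟨n, hn, rfl⟩
      · rw [hT]
        exact hb.root n hn
      · rw [hT']
        simpa using hb'.root n hn

/-! ### The equation `f'' = k² f` on an interval -/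

theorem eq_of_hasDerivAt_zero {E : Type*} [NormedAddCommGroup E] [NormedSpace ℝ E] {F : ℝ → E}
    {p r s t : ℝ} (hF : ∀ x ∈ Set.Ioo p r, HasDerivAt F 0 x) (hs : s ∈ Set.Ioo p r)
    (ht : t ∈ Set.Ioo p r) : F t = F s := by
  wlog hst : s ≤ t generalizing s t
  · exact (this ht hs (le_of_not_ge hst)).symm
  have hsub : ∀ x ∈ Set.Icc s t, x ∈ Set.Ioo p r := fun x hx =>
    ⟨hs.1.trans_le hx.1, hx.2.trans_lt ht.2⟩
  exact constant_of_has_deriv_right_zero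
    (fun x hx => (hF x (hsub x hx)).continuousAt.continuousWithinAt)
    (fun x hx => (hF x (hsub x ⟨hx.1, hx.2.le⟩)).hasDerivWithinAt) t ⟨hst, le_rfl⟩

theorem hasDerivAt_cosh_mul (k s x : ℝ) :
    HasDerivAt (fun x => Real.cosh (k * (x - s))) (k * Real.sinh (k * (x - s))) x := by
  have h : HasDerivAt (fun x => k * (x - s)) k x := by
    simpa using ((hasDerivAt_id x).sub_const s).const_mul k
  simpa [mul_comm] using h.cosh

theorem hasDerivAt_sinh_mul (k s x : ℝ) :
    HasDerivAt (fun x => Real.sinh (k * (x - s))) (k * Real.cosh (k * (x - s))) x := by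
  have h : HasDerivAt (fun x => k * (x - s)) k x := by
    simpa using ((hasDerivAt_id x).sub_const s).const_mul k
  simpa [mul_comm] using h.sinh

section Hyperbolic

variable {E : Type*} [NormedAddCommGroup E] [NormedSpace ℝ E] {k : ℝ} {f g : ℝ → E} {p r : ℝ}

/-- Transporting the data at a variable point x to the fixed point t gives a quantity independent of
x; it is compared at x = s and x = t. -/
theorem hyperbolic_of_hasDerivAt (hk : k ≠ 0)
    (hf : ∀ x ∈ Set.Ioo p r, HasDerivAt f (g x) x)
    (hg : ∀ x ∈ Set.Ioo p r, HasDerivAt g (k ^ 2 • f x) x) {s t : ℝ} (hs : s ∈ Set.Ioo p r)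
    (ht : t ∈ Set.Ioo p r) :
    f t = Real.cosh (k * (t - s)) • f s + (Real.sinh (k * (t - s)) / k) • g s ∧
    g t = (k * Real.sinh (k * (t - s))) • f s + Real.cosh (k * (t - s)) • g s := by
  have e : ∀ x, k * (t - x) = -(k * (x - t)) := fun x => by ring
  constructor
  · have h := eq_of_hasDerivAt_zero (p := p) (r := r) (s := s) (t := t)
      (F := fun x => Real.cosh (k * (x - t)) • f x - (Real.sinh (k * (x - t)) / k) • g x)
      (fun x hx => by
        have := ((hasDerivAt_cosh_mul k t x).smul (hf x hx)).sub
          (((hasDerivAt_sinh_mul k t x).div_const k).smul (hg x hx))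
        refine this.congr_deriv ?_
        rw [smul_smul, show Real.sinh (k * (x - t)) / k * k ^ 2 = k * Real.sinh (k * (x - t)) by
          field_simp, show k * Real.cosh (k * (x - t)) / k = Real.cosh (k * (x - t)) by
          field_simp]
        abel) hs ht
    simp only [sub_self, mul_zero, Real.cosh_zero, Real.sinh_zero, zero_div, zero_smul, sub_zero,
      one_smul] at h
    rw [h, e s, Real.cosh_neg, Real.sinh_neg, neg_div, neg_smul, sub_eq_add_neg]
  · have h := eq_of_hasDerivAt_zero (p := p) (r := r) (s := s) (t := t)
      (F := fun x => Real.cosh (k * (x - t)) • g x - (k * Real.sinh (k * (x - t))) • f x)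
      (fun x hx => by
        have := ((hasDerivAt_cosh_mul k t x).smul (hg x hx)).sub
          (((hasDerivAt_sinh_mul k t x).const_mul k).smul (hf x hx))
        refine this.congr_deriv ?_
        rw [smul_smul, show Real.cosh (k * (x - t)) * k ^ 2 = k * (k * Real.cosh (k * (x - t))) by
          ring]
        abel) hs ht
    simp only [sub_self, mul_zero, Real.cosh_zero, Real.sinh_zero, zero_smul, sub_zero,
      one_smul] at h
    rw [h, e s, Real.cosh_neg, Real.sinh_neg, mul_neg, neg_smul]
    abel

/-- Propagation from the left to the right endpoint of an interval. -/
theorem hyperbolic_endpoints (hk : k ≠ 0) (hpr : p < r) (hfc : Continuous f)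
    (hf : ∀ x ∈ Set.Ioo p r, HasDerivAt f (g x) x)
    (hg : ∀ x ∈ Set.Ioo p r, HasDerivAt g (k ^ 2 • f x) x) {β γ : E}
    (hβ : Tendsto g (𝓝[>] p) (𝓝 β)) (hγ : Tendsto g (𝓝[<] r) (𝓝 γ)) :
    f r = Real.cosh (k * (r - p)) • f p + (Real.sinh (k * (r - p)) / k) • β ∧
    γ = (k * Real.sinh (k * (r - p))) • f p + Real.cosh (k * (r - p)) • β := by
  have hmem : ∀ᶠ s in 𝓝[>] p, s ∈ Set.Ioo p r := Ioo_mem_nhdsGT hpr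
  have hmem' : ∀ᶠ s in 𝓝[<] r, s ∈ Set.Ioo p r := Ioo_mem_nhdsLT hpr
  have hcosh : ∀ t : ℝ, Tendsto (fun s => Real.cosh (k * (t - s))) (𝓝[>] p)
      (𝓝 (Real.cosh (k * (t - p)))) := fun t =>
    (Continuous.tendsto (by fun_prop) p).mono_left nhdsWithin_le_nhds
  have hsinh : ∀ t : ℝ, Tendsto (fun s => Real.sinh (k * (t - s))) (𝓝[>] p)
      (𝓝 (Real.sinh (k * (t - p)))) := fun t =>
    (Continuous.tendsto (by fun_prop) p).mono_left nhdsWithin_le_nhds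
  have hfp : Tendsto f (𝓝[>] p) (𝓝 (f p)) := (hfc.tendsto p).mono_left nhdsWithin_le_nhds
  have key : ∀ t ∈ Set.Ioo p r,
      f t = Real.cosh (k * (t - p)) • f p + (Real.sinh (k * (t - p)) / k) • β ∧
      g t = (k * Real.sinh (k * (t - p))) • f p + Real.cosh (k * (t - p)) • β := fun t ht => by
    constructor
    · refine tendsto_nhds_unique (tendsto_const_nhds (f := 𝓝[>] p)) ?_
      refine (((hcosh t).smul hfp).add (((hsinh t).div_const k).smul hβ)).congr' ?_
      filter_upwards [hmem] with s hs
      exact ((hyperbolic_of_hasDerivAt hk hf hg hs ht).1).symm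
    · refine tendsto_nhds_unique (tendsto_const_nhds (f := 𝓝[>] p)) ?_
      refine ((((hsinh t).const_mul k).smul hfp).add ((hcosh t).smul hβ)).congr' ?_
      filter_upwards [hmem] with s hs
      exact ((hyperbolic_of_hasDerivAt hk hf hg hs ht).2).symm
  constructor
  · refine tendsto_nhds_unique ((hfc.tendsto r).mono_left (nhdsWithin_le_nhds (s := Set.Iio r))) ?_
    refine Tendsto.congr' (f₁ := fun t => Real.cosh (k * (t - p)) • f p +
      (Real.sinh (k * (t - p)) / k) • β) ?_
      ((Continuous.tendsto (by fun_prop) r).mono_left nhdsWithin_le_nhds)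
    filter_upwards [hmem'] with t ht
    exact (key t ht).1.symm
  · refine tendsto_nhds_unique hγ ?_
    refine Tendsto.congr' (f₁ := fun t => (k * Real.sinh (k * (t - p))) • f p +
      Real.cosh (k * (t - p)) • β) ?_
      ((Continuous.tendsto (by fun_prop) r).mono_left nhdsWithin_le_nhds)
    filter_upwards [hmem'] with t ht
    exact (key t ht).2.symm

end Hyperbolic

/-! ### The distribution `ω` -/

theorem memH1loc_of_locallyLipschitz {f : ℝ → ℝ} (hf : LocallyLipschitz f) : MemH1loc f := by
  refine ⟨fun x y => ?_, fun x => ?_⟩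
  · obtain ⟨K, hK⟩ := (hf.locallyLipschitzOn (s := Set.uIcc x y)).exists_lipschitzOnWith_of_compact
      isCompact_uIcc
    exact hK.absolutelyContinuousOnInterval
  · obtain ⟨K, t, ht, hK⟩ := hf x
    obtain ⟨ε, hε, hball⟩ := Metric.nhds_basis_ball.mem_iff.1 ht
    refine ⟨Metric.ball x ε, Metric.ball_mem_nhds x hε, ?_⟩
    refine Measure.integrableOn_of_bounded (M := (K : ℝ) ^ 2) measure_ball_lt_top.ne
      ((measurable_deriv f).pow_const 2).aestronglyMeasurable ?_
    refine (ae_restrict_iff' measurableSet_ball).2 (Eventually.of_forall fun y hy => ?_)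
    have h1 := norm_deriv_le_of_lipschitzOn (Metric.isOpen_ball.mem_nhds hy) (hK.mono hball)
    rw [norm_pow]
    exact pow_le_pow_left₀ (norm_nonneg _) h1 2

theorem MemH1loc.continuous {f : ℝ → ℝ} (hf : MemH1loc f) : Continuous f := by
  refine continuous_iff_continuousAt.2 fun x => ?_
  have := (hf.1 (x - 1) (x + 1)).continuousOn
  rw [Set.uIcc_of_le (by linarith)] at this
  exact this.continuousAt (Icc_mem_nhds (by linarith) (by linarith))

theorem MemH1loc.locallyIntegrable_mul {f g : ℝ → ℝ} (hf : MemH1loc f) (hg : MemH1loc g) :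
    LocallyIntegrable fun x => deriv f x * deriv g x := by
  refine (hf.2.add hg.2).mono
    ((measurable_deriv f).mul (measurable_deriv g)).aestronglyMeasurable
    (Eventually.of_forall fun x => ?_)
  simp only [Pi.add_apply, Real.norm_eq_abs]
  rw [abs_of_nonneg (a := deriv f x ^ 2 + deriv g x ^ 2) (by positivity), abs_le]
  constructor <;> nlinarith [sq_nonneg (deriv f x + deriv g x), sq_nonneg (deriv f x - deriv g x)]

/-- Splitting `ω(h)` at a point. -/
theorem omega_eq_add {u h : ℝ → ℝ} (hu : MemH1loc u) (hh : MemH1loc h) {r x e : ℝ} (hrx : r ≤ x)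
    (hxe : x ≤ e) (hs : tsupport h ⊆ Set.Icc r e) :
    omega u h = ((∫ t in r..x, u t * h t) + ∫ t in r..x, deriv u t * deriv h t) +
      ((∫ t in x..e, u t * h t) + ∫ t in x..e, deriv u t * deriv h t) := by
  have h1 : LocallyIntegrable fun t => u t * h t :=
    (hu.continuous.mul hh.continuous).locallyIntegrable
  have h2 := hu.locallyIntegrable_mul hh
  have hI : ∀ F : ℝ → ℝ, LocallyIntegrable F → (∀ t, t ∉ tsupport h → F t = 0) →
      ∫ t, F t = (∫ t in r..x, F t) + ∫ t in x..e, F t := fun F hF h0 => by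
    rw [intervalIntegral.integral_add_adjacent_intervals
      (hF.integrableOn_isCompact isCompact_uIcc).intervalIntegrable
      (hF.integrableOn_isCompact isCompact_uIcc).intervalIntegrable,
      intervalIntegral.integral_of_le (hrx.trans hxe), ← integral_Icc_eq_integral_Ioc,
      setIntegral_eq_integral_of_forall_compl_eq_zero]
    exact fun t ht => h0 t fun h3 => ht (hs h3)
  rw [omega, hI _ h1 (fun t ht => by rw [image_eq_zero_of_notMem_tsupport ht, mul_zero]),
    hI _ h2 (fun t ht => by rw [deriv_of_notMem_tsupport ht, mul_zero])]
  ring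

theorem hasDerivAt_hyperbolic (x A B t : ℝ) :
    HasDerivAt (fun t => A * Real.cosh (t - x) + B * Real.sinh (t - x))
      (A * Real.sinh (t - x) + B * Real.cosh (t - x)) t := by
  have h1 := hasDerivAt_cosh_mul 1 x t
  have h2 := hasDerivAt_sinh_mul 1 x t
  simp only [one_mul] at h1 h2
  exact (h1.const_mul A).add (h2.const_mul B)

theorem hasDerivAt_hyperbolic' (x A B t : ℝ) :
    HasDerivAt (fun t => A * Real.sinh (t - x) + B * Real.cosh (t - x))
      (A * Real.cosh (t - x) + B * Real.sinh (t - x)) t := by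
  simpa only [add_comm] using hasDerivAt_hyperbolic x B A t

/-- Integration by parts against a solution of `w'' = w`. -/
theorem integral_hyperbolic {f w : ℝ → ℝ} {p r x A B : ℝ} (hpr : p ≤ r) (hf : MemH1loc f)
    (hw : ∀ t ∈ Set.Icc p r, w t = A * Real.cosh (t - x) + B * Real.sinh (t - x)) :
    (∫ t in p..r, f t * w t) + ∫ t in p..r, deriv f t * deriv w t =
      f r * (A * Real.sinh (r - x) + B * Real.cosh (r - x)) -
        f p * (A * Real.sinh (p - x) + B * Real.cosh (p - x)) := by
  set W' : ℝ → ℝ := fun t => A * Real.sinh (t - x) + B * Real.cosh (t - x) with hW'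
  have hAC : AbsolutelyContinuousOnInterval W' p r := by
    have : ContDiff ℝ 1 W' := by
      rw [hW']
      fun_prop
    exact this.contDiffOn.absolutelyContinuousOnInterval
  have e1 : ∫ t in p..r, f t * w t = ∫ t in p..r, f t * deriv W' t := by
    refine intervalIntegral.integral_congr_Ioo_of_le hpr fun t ht => ?_
    rw [hw t (Set.Ioo_subset_Icc_self ht), (hasDerivAt_hyperbolic' x A B t).deriv]
  have e2 : ∫ t in p..r, deriv f t * deriv w t = ∫ t in p..r, deriv f t * W' t := by
    refine intervalIntegral.integral_congr_Ioo_of_le hpr fun t ht => ?_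
    have : w =ᶠ[𝓝 t] fun t => A * Real.cosh (t - x) + B * Real.sinh (t - x) := by
      filter_upwards [Ioo_mem_nhds ht.1 ht.2] with s hs
      exact hw s (Set.Ioo_subset_Icc_self hs)
    rw [this.deriv_eq, (hasDerivAt_hyperbolic x A B t).deriv]
  rw [e1, e2, (hf.1 p r).integral_mul_deriv_eq_deriv_mul hAC]
  ring

/-- Near `x`, the function `u` solves `u'' = u` on both sides, with one-sided derivatives `β` and
`γ` at `x`. -/
def HasSlopes (u : ℝ → ℝ) (x β γ : ℝ) : Prop :=
  ∃ ε > 0, (∀ t ∈ Set.Icc (x - ε) x, u t = u x * Real.cosh (t - x) + β * Real.sinh (t - x)) ∧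
    ∀ t ∈ Set.Icc x (x + ε), u t = u x * Real.cosh (t - x) + γ * Real.sinh (t - x)

/-- Integration by parts on either side of x leaves the boundary terms βh(x) and -γh(x); those at x
± ε vanish because of the support of h. -/
theorem HasSlopes.isOmegaMass {u : ℝ → ℝ} {x β γ : ℝ} (h : HasSlopes u x β γ)
    (hu : MemH1loc u) : IsOmegaMass u x (β - γ) := by
  obtain ⟨ε, hε, h1, h2⟩ := h
  refine ⟨Set.Ioo (x - ε) (x + ε), isOpen_Ioo, ⟨by linarith, by linarith⟩, fun h hh hs => ?_⟩
  rw [omega_eq_add hu hh.1 (r := x - ε) (x := x) (e := x + ε) (by linarith) (by linarith)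
    (hs.trans Set.Ioo_subset_Icc_self)]
  have e1 := integral_hyperbolic (by linarith) hh.1 h1
  have e2 := integral_hyperbolic (by linarith) hh.1 h2
  have z1 : h (x - ε) = 0 := image_eq_zero_of_notMem_tsupport fun h3 => by
    have := (hs h3).1
    linarith
  have z2 : h (x + ε) = 0 := image_eq_zero_of_notMem_tsupport fun h3 => by
    have := (hs h3).2
    linarith
  simp only [mul_comm (h _) (u _), mul_comm (deriv h _) (deriv u _)] at e1 e2
  rw [e1, e2, z1, z2]
  simp
  ring

/-- Functions for which `ω` vanishes near `y` solve `u'' = u` near `y`. -/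
theorem exists_hasSlopes_of_notMem_omegaSupport {u : ℝ → ℝ} (hu : MemH1loc u) {y : ℝ}
    (hy : y ∉ omegaSupport u) : ∃ β, HasSlopes u y β β := by
  simp only [omegaSupport, Set.mem_ofPred_eq, not_forall, not_exists, not_and, not_not] at hy
  obtain ⟨U, hU, hyU, hω⟩ := hy
  obtain ⟨ε, hε, hsub⟩ := Metric.nhds_basis_closedBall.mem_iff.1 (hU.mem_nhds hyU)
  rw [Real.closedBall_eq_Icc] at hsub
  have key : ∀ t ∈ Set.Icc (y - ε) (y + ε), u t * Real.sinh (2 * ε) =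
      u (y - ε) * Real.sinh (y + ε - t) + u (y + ε) * Real.sinh (t - (y - ε)) := by
    intro t ht
    set r := y - ε with hr
    set e := y + ε with he
    -- Up to a factor this is the Dirichlet Green function of 1 - d²/dx² on [r, e] with pole t. The
    -- minimum selects the branch and the maximum cuts off outside [r, e]. Testing with it expresses
    -- u(t) by u(r) and u(e).
    set h : ℝ → ℝ := fun s => max 0 (min (Real.sinh (s - r) * Real.sinh (e - t))
      (Real.sinh (e - s) * Real.sinh (t - r))) with hh
    have s1 : 0 ≤ Real.sinh (e - t) := Real.sinh_nonneg_iff.2 (by linarith [ht.2])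
    have s2 : 0 ≤ Real.sinh (t - r) := Real.sinh_nonneg_iff.2 (by linarith [ht.1])
    have hH : MemH1loc h := by
      refine memH1loc_of_locallyLipschitz ?_
      have c1 : ContDiff ℝ 1 fun s => Real.sinh (s - r) * Real.sinh (e - t) := by fun_prop
      have c2 : ContDiff ℝ 1 fun s => Real.sinh (e - s) * Real.sinh (t - r) := by fun_prop
      exact (c1.locallyLipschitz.min c2.locallyLipschitz).const_max 0
    have hsupp : tsupport h ⊆ Set.Icc r e := by
      refine closure_minimal (fun s hs => ?_) isClosed_Icc
      by_contra hcon
      apply hs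
      rw [Set.mem_Icc, not_and_or, not_le, not_le] at hcon
      refine max_eq_left ?_
      rcases hcon with hc | hc
      · exact (min_le_left _ _).trans (mul_nonpos_of_nonpos_of_nonneg
          (Real.sinh_nonpos_iff.2 (by linarith)) s1)
      · exact (min_le_right _ _).trans (mul_nonpos_of_nonpos_of_nonneg
          (Real.sinh_nonpos_iff.2 (by linarith)) s2)
    have hcomp : HasCompactSupport h :=
      isCompact_Icc.of_isClosed_subset (isClosed_tsupport h) hsupp
    have h0 := hω h ⟨hH, hcomp⟩ (hsupp.trans hsub)
    have hl : ∀ s ∈ Set.Icc r t,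
        h s = 0 * Real.cosh (s - r) + Real.sinh (e - t) * Real.sinh (s - r) := fun s hs => by
      have m1 : Real.sinh (e - t) ≤ Real.sinh (e - s) := Real.sinh_le_sinh.2 (by linarith [hs.2])
      have m2 : Real.sinh (s - r) ≤ Real.sinh (t - r) := Real.sinh_le_sinh.2 (by linarith [hs.2])
      have m3 : 0 ≤ Real.sinh (s - r) := Real.sinh_nonneg_iff.2 (by linarith [hs.1])
      rw [hh]
      simp only
      rw [min_eq_left (by nlinarith), max_eq_right (by positivity)]
      ring
    have hr' : ∀ s ∈ Set.Icc t e,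
        h s = 0 * Real.cosh (s - e) + -Real.sinh (t - r) * Real.sinh (s - e) := fun s hs => by
      have m1 : Real.sinh (e - s) ≤ Real.sinh (e - t) := Real.sinh_le_sinh.2 (by linarith [hs.1])
      have m2 : Real.sinh (t - r) ≤ Real.sinh (s - r) := Real.sinh_le_sinh.2 (by linarith [hs.1])
      have m3 : 0 ≤ Real.sinh (e - s) := Real.sinh_nonneg_iff.2 (by linarith [hs.2])
      rw [hh]
      simp only
      rw [min_eq_right (by nlinarith), max_eq_right (by positivity),
        show e - s = -(s - e) by ring, Real.sinh_neg]
      ring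
    rw [omega_eq_add hu hH ht.1 ht.2 hsupp, integral_hyperbolic ht.1 hu hl,
      integral_hyperbolic ht.2 hu hr'] at h0
    have e1 : Real.sinh (2 * ε) = Real.sinh (e - t) * Real.cosh (t - r)
        + Real.cosh (e - t) * Real.sinh (t - r) := by
      rw [← Real.sinh_add]
      congr 1
      rw [hr, he]
      ring
    have e2 : Real.cosh (t - e) = Real.cosh (e - t) := by
      rw [← Real.cosh_neg, neg_sub]
    simp only [sub_self, Real.cosh_zero, zero_mul, zero_add, mul_one, e2] at h0
    rw [e1]
    linarith
  have hsh : 0 < Real.sinh (2 * ε) := Real.sinh_pos_iff.2 (by linarith)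
  have expand : ∀ t ∈ Set.Icc (y - ε) (y + ε), u t = u y * Real.cosh (t - y) +
      (u (y + ε) - u (y - ε)) * Real.cosh ε / Real.sinh (2 * ε) * Real.sinh (t - y) := by
    intro t ht
    have h1 := key t ht
    have h2 := key y ⟨by linarith, by linarith⟩
    rw [show y + ε - t = ε - (t - y) by ring, show t - (y - ε) = ε + (t - y) by ring,
      Real.sinh_sub, Real.sinh_add] at h1
    rw [add_sub_cancel_left, sub_sub_cancel] at h2
    generalize Real.sinh (2 * ε) = q at *
    field_simp
    linear_combination h1 - Real.cosh (t - y) * h2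
  exact ⟨_, ε, hε, fun t ht => expand t ⟨ht.1, by linarith [ht.2]⟩,
    fun t ht => expand t ⟨by linarith [ht.1], ht.2⟩⟩

theorem hyperbolic_rebase (A B x y t : ℝ) :
    A * Real.cosh (t - x) + B * Real.sinh (t - x) =
      (A * Real.cosh (y - x) + B * Real.sinh (y - x)) * Real.cosh (t - y) +
        (A * Real.sinh (y - x) + B * Real.cosh (y - x)) * Real.sinh (t - y) := by
  rw [show t - x = (t - y) + (y - x) by ring, Real.cosh_add, Real.sinh_add]
  ring

theorem hasSlopes_of_hyperbolic {u : ℝ → ℝ} {p r x A B y : ℝ}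
    (h : ∀ t ∈ Set.Icc p r, u t = A * Real.cosh (t - x) + B * Real.sinh (t - x))
    (hy : y ∈ Set.Ioo p r) : ∃ β, HasSlopes u y β β := by
  have key : ∀ t ∈ Set.Icc p r, u t = u y * Real.cosh (t - y) +
      (A * Real.sinh (y - x) + B * Real.cosh (y - x)) * Real.sinh (t - y) := fun t ht => by
    rw [h t ht, h y (Set.Ioo_subset_Icc_self hy), hyperbolic_rebase A B x y t]
  refine ⟨A * Real.sinh (y - x) + B * Real.cosh (y - x), min (y - p) (r - y),
    lt_min (by linarith [hy.1]) (by linarith [hy.2]), fun t ht => key t ⟨?_, ?_⟩,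
    fun t ht => key t ⟨?_, ?_⟩⟩
  · linarith [ht.1, min_le_left (y - p) (r - y)]
  · linarith [ht.2, hy.2]
  · linarith [ht.1, hy.1]
  · linarith [ht.2, min_le_right (y - p) (r - y)]

theorem HasSlopes.mono {u : ℝ → ℝ} {x β γ : ℝ} (h : HasSlopes u x β γ) :
    ∃ ε₀ > 0, ∀ ε > 0, ε ≤ ε₀ →
      (∀ t ∈ Set.Icc (x - ε) x, u t = u x * Real.cosh (t - x) + β * Real.sinh (t - x)) ∧
      ∀ t ∈ Set.Icc x (x + ε), u t = u x * Real.cosh (t - x) + γ * Real.sinh (t - x) := by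
  obtain ⟨ε₀, h0, h1, h2⟩ := h
  exact ⟨ε₀, h0, fun ε _ hle => ⟨fun t ht => h1 t ⟨by linarith [ht.1], ht.2⟩,
    fun t ht => h2 t ⟨ht.1, by linarith [ht.2]⟩⟩⟩

theorem HasSlopes.add {u v : ℝ → ℝ} {x β γ β' γ' : ℝ} (h : HasSlopes u x β γ)
    (h' : HasSlopes v x β' γ') : HasSlopes (fun t => u t + v t) x (β + β') (γ + γ') := by
  obtain ⟨ε₁, p1, h1⟩ := h.mono
  obtain ⟨ε₂, p2, h2⟩ := h'.mono
  have hm : 0 < min ε₁ ε₂ := lt_min p1 p2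
  obtain ⟨a1, a2⟩ := h1 _ hm (min_le_left _ _)
  obtain ⟨b1, b2⟩ := h2 _ hm (min_le_right _ _)
  refine ⟨_, hm, fun t ht => ?_, fun t ht => ?_⟩
  · beta_reduce
    rw [a1 t ht, b1 t ht]
    ring
  · beta_reduce
    rw [a2 t ht, b2 t ht]
    ring

theorem HasSlopes.const_mul {u : ℝ → ℝ} {x β γ : ℝ} (c : ℝ) (h : HasSlopes u x β γ) :
    HasSlopes (fun t => c * u t) x (c * β) (c * γ) := by
  obtain ⟨ε, hε, h1, h2⟩ := h
  refine ⟨ε, hε, fun t ht => ?_, fun t ht => ?_⟩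
  · beta_reduce
    rw [h1 t ht]
    ring
  · beta_reduce
    rw [h2 t ht]
    ring

theorem HasSlopes.comp_sub {u : ℝ → ℝ} {x β γ : ℝ} (c : ℝ) (h : HasSlopes u (x - c) β γ) :
    HasSlopes (fun t => u (t - c)) x β γ := by
  obtain ⟨ε, hε, h1, h2⟩ := h
  refine ⟨ε, hε, fun t ht => ?_, fun t ht => ?_⟩
  · beta_reduce
    rw [h1 (t - c) ⟨by linarith [ht.1], by linarith [ht.2]⟩, sub_sub_sub_cancel_right]
  · beta_reduce
    rw [h2 (t - c) ⟨by linarith [ht.1], by linarith [ht.2]⟩, sub_sub_sub_cancel_right]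

/-- Locally u solves u'' = u, so it is one hyperbolic function on the open interval. Continuity
extends the formula to the endpoints, and the base point z may then be an endpoint. -/
theorem exists_hyperbolic_Icc {u : ℝ → ℝ} (hu : Continuous u) {p r : ℝ} (hpr : p < r)
    (h : ∀ y ∈ Set.Ioo p r, ∃ β, HasSlopes u y β β) (z : ℝ) (hz : z ∈ Set.Icc p r) :
    ∃ β, ∀ t ∈ Set.Icc p r, u t = u z * Real.cosh (t - z) + β * Real.sinh (t - z) := by
  have hloc : ∀ y ∈ Set.Ioo p r, ∃ β, u =ᶠ[𝓝 y] fun t =>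
      u y * Real.cosh (t - y) + β * Real.sinh (t - y) := fun y hy => by
    obtain ⟨β, ε, hε, h1, h2⟩ := h y hy
    refine ⟨β, ?_⟩
    filter_upwards [Icc_mem_nhds (show y - ε < y by linarith) (show y < y + ε by linarith)]
      with t ht
    rcases le_total t y with hty | hty
    · exact h1 t ⟨ht.1, hty⟩
    · exact h2 t ⟨hty, ht.2⟩
  have hd1 : ∀ y ∈ Set.Ioo p r, HasDerivAt u (deriv u y) y := fun y hy => by
    obtain ⟨β, hβ⟩ := hloc y hy
    exact ((hasDerivAt_hyperbolic y (u y) β y).congr_of_eventuallyEq hβ).differentiableAt.hasDerivAt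
  have hd2 : ∀ y ∈ Set.Ioo p r, HasDerivAt (deriv u) ((1 : ℝ) ^ 2 • u y) y := fun y hy => by
    obtain ⟨β, hβ⟩ := hloc y hy
    have h3 : deriv u =ᶠ[𝓝 y] fun t => u y * Real.sinh (t - y) + β * Real.cosh (t - y) := by
      refine hβ.deriv.trans (Eventually.of_forall fun t => ?_)
      exact (hasDerivAt_hyperbolic y (u y) β t).deriv
    have h4 := (hasDerivAt_hyperbolic' y (u y) β y).congr_of_eventuallyEq h3
    simpa using h4
  set m := (p + r) / 2 with hm
  have hmem : m ∈ Set.Ioo p r := ⟨by linarith, by linarith⟩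
  have hEq : Set.EqOn u (fun t => u m * Real.cosh (t - m) + deriv u m * Real.sinh (t - m))
      (Set.Icc p r) := by
    rw [← closure_Ioo hpr.ne]
    refine Set.EqOn.closure (fun t ht => ?_) hu (by fun_prop)
    have := (hyperbolic_of_hasDerivAt one_ne_zero hd1 hd2 hmem ht).1
    simp only [one_mul, div_one, smul_eq_mul] at this
    rw [this]
    ring
  refine ⟨u m * Real.sinh (z - m) + deriv u m * Real.cosh (z - m), fun t ht => ?_⟩
  rw [hEq ht, hEq hz]
  exact hyperbolic_rebase _ _ _ _ _

theorem eventually_notMem_of_isDiscrete {S : Set ℝ} (hc : IsClosed S) (hd : IsDiscrete S) (x : ℝ) :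
    ∀ᶠ y in 𝓝[≠] x, y ∉ S := by
  have := isClosed_and_discrete_iff.1 ⟨hc, hd⟩ x
  rw [disjoint_principal_right] at this
  exact this

theorem isClosed_omegaSupport (u : ℝ → ℝ) : IsClosed (omegaSupport u) := by
  rw [← isOpen_compl_iff, isOpen_iff_forall_mem_open]
  intro x hx
  simp only [omegaSupport, Set.mem_compl_iff, Set.mem_ofPred_eq, not_forall] at hx
  obtain ⟨U, hU, hxU, h⟩ := hx
  exact ⟨U, fun y hy hy' => h (hy' U hU hy), hU, hxU⟩

theorem exists_hasSlopes {u : ℝ → ℝ} (hu : MemH1loc u) (hd : IsDiscrete (omegaSupport u))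
    (x : ℝ) : ∃ β γ, HasSlopes u x β γ := by
  have h1 := eventually_notMem_of_isDiscrete (isClosed_omegaSupport u) hd x
  rw [eventually_nhdsWithin_iff, Metric.eventually_nhds_iff] at h1
  obtain ⟨ε, hε, h1⟩ := h1
  have hloc : ∀ y, y ≠ x → |y - x| < ε → ∃ β, HasSlopes u y β β := fun y hne hy =>
    exists_hasSlopes_of_notMem_omegaSupport hu (h1 (by rwa [Real.dist_eq]) hne)
  obtain ⟨β, hβ⟩ := exists_hyperbolic_Icc hu.continuous (show x - ε < x by linarith)
    (fun y hy => hloc y hy.2.ne (by rw [abs_lt]; constructor <;> linarith [hy.1, hy.2])) x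
    ⟨by linarith, le_rfl⟩
  obtain ⟨γ, hγ⟩ := exists_hyperbolic_Icc hu.continuous (show x < x + ε by linarith)
    (fun y hy => hloc y hy.1.ne' (by rw [abs_lt]; constructor <;> linarith [hy.1, hy.2])) x
    ⟨le_rfl, by linarith⟩
  exact ⟨β, γ, ε, hε, hβ, hγ⟩

theorem HasSlopes.omegaMass_eq {u : ℝ → ℝ} (hu : MemH1loc u) {x β γ : ℝ}
    (h : HasSlopes u x β γ) : omegaMass u x = β - γ :=
  MultiPeakon.omegaMass_eq (h.isOmegaMass hu)

theorem mem_omegaSupport_iff {u : ℝ → ℝ} (hu : MemH1loc u) {x β γ : ℝ}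
    (h : HasSlopes u x β γ) : x ∈ omegaSupport u ↔ omegaMass u x ≠ 0 := by
  have hm := h.isOmegaMass hu
  rw [h.omegaMass_eq hu]
  obtain ⟨U, hU, hxU, hω⟩ := hm
  constructor
  · intro hx h0
    obtain ⟨g, hg, hgU, hg0⟩ := hx U hU hxU
    rw [hω g hg hgU, h0, zero_mul] at hg0
    exact hg0 rfl
  · intro h0 V hV hxV
    obtain ⟨g, hgs, hgc, hgd, -, hgx⟩ := exists_contDiff_tsupport_subset (n := 1)
      ((hU.inter hV).mem_nhds ⟨hxU, hxV⟩)
    have hH : MemH1c g := ⟨memH1loc_of_locallyLipschitz hgd.locallyLipschitz, hgc⟩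
    refine ⟨g, hH, fun y hy => (hgs hy).2, ?_⟩
    rwa [hω g hH fun y hy => (hgs hy).1, hgx, mul_one]

/-! ### The measure `υ` -/

theorem energyMeasure_singleton (u : ℝ → ℝ) (x : ℝ) : energyMeasure u {x} = 0 :=
  withDensity_absolutelyContinuous _ _ (measure_singleton x)

section PhaseSpace

variable {ℓ : ℝ} {p : (ℝ → ℝ) × Measure ℝ}

theorem upsilon_singleton (hp : p ∈ bigPhaseSpace ℓ) (x : ℝ) :
    upsilon p.1 p.2 {x} = p.2 {x} := by
  conv_rhs => rw [← upsilon_add_energyMeasure hp]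
  rw [Measure.add_apply, energyMeasure_singleton, add_zero]

theorem upsilon_singleton_ne_top (hp : p ∈ bigPhaseSpace ℓ) (x : ℝ) :
    upsilon p.1 p.2 {x} ≠ ⊤ := by
  rw [upsilon_singleton hp]
  have := hp.2.2.1
  exact isCompact_singleton.measure_lt_top.ne

theorem upsilon_real_add_period (hp : p ∈ bigPhaseSpace ℓ) (x : ℝ) :
    (upsilon p.1 p.2).real {x + ℓ} = (upsilon p.1 p.2).real {x} := by
  rw [Measure.real, Measure.real, upsilon_singleton hp, upsilon_singleton hp]
  conv_lhs => rw [← hp.2.2.2.1]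
  rw [Measure.map_apply (by fun_prop) (measurableSet_singleton _)]
  congr 2
  ext y
  simp

theorem mem_support_iff_singleton_ne_zero {υ : Measure ℝ} (hd : IsDiscrete υ.support) (x : ℝ) :
    x ∈ υ.support ↔ υ {x} ≠ 0 := by
  constructor
  · intro hx h0
    have h1 := eventually_notMem_of_isDiscrete Measure.isClosed_support hd x
    rw [eventually_nhdsWithin_iff] at h1
    have h2 := (Measure.mem_support_iff_forall x).1 hx _ h1
    have h3 : {y | y ∈ ({x}ᶜ : Set ℝ) → y ∉ υ.support} ⊆ {x} ∪ υ.supportᶜ := fun y hy => by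
      by_cases hyx : y = x
      · exact Or.inl hyx
      · exact Or.inr (hy hyx)
    have h4 := (measure_mono (μ := υ) h3).trans (measure_union_le _ _)
    rw [h0, Measure.measure_compl_support, add_zero] at h4
    exact absurd h2 (not_lt.2 h4)
  · intro h0
    rw [Measure.mem_support_iff_forall]
    exact fun U hU => (pos_iff_ne_zero.2 h0).trans_le
      (measure_mono (Set.singleton_subset_iff.2 (mem_of_mem_nhds hU)))

/-- A discrete subset of the line is countable and the complement of the support is null, so such a
measure is the countable sum of its atoms. -/
theorem measure_eq_of_singleton_eq {υ υ' : Measure ℝ} (hd : IsDiscrete υ.support)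
    (hd' : IsDiscrete υ'.support) (h : ∀ x, υ {x} = υ' {x}) : υ = υ' := by
  set S := υ.support ∪ υ'.support with hS
  have hcount : S.Countable :=
    ((HereditarilyLindelofSpace.isLindelof _).countable_of_isDiscrete hd).union
      ((HereditarilyLindelofSpace.isLindelof _).countable_of_isDiscrete hd')
  have key : ∀ ν : Measure ℝ, ν.support ⊆ S → ∀ B, ν B = ∑' x : (B ∩ S : Set ℝ), ν {(x : ℝ)} := by
    intro ν hν B
    have h0 : ν Sᶜ = 0 :=
      measure_mono_null (Set.compl_subset_compl.2 hν) Measure.measure_compl_support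
    rw [← measure_inter_conull h0]
    have hc : (B ∩ S).Countable := hcount.mono Set.inter_subset_right
    conv_lhs => rw [← Set.biUnion_of_singleton (B ∩ S)]
    rw [measure_biUnion hc]
    · exact fun x _ y _ hxy => Set.disjoint_singleton.2 hxy
    · exact fun x _ => measurableSet_singleton x
  ext B _
  rw [key υ Set.subset_union_left, key υ' Set.subset_union_right]
  simp only [h]

theorem omegaMass_add_period (hp : p ∈ phaseSpace ℓ) (x : ℝ) :
    omegaMass p.1 (x + ℓ) = omegaMass p.1 x := by
  obtain ⟨hb, hd, -⟩ := hp
  obtain ⟨β, γ, h⟩ := exists_hasSlopes hb.2.1 hd x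
  have h' : HasSlopes (fun t => p.1 (t - ℓ)) (x + ℓ) β γ :=
    HasSlopes.comp_sub ℓ (by rwa [add_sub_cancel_right])
  have e : (fun t => p.1 (t - ℓ)) = p.1 := funext fun t => hb.1.sub_eq t
  rw [e] at h'
  rw [h.omegaMass_eq hb.2.1, h'.omegaMass_eq hb.2.1]

theorem mem_singularSet_iff (hp : p ∈ phaseSpace ℓ) (x : ℝ) :
    x ∈ singularSet p.1 p.2 ↔ omegaMass p.1 x ≠ 0 ∨ (upsilon p.1 p.2).real {x} ≠ 0 := by
  obtain ⟨hb, hd, hd'⟩ := hp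
  obtain ⟨β, γ, h⟩ := exists_hasSlopes hb.2.1 hd x
  rw [singularSet, Set.mem_union, mem_omegaSupport_iff hb.2.1 h,
    mem_support_iff_singleton_ne_zero hd', Measure.real, Ne, Ne, Ne, ENNReal.toReal_eq_zero_iff,
    or_iff_left (upsilon_singleton_ne_top hb x)]

theorem eventually_notMem_singularSet (hp : p ∈ phaseSpace ℓ) (x : ℝ) :
    ∀ᶠ y in 𝓝[≠] x, y ∉ singularSet p.1 p.2 := by
  filter_upwards [eventually_notMem_of_isDiscrete (isClosed_omegaSupport _) hp.2.1 x,
    eventually_notMem_of_isDiscrete Measure.isClosed_support hp.2.2 x] with y h1 h2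
  exact fun h => h.elim h1 h2

/-- A pair in the phase space is determined by its point masses. -/
theorem phaseSpace_ext (hℓ : 0 < ℓ) {p' : (ℝ → ℝ) × Measure ℝ} (hp : p ∈ phaseSpace ℓ)
    (hp' : p' ∈ phaseSpace ℓ) (hω : ∀ x, omegaMass p.1 x = omegaMass p'.1 x)
    (hυ : ∀ x, (upsilon p.1 p.2).real {x} = (upsilon p'.1 p'.2).real {x}) : p = p' := by
  obtain ⟨hb, hd, hs⟩ := hp
  obtain ⟨hb', hd', hs'⟩ := hp'
  have hu : p.1 = p'.1 := by
    -- The difference of the two functions has no slope jumps, so it solves D'' = D on the line; a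
    -- periodic solution is zero. Comparing its values at 0, ℓ and 2ℓ eliminates the slope and gives
    -- D(0)(2 - 2 cosh ℓ) = 0.
    set D : ℝ → ℝ := fun t => p.1 t + -1 * p'.1 t with hD
    have hDs : ∀ y, ∃ β, HasSlopes D y β β := fun y => by
      obtain ⟨β, γ, h⟩ := exists_hasSlopes hb.2.1 hd y
      obtain ⟨β', γ', h'⟩ := exists_hasSlopes hb'.2.1 hd' y
      have h1 := hω y
      rw [h.omegaMass_eq hb.2.1, h'.omegaMass_eq hb'.2.1] at h1
      have h2 := h.add (h'.const_mul (-1))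
      rw [show γ + -1 * γ' = β + -1 * β' by linarith] at h2
      exact ⟨_, h2⟩
    have hDc : Continuous D := hb.2.1.continuous.add (hb'.2.1.continuous.const_mul _)
    have hDp : Function.Periodic D ℓ := fun t => by
      simp only [hD, hb.1 t, hb'.1 t]
    obtain ⟨β, hβ⟩ := exists_hyperbolic_Icc hDc (show 0 < 2 * ℓ by linarith)
      (fun y _ => hDs y) 0 ⟨le_rfl, by linarith⟩
    have e1 := hβ ℓ ⟨hℓ.le, by linarith⟩
    have e2 := hβ (2 * ℓ) ⟨by linarith, le_rfl⟩
    have p1 : D ℓ = D 0 := by simpa using hDp 0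
    have p2 : D (2 * ℓ) = D 0 := by
      rw [two_mul, hDp ℓ, p1]
    rw [sub_zero, p1] at e1
    rw [sub_zero, p2, Real.cosh_two_mul, Real.sinh_two_mul] at e2
    have hc : 1 < Real.cosh ℓ := Real.one_lt_cosh.2 hℓ.ne'
    have hsh : 0 < Real.sinh ℓ := Real.sinh_pos_iff.2 hℓ
    have hcs := Real.cosh_sq ℓ
    have hA : D 0 = 0 := by
      have : D 0 * (2 - 2 * Real.cosh ℓ) = 0 := by
        linear_combination e2 - 2 * Real.cosh ℓ * e1 - D 0 * hcs
      exact (mul_eq_zero.1 this).resolve_right (by linarith)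
    have hB : β = 0 := by
      rw [hA] at e1
      have : β * Real.sinh ℓ = 0 := by linarith
      exact (mul_eq_zero.1 this).resolve_right hsh.ne'
    funext t
    obtain ⟨s, hs, hts⟩ := hDp.exists_mem_Ico₀ hℓ t
    have h3 := hβ s ⟨hs.1, by linarith [hs.2]⟩
    rw [hA, hB, zero_mul, zero_mul, add_zero, ← hts] at h3
    simp only [hD] at h3
    linarith
  have hυ' : upsilon p.1 p.2 = upsilon p'.1 p'.2 := by
    refine measure_eq_of_singleton_eq hs hs' fun x => ?_
    rw [← ENNReal.toReal_eq_toReal_iff' (upsilon_singleton_ne_top hb x)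
      (upsilon_singleton_ne_top hb' x)]
    exact hυ x
  refine Prod.ext hu ?_
  rw [← upsilon_add_energyMeasure hb, ← upsilon_add_energyMeasure hb', hυ', hu]

end PhaseSpace

/-! ### Construction of a pair with prescribed point masses -/

/-- Both one-sided formulas merge into a single one: the mean slope multiplies sinh(t - x) and half
the jump multiplies sinh|t - x|. -/
theorem HasSlopes.locallyLipschitz {u : ℝ → ℝ} (h : ∀ x, ∃ β γ, HasSlopes u x β γ) :
    LocallyLipschitz u := by
  intro x
  obtain ⟨β, γ, ε, hε, h1, h2⟩ := h x
  have hF : LocallyLipschitz fun t : ℝ => u x * Real.cosh (t - x) +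
      (β + γ) / 2 * Real.sinh (t - x) + (γ - β) / 2 * Real.sinh |t - x| := by
    refine LocallyLipschitz.add ?_ ?_
    · exact ContDiff.locallyLipschitz (𝕂 := ℝ)
        (((Real.contDiff_cosh.comp (contDiff_id.sub contDiff_const)).const_smul (u x)).add
          ((Real.contDiff_sinh.comp (contDiff_id.sub contDiff_const)).const_smul ((β + γ) / 2)))
    · have h3 : LocallyLipschitz fun s : ℝ => (γ - β) / 2 * Real.sinh s :=
        ContDiff.locallyLipschitz (𝕂 := ℝ) (Real.contDiff_sinh.const_smul ((γ - β) / 2))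
      have h4 : LocallyLipschitz fun t : ℝ => |t - x| := by
        have : LipschitzWith 1 fun t : ℝ => |t - x| := LipschitzWith.of_dist_le_mul fun s t => by
          rw [Real.dist_eq, Real.dist_eq, NNReal.coe_one, one_mul]
          simpa using abs_abs_sub_abs_le (s - x) (t - x)
        exact this.locallyLipschitz
      exact h3.comp h4
  obtain ⟨K, t, ht, hK⟩ := hF x
  refine ⟨K, t ∩ Set.Icc (x - ε) (x + ε), inter_mem ht
    (Icc_mem_nhds (by linarith) (by linarith)), ?_⟩
  have hEq : Set.EqOn u (fun t : ℝ => u x * Real.cosh (t - x) +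
      (β + γ) / 2 * Real.sinh (t - x) + (γ - β) / 2 * Real.sinh |t - x|)
      (Set.Icc (x - ε) (x + ε)) := fun s hs => by
    rcases le_total s x with hsx | hsx
    · rw [h1 s ⟨hs.1, hsx⟩]
      simp only [abs_of_nonpos (sub_nonpos.2 hsx), Real.sinh_neg]
      ring
    · rw [h2 s ⟨hsx, hs.2⟩]
      simp only [abs_of_nonneg (sub_nonneg.2 hsx)]
      ring
  intro y hy s hs
  rw [hEq hy.2, hEq hs.2]
  exact hK hy.1 hs.1

theorem HasSlopes.sum {ι : Type*} (F : Finset ι) (c : ι → ℝ) (G : ι → ℝ → ℝ) (β γ : ι → ℝ) (x : ℝ)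
    (h : ∀ i ∈ F, HasSlopes (G i) x (β i) (γ i)) :
    HasSlopes (fun t => ∑ i ∈ F, c i * G i t) x (∑ i ∈ F, c i * β i) (∑ i ∈ F, c i * γ i) := by
  classical
  induction F using Finset.induction_on with
  | empty => exact ⟨1, one_pos, by simp, by simp⟩
  | insert i F hi ih =>
    simp only [Finset.sum_insert hi]
    exact ((h i (Finset.mem_insert_self _ _)).const_mul (c i)).add
      (ih fun j hj => h j (Finset.mem_insert_of_mem hj))

theorem eq_of_toIcoMod_eq {ℓ : ℝ} (hℓ : 0 < ℓ) {c x y : ℝ}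
    (h : toIcoMod hℓ c x = toIcoMod hℓ c y) (hxy : |x - y| < ℓ) : x = y := by
  have h1 : x - y = ((toIcoDiv hℓ c x - toIcoDiv hℓ c y : ℤ) : ℝ) * ℓ := by
    have e1 := toIcoMod_add_toIcoDiv_zsmul hℓ c x
    have e2 := toIcoMod_add_toIcoDiv_zsmul hℓ c y
    rw [zsmul_eq_mul] at e1 e2
    push_cast
    linarith
  rw [h1, abs_mul, abs_of_pos hℓ] at hxy
  have h2 : |((toIcoDiv hℓ c x - toIcoDiv hℓ c y : ℤ) : ℝ)| < 1 := by
    by_contra hc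
    nlinarith [not_lt.1 hc]
  have h3 : |toIcoDiv hℓ c x - toIcoDiv hℓ c y| < 1 := by exact_mod_cast h2
  rw [Int.abs_lt_one_iff.1 h3] at h1
  simp at h1
  linarith

/-- Points congruent modulo ℓ are at least ℓ apart, so a ball of radius ℓ/2 contains at most one
point of a given class. -/
theorem eventually_toIcoMod_ne {ℓ : ℝ} (hℓ : 0 < ℓ) (a c x : ℝ) :
    ∀ᶠ y in 𝓝[≠] x, toIcoMod hℓ a y ≠ c := by
  by_cases h : ∃ z, z ≠ x ∧ |z - x| < ℓ / 2 ∧ toIcoMod hℓ a z = c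
  · obtain ⟨z, hzx, hz, hzc⟩ := h
    have h1 : ∀ᶠ y in 𝓝[≠] x, |y - x| < ℓ / 2 := by
      refine mem_nhdsWithin_of_mem_nhds ?_
      exact Metric.ball_mem_nhds x (half_pos hℓ)
    have h2 : ∀ᶠ y in 𝓝[≠] x, y ≠ z := by
      refine mem_nhdsWithin_of_mem_nhds ?_
      exact isOpen_ne.mem_nhds hzx.symm
    filter_upwards [h1, h2] with y hy hyz hyc
    refine hyz (eq_of_toIcoMod_eq hℓ (hyc.trans hzc.symm) ?_)
    rw [abs_lt] at *
    constructor <;> linarith [hy.1, hy.2, hz.1, hz.2]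
  · push Not at h
    have h1 : ∀ᶠ y in 𝓝[≠] x, |y - x| < ℓ / 2 := by
      refine mem_nhdsWithin_of_mem_nhds ?_
      exact Metric.ball_mem_nhds x (half_pos hℓ)
    filter_upwards [h1, self_mem_nhdsWithin] with y hy hyx
    exact h y hyx hy

/-- The periodic Green function of `u ↦ u - u''`. -/
def peakon {ℓ : ℝ} (hℓ : 0 < ℓ) (t : ℝ) : ℝ :=
  Real.cosh (toIcoMod hℓ 0 t - ℓ / 2) / (2 * Real.sinh (ℓ / 2))

theorem peakon_periodic {ℓ : ℝ} (hℓ : 0 < ℓ) : Function.Periodic (peakon hℓ) ℓ := fun t => by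
  simp only [peakon, toIcoMod_add_right]

theorem peakon_eq {ℓ : ℝ} (hℓ : 0 < ℓ) {t : ℝ} (ht : t ∈ Set.Icc 0 ℓ) :
    peakon hℓ t = Real.cosh (ℓ / 2) / (2 * Real.sinh (ℓ / 2)) * Real.cosh (t - 0) +
      -(1 / 2) * Real.sinh (t - 0) := by
  have hs : 0 < Real.sinh (ℓ / 2) := Real.sinh_pos_iff.2 (by linarith)
  have key : peakon hℓ t = Real.cosh (t - ℓ / 2) / (2 * Real.sinh (ℓ / 2)) := by
    rcases ht.2.lt_or_eq with hlt | heq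
    · rw [peakon, (toIcoMod_eq_self hℓ).2 ⟨ht.1, by simpa using hlt⟩]
    · have h0 : peakon hℓ ℓ = peakon hℓ 0 := by simpa using peakon_periodic hℓ 0
      rw [heq, h0, peakon, (toIcoMod_eq_self hℓ).2 ⟨le_rfl, by simpa using hℓ⟩, zero_sub,
        Real.cosh_neg, show ℓ - ℓ / 2 = ℓ / 2 by ring]
  rw [key, Real.cosh_sub, sub_zero]
  field_simp
  ring

/-- The slope drops by 1 exactly at the multiples of ℓ, so 1 - d²/dx² maps this function to a unit
mass per period. -/
theorem peakon_hasSlopes {ℓ : ℝ} (hℓ : 0 < ℓ) (x : ℝ) : ∃ β γ, HasSlopes (peakon hℓ) x β γ ∧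
    β - γ = if toIcoMod hℓ 0 x = 0 then 1 else 0 := by
  have hs : 0 < Real.sinh (ℓ / 2) := Real.sinh_pos_iff.2 (by linarith)
  set y := toIcoMod hℓ 0 x with hy
  have hmem : y ∈ Set.Ico 0 ℓ := by simpa using toIcoMod_mem_Ico hℓ 0 x
  suffices h : ∃ β γ, HasSlopes (peakon hℓ) y β γ ∧ β - γ = if y = 0 then 1 else 0 by
    obtain ⟨β, γ, h1, h2⟩ := h
    refine ⟨β, γ, ?_, h2⟩
    have e : (fun t => peakon hℓ (t - toIcoDiv hℓ 0 x • ℓ)) = peakon hℓ :=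
      funext fun t => (peakon_periodic hℓ).sub_zsmul_eq _
    rw [← e]
    exact HasSlopes.comp_sub _ h1
  by_cases h0 : y = 0
  · rw [if_pos h0, h0]
    have h00 : peakon hℓ 0 = Real.cosh (ℓ / 2) / (2 * Real.sinh (ℓ / 2)) := by
      simpa using peakon_eq hℓ ⟨le_rfl, hℓ.le⟩
    refine ⟨1 / 2, -(1 / 2), ⟨ℓ, hℓ, fun t ht => ?_, fun t ht => ?_⟩, by norm_num⟩
    · rw [← peakon_periodic hℓ t, peakon_eq hℓ ⟨by linarith [ht.1], by linarith [ht.2]⟩, h00,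
        sub_zero, sub_zero, Real.cosh_add, Real.sinh_add,
        show ℓ = ℓ / 2 + ℓ / 2 by ring, Real.cosh_add, Real.sinh_add,
        show ℓ / 2 + ℓ / 2 = ℓ by ring]
      have hc := Real.cosh_sq (ℓ / 2)
      field_simp
      linear_combination (Real.cosh t * Real.cosh (ℓ / 2) +
        Real.sinh t * Real.sinh (ℓ / 2)) * hc
    · rw [peakon_eq hℓ ⟨ht.1, by linarith [ht.2]⟩, h00]
  · rw [if_neg h0]
    obtain ⟨β, hβ⟩ := hasSlopes_of_hyperbolic (fun t ht => peakon_eq hℓ ht)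
      (y := y) ⟨lt_of_le_of_ne hmem.1 (Ne.symm h0), hmem.2⟩
    exact ⟨β, β, hβ, sub_self _⟩

/-- The point measure with weight `v y` at `y`. -/
def pointMeasure (v : ℝ → ℝ) : Measure ℝ :=
  Measure.sum fun y => ENNReal.ofReal (v y) • Measure.dirac y

theorem pointMeasure_apply (v : ℝ → ℝ) {B : Set ℝ} (hB : MeasurableSet B) :
    pointMeasure v B = ∑' y, ENNReal.ofReal (v y) * B.indicator 1 y := by
  simp [pointMeasure, Measure.sum_apply _ hB, Measure.dirac_apply' _ hB]

theorem pointMeasure_apply_of_subsingleton {v : ℝ → ℝ} {B : Set ℝ} (hB : MeasurableSet B) {x : ℝ}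
    (hx : x ∈ B) (h : ∀ y ∈ B, y ≠ x → v y = 0) : pointMeasure v B = ENNReal.ofReal (v x) := by
  rw [pointMeasure_apply v hB, tsum_eq_single x]
  · simp [hx]
  · intro y hy
    by_cases hyB : y ∈ B
    · simp [h y hyB hy]
    · simp [hyB]

theorem pointMeasure_map {v : ℝ → ℝ} {ℓ : ℝ} (hv : Function.Periodic v ℓ) :
    (pointMeasure v).map (fun x => x + ℓ) = pointMeasure v := by
  ext B hB
  have hm : Measurable fun x : ℝ => x + ℓ := by fun_prop
  rw [Measure.map_apply hm hB, pointMeasure_apply v (hm hB), pointMeasure_apply v hB,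
    ← (Equiv.addRight ℓ).tsum_eq fun y => ENNReal.ofReal (v y) * B.indicator 1 y]
  refine tsum_congr fun y => ?_
  simp only [Equiv.coe_addRight, hv y]
  rfl

section Isolated

variable {v : ℝ → ℝ} (hv : ∀ x, ∀ᶠ y in 𝓝[≠] x, v y = 0)
include hv

theorem exists_isOpen_of_isolated (x : ℝ) :
    ∃ U, IsOpen U ∧ x ∈ U ∧ ∀ y ∈ U, y ≠ x → v y = 0 := by
  obtain ⟨U, hU, hUo, hxU⟩ := mem_nhds_iff.1 (eventually_nhdsWithin_iff.1 (hv x))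
  exact ⟨U, hUo, hxU, fun y hy hne => hU hy hne⟩

theorem pointMeasure_isLocallyFinite : IsLocallyFiniteMeasure (pointMeasure v) := ⟨fun x => by
  obtain ⟨U, hU, hxU, h⟩ := exists_isOpen_of_isolated hv x
  exact ⟨U, hU.mem_nhds hxU, by
    rw [pointMeasure_apply_of_subsingleton hU.measurableSet hxU h]
    exact ENNReal.ofReal_lt_top⟩⟩

theorem isDiscrete_support_pointMeasure : IsDiscrete (pointMeasure v).support := by
  refine (isClosed_and_discrete_iff.2 fun x => ?_).2
  rw [disjoint_principal_right]
  filter_upwards [hv x] with y hy hys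
  obtain ⟨U, hU, hyU, h⟩ := exists_isOpen_of_isolated hv y
  have := (Measure.mem_support_iff_forall y).1 hys U (hU.mem_nhds hyU)
  rw [pointMeasure_apply_of_subsingleton hU.measurableSet hyU h, hy] at this
  simp at this

end Isolated

theorem energyMeasure_isLocallyFinite {u : ℝ → ℝ} (hu : MemH1loc u) :
    IsLocallyFiniteMeasure (energyMeasure u) := by
  have h1 : LocallyIntegrable fun x => u x ^ 2 + deriv u x ^ 2 :=
    ((hu.continuous.pow 2).locallyIntegrable).add hu.2
  refine ⟨fun x => ?_⟩
  obtain ⟨U, hU, hint⟩ := h1 x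
  refine ⟨U, hU, ?_⟩
  rw [energyMeasure, withDensity_apply' _ U]
  refine lt_of_le_of_lt (lintegral_mono fun y => ?_) hint.2
  exact Real.ofReal_le_enorm _

theorem energyMeasure_map {u : ℝ → ℝ} {ℓ : ℝ} (hu : Function.Periodic u ℓ) :
    (energyMeasure u).map (fun x => x + ℓ) = energyMeasure u := by
  have hd : ∀ x, deriv u (x + ℓ) = deriv u x := fun x => by
    conv_rhs => rw [← funext hu]
    rw [deriv_comp_add_const]
  have hm : MeasurePreserving (fun x : ℝ => x + ℓ) volume volume :=
    measurePreserving_add_right volume ℓ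
  have he : MeasurableEmbedding fun x : ℝ => x + ℓ := (MeasurableEquiv.addRight ℓ).measurableEmbedding
  ext B hB
  rw [he.map_apply, energyMeasure, withDensity_apply' _ _, withDensity_apply' _ _,
    ← hm.setLIntegral_comp_preimage_emb he _ B]
  simp only [hu _, hd]

/-- Take u = ∑ w(y) `peakon`(· - y) over y in F and let μ be the point measure of v plus the energy
measure of u. -/
theorem exists_phaseSpace {ℓ : ℝ} (hℓ : 0 < ℓ) (a : ℝ) (F : Finset ℝ) {w v : ℝ → ℝ}
    (hF : ∀ x ∈ F, x ∈ Set.Ico a (a + ℓ)) (hw : Function.Periodic w ℓ)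
    (hv : Function.Periodic v ℓ) (hv0 : ∀ x, 0 ≤ v x)
    (hwF : ∀ x ∈ Set.Ico a (a + ℓ), x ∉ F → w x = 0)
    (hvF : ∀ x ∈ Set.Ico a (a + ℓ), x ∉ F → v x = 0) :
    ∃ p ∈ phaseSpace ℓ, (∀ x, omegaMass p.1 x = w x) ∧
      ∀ x, (upsilon p.1 p.2).real {x} = v x := by
  have hmod : ∀ {f : ℝ → ℝ}, Function.Periodic f ℓ → ∀ x, f x = f (toIcoMod hℓ a x) :=
    fun hf x => by
      conv_lhs => rw [← toIcoMod_add_toIcoDiv_zsmul hℓ a x]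
      exact hf.zsmul _ _
  have hiso : ∀ {f : ℝ → ℝ}, Function.Periodic f ℓ →
      (∀ x ∈ Set.Ico a (a + ℓ), x ∉ F → f x = 0) → ∀ x, ∀ᶠ y in 𝓝[≠] x, f y = 0 :=
    fun hf h0 x => by
      have : ∀ᶠ y in 𝓝[≠] x, ∀ c ∈ F, toIcoMod hℓ a y ≠ c :=
        (F.eventually_all).2 fun c _ => eventually_toIcoMod_ne hℓ a c x
      filter_upwards [this] with y hy
      rw [hmod hf]
      exact h0 _ (toIcoMod_mem_Ico hℓ a y) fun h => hy _ h rfl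
  have hiw := hiso hw hwF
  have hiv := hiso hv hvF
  set u : ℝ → ℝ := fun t => ∑ y ∈ F, w y * peakon hℓ (t - y) with hu
  have hslopes : ∀ x, ∃ β γ, HasSlopes u x β γ ∧ β - γ = w x := fun x => by
    choose β γ h1 h2 using fun y => peakon_hasSlopes hℓ (x - y)
    refine ⟨_, _, HasSlopes.sum F w _ β γ x fun y _ => HasSlopes.comp_sub y (h1 y), ?_⟩
    rw [← Finset.sum_sub_distrib]
    simp only [← mul_sub, h2]
    have hmem := toIcoMod_mem_Ico hℓ a x
    have hiff : ∀ y ∈ F, (toIcoMod hℓ 0 (x - y) = 0 ↔ y = toIcoMod hℓ a x) := fun y hy => by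
      constructor
      · intro h0
        have e : x = y + toIcoDiv hℓ 0 (x - y) • ℓ := by
          have := toIcoMod_add_toIcoDiv_zsmul hℓ 0 (x - y)
          rw [h0] at this
          linarith
        rw [e, toIcoMod_add_zsmul, (toIcoMod_eq_self hℓ).2 (hF y hy)]
      · intro h0
        have e : x - y = 0 + toIcoDiv hℓ a x • ℓ := by
          have := toIcoMod_add_toIcoDiv_zsmul hℓ a x
          rw [← h0] at this
          linarith
        rw [e, toIcoMod_add_zsmul, (toIcoMod_eq_self hℓ).2 ⟨le_rfl, by simpa using hℓ⟩]
    rw [Finset.sum_congr rfl fun y hy => by rw [if_congr (hiff y hy) rfl rfl]]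
    simp only [mul_ite, mul_one, mul_zero, Finset.sum_ite_eq']
    rw [hmod hw x]
    split_ifs with h
    · rfl
    · exact (hwF _ hmem h).symm
  have hex : ∀ x, ∃ β γ, HasSlopes u x β γ := fun x => by
    obtain ⟨β, γ, h, -⟩ := hslopes x
    exact ⟨β, γ, h⟩
  have hH : MemH1loc u := memH1loc_of_locallyLipschitz (HasSlopes.locallyLipschitz hex)
  have hper : Function.Periodic u ℓ := fun t => by
    simp only [hu]
    refine Finset.sum_congr rfl fun y _ => ?_
    rw [show t + ℓ - y = t - y + ℓ by ring, peakon_periodic hℓ]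
  have hmass : ∀ x, omegaMass u x = w x := fun x => by
    obtain ⟨β, γ, h, e⟩ := hslopes x
    rw [h.omegaMass_eq hH, e]
  have hfin1 := pointMeasure_isLocallyFinite hiv
  have hfin2 := energyMeasure_isLocallyFinite hH
  have hbig : (u, pointMeasure v + energyMeasure u) ∈ bigPhaseSpace ℓ := by
    refine ⟨hper, hH, ⟨fun x => ?_⟩, ?_, fun B _ => ?_⟩
    · obtain ⟨s, hs, h1⟩ := hfin1.1 x
      obtain ⟨t, ht, h2⟩ := hfin2.1 x
      refine ⟨s ∩ t, inter_mem hs ht, ?_⟩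
      rw [Measure.add_apply]
      exact ENNReal.add_lt_top.2 ⟨(measure_mono Set.inter_subset_left).trans_lt h1,
        (measure_mono Set.inter_subset_right).trans_lt h2⟩
    · rw [Measure.map_add _ _ (by fun_prop), pointMeasure_map hv, energyMeasure_map hper]
    · rw [Measure.add_apply]
      exact le_add_self
  have hups : upsilon u (pointMeasure v + energyMeasure u) = pointMeasure v := by
    have h := upsilon_add_energyMeasure hbig
    -- The energy measure is cancelled on sets where it is finite.
    refine (Measure.ext_iff_of_iUnion_eq_univ (iUnion_spanningSets (energyMeasure u))).2 fun n => ?_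
    ext B hB
    have hlt : energyMeasure u (B ∩ spanningSets (energyMeasure u) n) ≠ ⊤ :=
      ((measure_mono Set.inter_subset_right).trans_lt
        (measure_spanningSets_lt_top (energyMeasure u) n)).ne
    rw [Measure.restrict_apply hB, Measure.restrict_apply hB, ← ENNReal.add_left_inj hlt,
      ← Measure.add_apply, ← Measure.add_apply]
    exact congrArg (fun ν : Measure ℝ => ν _) h
  refine ⟨(u, pointMeasure v + energyMeasure u), ⟨hbig, ?_, ?_⟩, hmass, fun x => ?_⟩
  · refine (isClosed_and_discrete_iff.2 fun x => ?_).2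
    rw [disjoint_principal_right]
    filter_upwards [hiw x] with y hy hys
    obtain ⟨β, γ, h⟩ := hex y
    exact (mem_omegaSupport_iff hH h).1 hys (by rw [hmass, hy])
  · rw [hups]
    exact isDiscrete_support_pointMeasure hiv
  · rw [hups, Measure.real, pointMeasure_apply_of_subsingleton (measurableSet_singleton x)
      (Set.mem_singleton x) (fun y hy hne => absurd hy hne), ENNReal.toReal_ofReal (hv0 x)]

/-! ### Enumeration of point masses -/

/-- The point mass at `y` of the measures described by a list. -/
def massAt : List (ℝ × ℝ × ℝ) → ℝ → ℝ × ℝ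
  | [], _ => 0
  | (x, m) :: L, y => (if y = x then m else 0) + massAt L y

theorem massAt_append : ∀ (L L' : List (ℝ × ℝ × ℝ)) (y : ℝ),
    massAt (L ++ L') y = massAt L y + massAt L' y
  | [], L', y => (zero_add _).symm
  | (x, m) :: L, L', y => by
    rw [List.cons_append, massAt, massAt, massAt_append L L' y, add_assoc]

theorem massAt_eq_zero_of_le {b : ℝ} : ∀ {L : List (ℝ × ℝ × ℝ)} {t y : ℝ}, IsString b L t →
    t ≤ y → massAt L y = 0
  | [], _, _, _, _ => rfl
  | (x, w, v) :: L, t, y, h, hy => by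
    have hxy : x < y := h.1.trans_le hy
    rw [massAt, if_neg hxy.ne', massAt_eq_zero_of_le h.2.2.2 hxy.le, add_zero]

theorem massAt_eq_zero_of_ge {b : ℝ} : ∀ {L : List (ℝ × ℝ × ℝ)} {t y : ℝ}, IsString b L t →
    y ≤ b → massAt L y = 0
  | [], _, _, _, _ => rfl
  | (x, w, v) :: L, t, y, h, hy => by
    have hxy : y < x := hy.trans_lt h.2.2.2.lt
    rw [massAt, if_neg hxy.ne, massAt_eq_zero_of_ge h.2.2.2 hy, add_zero]

theorem massAt_head {b x w v t : ℝ} {L : List (ℝ × ℝ × ℝ)}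
    (h : IsString b ((x, w, v) :: L) t) : massAt ((x, w, v) :: L) x = (w, v) := by
  rw [massAt, if_pos rfl, massAt_eq_zero_of_le h.2.2.2 le_rfl, add_zero]

theorem massAt_of_ne {x : ℝ} {m : ℝ × ℝ} {L : List (ℝ × ℝ × ℝ)} {y : ℝ} (h : y ≠ x) :
    massAt ((x, m) :: L) y = massAt L y := by
  rw [massAt, if_neg h, zero_add]

theorem massAt_snd_nonneg {b : ℝ} : ∀ {L : List (ℝ × ℝ × ℝ)} {t : ℝ}, IsString b L t →
    ∀ y, 0 ≤ (massAt L y).2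
  | [], _, _, _ => le_rfl
  | (x, w, v) :: L, t, h, y => by
    rw [massAt, Prod.snd_add]
    refine add_nonneg ?_ (massAt_snd_nonneg h.2.2.2 y)
    split_ifs
    · exact h.2.1
    · exact le_rfl

theorem massAt_eq_zero_of_notMem : ∀ {L : List (ℝ × ℝ × ℝ)} {y : ℝ}, y ∉ L.map Prod.fst →
    massAt L y = 0
  | [], _, _ => rfl
  | (x, m) :: L, y, h => by
    simp only [List.map_cons, List.mem_cons, not_or] at h
    rw [massAt_of_ne h.1, massAt_eq_zero_of_notMem h.2]

/-- The list enumerates the point masses `m` in `(b, t)`. -/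
def Enumerates (m : ℝ → ℝ × ℝ) (b : ℝ) (L : List (ℝ × ℝ × ℝ)) (t : ℝ) : Prop :=
  IsString b L t ∧ ∀ y ∈ Set.Ioo b t, m y = massAt L y

theorem mass_ne_zero {w v : ℝ} (h : w ≠ 0 ∨ v ≠ 0) : (w, v) ≠ (0 : ℝ × ℝ) := fun h0 => by
  obtain ⟨h1, h2⟩ := Prod.mk.inj h0
  exact h.elim (· h1) (· h2)

theorem Enumerates.tail {m : ℝ → ℝ × ℝ} {b x w v t : ℝ} {L : List (ℝ × ℝ × ℝ)}
    (h : Enumerates m b ((x, w, v) :: L) t) :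
    Enumerates m b L x ∧ m x = (w, v) ∧ ∀ y ∈ Set.Ioo x t, m y = 0 := by
  have hb := h.1.2.2.2.lt
  refine ⟨⟨h.1.2.2.2, fun y hy => ?_⟩, ?_, fun y hy => ?_⟩
  · rw [h.2 y ⟨hy.1, hy.2.trans h.1.1⟩, massAt_of_ne hy.2.ne]
  · rw [h.2 x ⟨hb, h.1.1⟩, massAt_head h.1]
  · rw [h.2 y ⟨hb.trans hy.1, hy.2⟩, massAt_of_ne hy.1.ne',
      massAt_eq_zero_of_le h.1.2.2.2 hy.1.le]

/-- The head of either list is the rightmost mass in the interval, so the heads agree; then the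
tails are compared. -/
theorem Enumerates.unique {m : ℝ → ℝ × ℝ} {b : ℝ} : ∀ {L L' : List (ℝ × ℝ × ℝ)} {t : ℝ},
    Enumerates m b L t → Enumerates m b L' t → L = L'
  | [], [], _, _, _ => rfl
  | [], (x, w, v) :: L', t, h, h' => by
    have := h.2 x ⟨h'.1.2.2.2.lt, h'.1.1⟩
    rw [h'.tail.2.1] at this
    exact absurd this (mass_ne_zero h'.1.2.2.1)
  | (x, w, v) :: L, [], t, h, h' => by
    have := h'.2 x ⟨h.1.2.2.2.lt, h.1.1⟩
    rw [h.tail.2.1] at this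
    exact absurd this (mass_ne_zero h.1.2.2.1)
  | (x, w, v) :: L, (x', w', v') :: L', t, h, h' => by
    have hx : x = x' := by
      rcases lt_trichotomy x x' with hlt | heq | hlt
      · have := h.tail.2.2 x' ⟨hlt, h'.1.1⟩
        rw [h'.tail.2.1] at this
        exact absurd this (mass_ne_zero h'.1.2.2.1)
      · exact heq
      · have := h'.tail.2.2 x ⟨hlt, h.1.1⟩
        rw [h.tail.2.1] at this
        exact absurd this (mass_ne_zero h.1.2.2.1)
    subst hx
    have e := h.tail.2.1.symm.trans h'.tail.2.1
    rw [e, Enumerates.unique h.tail.1 h'.tail.1]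

theorem jump_zero : jump 0 0 = 1 := by
  ext i j : 2
  fin_cases i <;> fin_cases j <;> simp [jump, jumpPoly]

theorem transfer_append_cons {b c w v : ℝ} {L' : List (ℝ × ℝ × ℝ)} :
    ∀ {L : List (ℝ × ℝ × ℝ)} {t : ℝ}, transfer b (L ++ (c, w, v) :: L') t =
      transfer c L t * jump w v * transfer b L' c
  | [], _ => rfl
  | (x, w', v') :: L, t => by
    rw [List.cons_append, transfer, transfer, transfer_append_cons, Matrix.mul_assoc,
      Matrix.mul_assoc, Matrix.mul_assoc, Matrix.mul_assoc, Matrix.mul_assoc]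

theorem transfer_append {b c : ℝ} {L' : List (ℝ × ℝ × ℝ)} :
    ∀ {L : List (ℝ × ℝ × ℝ)} {t : ℝ}, transfer b (L ++ L') t = transfer c L t * transfer b L' c
  | [], t => by
    rw [List.nil_append]
    cases L' with
    | nil => rw [transfer, transfer, transfer, ← propagator_add, sub_add_sub_cancel]
    | cons p L' =>
      obtain ⟨x, w, v⟩ := p
      rw [transfer, transfer, transfer, ← Matrix.mul_assoc, ← Matrix.mul_assoc, ← propagator_add,
        sub_add_sub_cancel]
  | (x, w', v') :: L, t => by
    rw [List.cons_append, transfer, transfer, transfer_append (c := c), Matrix.mul_assoc,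
      Matrix.mul_assoc, Matrix.mul_assoc]

theorem IsString.append_cons {b c w v : ℝ} {L' : List (ℝ × ℝ × ℝ)} (h' : IsString b L' c)
    (hv : 0 ≤ v) (hwv : w ≠ 0 ∨ v ≠ 0) : ∀ {L : List (ℝ × ℝ × ℝ)} {t : ℝ}, IsString c L t →
      IsString b (L ++ (c, w, v) :: L') t
  | [], _, h => ⟨h, hv, hwv, h'⟩
  | (_, _, _) :: _, _, h => ⟨h.1, h.2.1, h.2.2.1, IsString.append_cons h' hv hwv h.2.2.2⟩

theorem IsString.mono {b t s : ℝ} : ∀ {L : List (ℝ × ℝ × ℝ)}, IsString b L t → t ≤ s →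
    IsString b L s
  | [], h, hts => lt_of_lt_of_le h hts
  | (_, _, _) :: _, h, hts => ⟨h.1.trans_le hts, h.2⟩

theorem IsString.append {b c : ℝ} {L' : List (ℝ × ℝ × ℝ)} (h' : IsString b L' c) :
    ∀ {L : List (ℝ × ℝ × ℝ)} {t : ℝ}, IsString c L t → IsString b (L ++ L') t
  | [], _, h => h'.mono (le_of_lt h)
  | (_, _, _) :: _, _, h => ⟨h.1, h.2.1, h.2.2.1, IsString.append h' h.2.2.2⟩

/-- The point c becomes a new list entry only if it carries mass, since entries of a string must be
nontrivial; otherwise the two free intervals at c merge. The product formula holds in both cases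
because the jump of zero mass is the identity. -/
theorem Enumerates.append {m : ℝ → ℝ × ℝ} (hm : ∀ x, 0 ≤ (m x).2) {b c t : ℝ}
    {L L' : List (ℝ × ℝ × ℝ)} (h : Enumerates m c L t) (h' : Enumerates m b L' c) :
    ∃ L'', Enumerates m b L'' t ∧ transfer b L'' t =
      transfer c L t * jump (m c).1 (m c).2 * transfer b L' c := by
  by_cases h0 : m c = 0
  · refine ⟨L ++ L', ⟨h'.1.append h.1, fun y hy => ?_⟩, ?_⟩
    · rw [massAt_append]
      rcases lt_trichotomy y c with hlt | heq | hlt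
      · rw [massAt_eq_zero_of_ge h.1 hlt.le, zero_add]
        exact h'.2 y ⟨hy.1, hlt⟩
      · rw [heq, massAt_eq_zero_of_ge h.1 le_rfl, massAt_eq_zero_of_le h'.1 le_rfl, h0, zero_add]
      · rw [massAt_eq_zero_of_le h'.1 hlt.le, add_zero]
        exact h.2 y ⟨hlt, hy.2⟩
    · rw [h0, Prod.fst_zero, Prod.snd_zero, jump_zero, Matrix.mul_one]
      exact transfer_append
  · have hne : (m c).1 ≠ 0 ∨ (m c).2 ≠ 0 := by
      by_contra hcon
      push Not at hcon
      exact h0 (Prod.ext hcon.1 hcon.2)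
    refine ⟨L ++ (c, (m c).1, (m c).2) :: L', ⟨h'.1.append_cons (hm c) hne h.1, fun y hy => ?_⟩,
      transfer_append_cons⟩
    rw [massAt_append]
    rcases lt_trichotomy y c with hlt | heq | hlt
    · rw [massAt_eq_zero_of_ge h.1 hlt.le, zero_add, massAt_of_ne hlt.ne]
      exact h'.2 y ⟨hy.1, hlt⟩
    · rw [heq, massAt_eq_zero_of_ge h.1 le_rfl, massAt, if_pos rfl,
        massAt_eq_zero_of_le h'.1 le_rfl, add_zero, zero_add]
    · rw [massAt_of_ne hlt.ne', massAt_eq_zero_of_le h'.1 hlt.le, add_zero]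
      exact h.2 y ⟨hlt, hy.2⟩

section Isolated

variable {m : ℝ → ℝ × ℝ} (hm : ∀ x, 0 ≤ (m x).2) (hiso : ∀ x, ∀ᶠ y in 𝓝[≠] x, m y = 0)

include hiso in
theorem finite_masses (b t : ℝ) : {y ∈ Set.Ioo b t | m y ≠ 0}.Finite := by
  have h1 : IsClosed {y | m y ≠ 0} ∧ IsDiscrete {y | m y ≠ 0} := by
    refine isClosed_and_discrete_iff.2 fun x => ?_
    rw [disjoint_principal_right]
    filter_upwards [hiso x] with y hy h
    exact h hy
  have h2 : (Set.Icc b t ∩ {y | m y ≠ 0}).Finite :=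
    (isCompact_Icc.inter_right h1.1).finite (h1.2.mono Set.inter_subset_right)
  exact h2.subset fun y hy => ⟨Set.Ioo_subset_Icc_self hy.1, hy.2⟩

include hm hiso in
-- Splitting at any mass leaves strictly fewer masses on both sides.
theorem exists_enumerates {b t : ℝ} (hbt : b < t) : ∃ L, Enumerates m b L t := by
  induction hn : {y ∈ Set.Ioo b t | m y ≠ 0}.ncard using Nat.strong_induction_on
    generalizing b t with
  | _ n ih =>
    by_cases h : ∃ c ∈ Set.Ioo b t, m c ≠ 0
    · obtain ⟨c, hc, hmc⟩ := h
      have hfin := finite_masses hiso b t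
      obtain ⟨L, hL⟩ := ih _ (hn ▸ Set.ncard_lt_ncard (t := {y ∈ Set.Ioo b t | m y ≠ 0})
        ⟨fun y hy => ⟨⟨hc.1.trans hy.1.1, hy.1.2⟩, hy.2⟩,
          fun hsub => absurd (hsub ⟨hc, hmc⟩).1.1 (lt_irrefl c)⟩ hfin) hc.2 rfl
      obtain ⟨L', hL'⟩ := ih _ (hn ▸ Set.ncard_lt_ncard (t := {y ∈ Set.Ioo b t | m y ≠ 0})
        ⟨fun y hy => ⟨⟨hy.1.1, hy.1.2.trans hc.2⟩, hy.2⟩,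
          fun hsub => absurd (hsub ⟨hc, hmc⟩).1.2 (lt_irrefl c)⟩ hfin) hc.1 rfl
      obtain ⟨L'', hL'', -⟩ := hL.append hm hL'
      exact ⟨L'', hL''⟩
    · push Not at h
      exact ⟨[], hbt, h⟩

end Isolated

/-! ### The fundamental matrix -/

/-- A list enumerating the point masses `m` in `(b, t)`. -/
def massList (m : ℝ → ℝ × ℝ) (b t : ℝ) : List (ℝ × ℝ × ℝ) :=
  Classical.epsilon fun L => Enumerates m b L t

/-- The matrix that maps `(f(b), f'(b))` to `(f(t), f'(t))` for `b < t`. -/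
def evolution (m : ℝ → ℝ × ℝ) (z : ℂ) (b t : ℝ) : Matrix (Fin 2) (Fin 2) ℂ :=
  (aeval z : ℝ[X] →ₐ[ℝ] ℂ).mapMatrix (transfer b (massList m b t) t * jump (m b).1 (m b).2)

theorem Enumerates.evolution_eq {m : ℝ → ℝ × ℝ} {b t : ℝ} {L : List (ℝ × ℝ × ℝ)}
    (h : Enumerates m b L t) (z : ℂ) : evolution m z b t =
      (aeval z : ℝ[X] →ₐ[ℝ] ℂ).mapMatrix (transfer b L t * jump (m b).1 (m b).2) := by
  have h' : Enumerates m b (massList m b t) t :=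
    Classical.epsilon_spec (p := fun L => Enumerates m b L t) ⟨L, h⟩
  rw [evolution, h'.unique h]

theorem det_evolution (m : ℝ → ℝ × ℝ) (z : ℂ) (b t : ℝ) : (evolution m z b t).det = 1 := by
  rw [evolution, ← AlgHom.map_det, Matrix.det_mul, det_transfer, det_jump,
    one_mul, map_one]

theorem isUnit_det_evolution (m : ℝ → ℝ × ℝ) (z : ℂ) (b t : ℝ) :
    IsUnit (evolution m z b t).det := by
  rw [det_evolution]
  exact isUnit_one

theorem evolution_of_forall_eq_zero {m : ℝ → ℝ × ℝ} (z : ℂ) {b t : ℝ} (hbt : b < t)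
    (h : ∀ y ∈ Set.Ioo b t, m y = 0) : evolution m z b t =
      (aeval z : ℝ[X] →ₐ[ℝ] ℂ).mapMatrix (propagator (t - b)) *
        (aeval z : ℝ[X] →ₐ[ℝ] ℂ).mapMatrix (jump (m b).1 (m b).2) := by
  rw [Enumerates.evolution_eq (L := []) ⟨hbt, h⟩, map_mul]
  rfl

/-- A mass at the left endpoint is included and one at the right endpoint is not, in accordance with
the left-continuity of f'; so a mass at c is counted once. -/
theorem evolution_mul {m : ℝ → ℝ × ℝ} (hm : ∀ x, 0 ≤ (m x).2)
    (hiso : ∀ x, ∀ᶠ y in 𝓝[≠] x, m y = 0) (z : ℂ) {b c t : ℝ} (hbc : b < c) (hct : c < t) :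
    evolution m z c t * evolution m z b c = evolution m z b t := by
  obtain ⟨L, hL⟩ := exists_enumerates hm hiso hct
  obtain ⟨L', hL'⟩ := exists_enumerates hm hiso hbc
  obtain ⟨L'', hL'', e⟩ := hL.append hm hL'
  rw [hL.evolution_eq, hL'.evolution_eq, hL''.evolution_eq, e, ← map_mul]
  simp only [Matrix.mul_assoc]

/-- The value at `t` of the solution with initial values `v` at `a`. -/
def solVec (m : ℝ → ℝ × ℝ) (z : ℂ) (a : ℝ) (v : Fin 2 → ℂ) (t : ℝ) : Fin 2 → ℂ :=
  -- `evolution` is meant for forward transport only, so both a and t are reached from a point to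
  -- the left of both; its choice is immaterial by `evolution_mul_inv_eq`.
  (evolution m z (min a t - 1) t * (evolution m z (min a t - 1) a)⁻¹).mulVec v

theorem solVec_self (m : ℝ → ℝ × ℝ) (z : ℂ) (a : ℝ) (v : Fin 2 → ℂ) : solVec m z a v a = v := by
  rw [solVec, Matrix.mul_nonsing_inv _ (isUnit_det_evolution m z _ _), Matrix.one_mulVec]

section SolVec

variable {m : ℝ → ℝ × ℝ} (hm : ∀ x, 0 ≤ (m x).2) (hiso : ∀ x, ∀ᶠ y in 𝓝[≠] x, m y = 0) (z : ℂ)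
include hm hiso

theorem evolution_mul_inv_eq {a t b b' : ℝ} (hb'b : b' < b) (hba : b < a) (hbt : b < t) :
    evolution m z b' t * (evolution m z b' a)⁻¹ = evolution m z b t * (evolution m z b a)⁻¹ := by
  rw [← evolution_mul hm hiso z hb'b hba, ← evolution_mul hm hiso z hb'b hbt, Matrix.mul_inv_rev,
    Matrix.mul_assoc, Matrix.mul_nonsing_inv_cancel_left _ _ (isUnit_det_evolution m z b' b)]

theorem solVec_eq (a : ℝ) (v : Fin 2 → ℂ) {t b : ℝ} (hba : b < a) (hbt : b < t) :
    solVec m z a v t = (evolution m z b t).mulVec ((evolution m z b a)⁻¹.mulVec v) := by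
  have h1 : min a t - 1 < a := by linarith [min_le_left a t]
  have h2 : min a t - 1 < t := by linarith [min_le_right a t]
  have hd : min (min a t - 1) b - 1 < min a t - 1 := by linarith [min_le_left (min a t - 1) b]
  have hd' : min (min a t - 1) b - 1 < b := by linarith [min_le_right (min a t - 1) b]
  have e := (evolution_mul_inv_eq hm hiso z hd h1 h2).symm.trans
    (evolution_mul_inv_eq hm hiso z hd' hba hbt)
  rw [Matrix.mulVec_mulVec, ← e]
  rfl

theorem solVec_of_lt (a : ℝ) (v : Fin 2 → ℂ) {x t : ℝ} (hxt : x < t) :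
    solVec m z a v t = (evolution m z x t).mulVec (solVec m z a v x) := by
  have h1 : min a x - 1 < a := by linarith [min_le_left a x]
  have h2 : min a x - 1 < x := by linarith [min_le_right a x]
  rw [solVec_eq hm hiso z a v h1 (h2.trans hxt), solVec_eq hm hiso z a v h1 h2,
    Matrix.mulVec_mulVec (M := evolution m z x t), evolution_mul hm hiso z h2 hxt]

end SolVec

theorem propagator_mulVec (z : ℂ) (d : ℝ) (v : Fin 2 → ℂ) :
    ((aeval z : ℝ[X] →ₐ[ℝ] ℂ).mapMatrix (propagator d)).mulVec v =
      ![(Real.cosh (d / 2) : ℂ) * v 0 + (2 * Real.sinh (d / 2) : ℝ) * v 1,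
        (Real.sinh (d / 2) / 2 : ℝ) * v 0 + (Real.cosh (d / 2) : ℂ) * v 1] := by
  ext i
  fin_cases i <;> simp [propagator, Matrix.mulVec, dotProduct, Fin.sum_univ_two]

theorem jump_mulVec (z : ℂ) (w r : ℝ) (v : Fin 2 → ℂ) :
    ((aeval z : ℝ[X] →ₐ[ℝ] ℂ).mapMatrix (jump w r)).mulVec v =
      ![v 0, v 1 - (z * w + z ^ 2 * r) * v 0] := by
  ext i
  fin_cases i
  · simp [jump, jumpPoly, Matrix.mulVec, dotProduct, Fin.sum_univ_two]
  · simp [jump, jumpPoly, Matrix.mulVec, dotProduct, Fin.sum_univ_two]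
    ring

section Hyperbolic

variable (x : ℝ) (A B : ℂ)

theorem hasDerivAt_fundamental (t : ℝ) :
    HasDerivAt (fun t : ℝ => (Real.cosh ((t - x) / 2) : ℂ) * A +
        ((2 * Real.sinh ((t - x) / 2) : ℝ) : ℂ) * B)
      (((Real.sinh ((t - x) / 2) / 2 : ℝ) : ℂ) * A + (Real.cosh ((t - x) / 2) : ℂ) * B) t := by
  have h1 := (hasDerivAt_cosh_mul (1 / 2) x t).ofReal_comp
  have h2 := ((hasDerivAt_sinh_mul (1 / 2) x t).const_mul 2).ofReal_comp
  have e : ∀ s : ℝ, 1 / 2 * (s - x) = (s - x) / 2 := fun s => by ring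
  simp only [e] at h1 h2
  refine ((h1.mul_const A).add (h2.mul_const B)).congr_deriv ?_
  push_cast
  ring

theorem hasDerivAt_fundamental' (t : ℝ) :
    HasDerivAt (fun t : ℝ => ((Real.sinh ((t - x) / 2) / 2 : ℝ) : ℂ) * A +
        (Real.cosh ((t - x) / 2) : ℂ) * B)
      (1 / 4 * ((Real.cosh ((t - x) / 2) : ℂ) * A +
        ((2 * Real.sinh ((t - x) / 2) : ℝ) : ℂ) * B)) t := by
  have h1 := (hasDerivAt_cosh_mul (1 / 2) x t).ofReal_comp
  have h2 := ((hasDerivAt_sinh_mul (1 / 2) x t).div_const 2).ofReal_comp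
  have e : ∀ s : ℝ, 1 / 2 * (s - x) = (s - x) / 2 := fun s => by ring
  simp only [e] at h1 h2
  refine ((h2.mul_const A).add (h1.mul_const B)).congr_deriv ?_
  push_cast
  ring

end Hyperbolic

section SolVec

variable {m : ℝ → ℝ × ℝ} (hm : ∀ x, 0 ≤ (m x).2) (hiso : ∀ x, ∀ᶠ y in 𝓝[≠] x, m y = 0) (z : ℂ)
include hm hiso

theorem solVec_eventually_gt (a : ℝ) (v : Fin 2 → ℂ) (x : ℝ) : ∀ᶠ t in 𝓝[>] x,
    solVec m z a v t = ((aeval z : ℝ[X] →ₐ[ℝ] ℂ).mapMatrix (propagator (t - x))).mulVec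
      (((aeval z : ℝ[X] →ₐ[ℝ] ℂ).mapMatrix (jump (m x).1 (m x).2)).mulVec (solVec m z a v x)) := by
  obtain ⟨r, hr, h⟩ := mem_nhdsGT_iff_exists_Ioo_subset.1 (nhdsGT_le_nhdsNE x (hiso x))
  filter_upwards [Ioo_mem_nhdsGT hr] with t ht
  rw [solVec_of_lt hm hiso z a v ht.1,
    evolution_of_forall_eq_zero z ht.1 fun y hy => h ⟨hy.1, hy.2.trans ht.2⟩, Matrix.mulVec_mulVec]

theorem solVec_eventually_lt (a : ℝ) (v : Fin 2 → ℂ) (x : ℝ) : ∀ᶠ t in 𝓝[<] x,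
    solVec m z a v t = ((aeval z : ℝ[X] →ₐ[ℝ] ℂ).mapMatrix (propagator (t - x))).mulVec
      (solVec m z a v x) := by
  obtain ⟨r, hr, h⟩ := mem_nhdsLT_iff_exists_Ioo_subset.1 (nhdsLT_le_nhdsNE x (hiso x))
  filter_upwards [Ioo_mem_nhdsLT hr] with t ht
  have h0 : m t = 0 := h ht
  rw [solVec_of_lt hm hiso z a v ht.2,
    -- Just to the left of x there is no mass, so the state at t is obtained from that at x by the
    -- propagator of negative length t - x.
    evolution_of_forall_eq_zero z ht.2 fun y hy => h ⟨ht.1.trans hy.1, hy.2⟩, h0, Prod.fst_zero,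
    Prod.snd_zero, jump_zero, map_one, Matrix.mul_one, Matrix.mulVec_mulVec, ← map_mul,
    ← propagator_add, sub_add_sub_cancel, sub_self, propagator_zero, map_one, Matrix.one_mulVec]

end SolVec

/-! ### Solutions, monodromy and Dirichlet spectrum of a pair -/

/-- The point masses of `ω` and `υ`. -/
def masses (p : (ℝ → ℝ) × Measure ℝ) (x : ℝ) : ℝ × ℝ :=
  (omegaMass p.1 x, (upsilon p.1 p.2).real {x})

section PhaseSpace

variable {ℓ : ℝ} {p : (ℝ → ℝ) × Measure ℝ}

theorem masses_snd_nonneg (p : (ℝ → ℝ) × Measure ℝ) (x : ℝ) : 0 ≤ (masses p x).2 :=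
  measureReal_nonneg

variable (hp : p ∈ phaseSpace ℓ)
include hp

theorem masses_eq_zero_iff (x : ℝ) : masses p x = 0 ↔ x ∉ singularSet p.1 p.2 := by
  rw [mem_singularSet_iff hp, masses, Prod.mk_eq_zero]
  tauto

theorem eventually_masses_eq_zero (x : ℝ) : ∀ᶠ y in 𝓝[≠] x, masses p y = 0 := by
  filter_upwards [eventually_notMem_singularSet hp x] with y hy
  exact (masses_eq_zero_iff hp y).2 hy

theorem masses_add_period (x : ℝ) : masses p (x + ℓ) = masses p x := by
  rw [masses, masses, omegaMass_add_period hp, upsilon_real_add_period hp.1]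

theorem isSolution_solVec (a : ℝ) (z : ℂ) (v : Fin 2 → ℂ) :
    IsSolution p.1 p.2 z (fun t => solVec (masses p) z a v t 0)
      (fun t => solVec (masses p) z a v t 1) := by
  have hm := masses_snd_nonneg p
  have hiso := eventually_masses_eq_zero hp
  set Y := solVec (masses p) z a v with hY
  have hlt : ∀ x, ∀ᶠ t in 𝓝[<] x,
      Y t 0 = (Real.cosh ((t - x) / 2) : ℂ) * Y x 0 +
        ((2 * Real.sinh ((t - x) / 2) : ℝ) : ℂ) * Y x 1 ∧
      Y t 1 = ((Real.sinh ((t - x) / 2) / 2 : ℝ) : ℂ) * Y x 0 +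
        (Real.cosh ((t - x) / 2) : ℂ) * Y x 1 := fun x => by
    filter_upwards [solVec_eventually_lt hm hiso z a v x] with t ht
    rw [propagator_mulVec] at ht
    rw [hY, ht]
    exact ⟨rfl, rfl⟩
  have hgt : ∀ x, ∀ᶠ t in 𝓝[>] x,
      Y t 0 = (Real.cosh ((t - x) / 2) : ℂ) * Y x 0 + ((2 * Real.sinh ((t - x) / 2) : ℝ) : ℂ) *
        (Y x 1 - (z * (masses p x).1 + z ^ 2 * (masses p x).2) * Y x 0) ∧
      Y t 1 = ((Real.sinh ((t - x) / 2) / 2 : ℝ) : ℂ) * Y x 0 + (Real.cosh ((t - x) / 2) : ℂ) *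
        (Y x 1 - (z * (masses p x).1 + z ^ 2 * (masses p x).2) * Y x 0) := fun x => by
    filter_upwards [solVec_eventually_gt hm hiso z a v x] with t ht
    rw [propagator_mulVec, jump_mulVec] at ht
    rw [hY, ht]
    exact ⟨rfl, rfl⟩
  have hnear : ∀ x, x ∉ singularSet p.1 p.2 → ∀ᶠ t in 𝓝 x,
      Y t 0 = (Real.cosh ((t - x) / 2) : ℂ) * Y x 0 +
        ((2 * Real.sinh ((t - x) / 2) : ℝ) : ℂ) * Y x 1 ∧
      Y t 1 = ((Real.sinh ((t - x) / 2) / 2 : ℝ) : ℂ) * Y x 0 +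
        (Real.cosh ((t - x) / 2) : ℂ) * Y x 1 := fun x hx => by
    have h0 := (masses_eq_zero_iff hp x).2 hx
    have h1 := hgt x
    simp only [h0, Prod.fst_zero, Prod.snd_zero, Complex.ofReal_zero, mul_zero, add_zero, zero_mul,
      sub_zero] at h1
    have h2 := eventually_sup.2 ⟨hlt x, h1⟩
    rw [nhdsLT_sup_nhdsGT] at h2
    rw [eventually_nhdsWithin_iff] at h2
    filter_upwards [h2] with t ht
    by_cases htx : t = x
    · simp [htx]
    · exact ht htx
  have hc0 : ∀ x A B, Tendsto (fun t : ℝ => (Real.cosh ((t - x) / 2) : ℂ) * A +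
      ((2 * Real.sinh ((t - x) / 2) : ℝ) : ℂ) * B) (𝓝 x) (𝓝 A) := fun x A B => by
    simpa [ContinuousAt] using (hasDerivAt_fundamental x A B x).continuousAt
  have hc1 : ∀ x A B, Tendsto (fun t : ℝ => ((Real.sinh ((t - x) / 2) / 2 : ℝ) : ℂ) * A +
      (Real.cosh ((t - x) / 2) : ℂ) * B) (𝓝 x) (𝓝 B) := fun x A B => by
    simpa [ContinuousAt] using (hasDerivAt_fundamental' x A B x).continuousAt
  refine ⟨continuous_iff_continuousAt.2 fun x => ?_, fun x hx => ?_, fun x hx => ?_, fun x _ => ?_,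
    fun x _ => ?_⟩
  · rw [continuousAt_iff_continuous_left'_right']
    constructor
    · exact ((hc0 x _ _).mono_left nhdsWithin_le_nhds).congr'
        ((hlt x).mono fun t ht => ht.1.symm)
    · exact ((hc0 x _ _).mono_left nhdsWithin_le_nhds).congr'
        ((hgt x).mono fun t ht => ht.1.symm)
  · have := (hasDerivAt_fundamental x (Y x 0) (Y x 1) x).congr_of_eventuallyEq
      ((hnear x hx).mono fun t ht => ht.1)
    simpa using this
  · have := (hasDerivAt_fundamental' x (Y x 0) (Y x 1) x).congr_of_eventuallyEq
      ((hnear x hx).mono fun t ht => ht.2)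
    simpa using this
  · exact ((hc1 x _ _).mono_left nhdsWithin_le_nhds).congr' ((hlt x).mono fun t ht => ht.2.symm)
  · exact ((hc1 x _ _).mono_left nhdsWithin_le_nhds).congr' ((hgt x).mono fun t ht => ht.2.symm)

/-- Between masses the equation is f'' = f/4, solved by the propagator, and at a mass the one-sided
limits of f' give the jump; induction over the enumeration composes the steps. In particular initial
values determine the solution. -/
theorem IsSolution.eq_evolution {z : ℂ} {f f' : ℝ → ℂ} (h : IsSolution p.1 p.2 z f f') {b t : ℝ}
    (hbt : b < t) : ![f t, f' t] = (evolution (masses p) z b t).mulVec ![f b, f' b] := by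
  have hright : ∀ x, Tendsto f' (𝓝[>] x)
      (𝓝 (f' x - (z * (masses p x).1 + z ^ 2 * (masses p x).2) * f x)) := fun x => by
    by_cases hx : x ∈ singularSet p.1 p.2
    · exact h.right x hx
    · rw [(masses_eq_zero_iff hp x).2 hx]
      simpa using (h.hasDerivAt' x hx).continuousAt.tendsto.mono_left nhdsWithin_le_nhds
  have hleft : ∀ x, Tendsto f' (𝓝[<] x) (𝓝 (f' x)) := fun x => by
    by_cases hx : x ∈ singularSet p.1 p.2
    · exact h.left x hx
    · exact (h.hasDerivAt' x hx).continuousAt.tendsto.mono_left nhdsWithin_le_nhds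
  have hfree : ∀ x s, x < s → (∀ y ∈ Set.Ioo x s, masses p y = 0) → ![f s, f' s] =
      ((aeval z : ℝ[X] →ₐ[ℝ] ℂ).mapMatrix (propagator (s - x))).mulVec
        (((aeval z : ℝ[X] →ₐ[ℝ] ℂ).mapMatrix (jump (masses p x).1 (masses p x).2)).mulVec
          ![f x, f' x]) := fun x s hxs h0 => by
    have hns : ∀ y ∈ Set.Ioo x s, y ∉ singularSet p.1 p.2 := fun y hy =>
      (masses_eq_zero_iff hp y).1 (h0 y hy)
    obtain ⟨e1, e2⟩ := hyperbolic_endpoints (k := 1 / 2) (by norm_num) hxs h.continuous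
      (fun y hy => h.hasDerivAt y (hns y hy)) (fun y hy => by
        have := h.hasDerivAt' y (hns y hy)
        rw [Complex.real_smul]
        norm_num at this ⊢
        exact this) (hright x) (hleft s)
    rw [show 1 / 2 * (s - x) = (s - x) / 2 by ring] at e1 e2
    rw [propagator_mulVec, jump_mulVec]
    simp only [Matrix.cons_val_zero, Matrix.cons_val_one]
    rw [e1, e2]
    simp only [Complex.real_smul]
    ext i
    fin_cases i
    · simp only [Fin.zero_eta, Matrix.cons_val_zero]
      push_cast
      ring
    · simp only [Fin.mk_one, Matrix.cons_val_one]
      push_cast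
      ring
  obtain ⟨L, hL⟩ := exists_enumerates (masses_snd_nonneg p) (eventually_masses_eq_zero hp) hbt
  rw [hL.evolution_eq, map_mul, ← Matrix.mulVec_mulVec]
  clear hbt
  induction L generalizing t with
  | nil => exact hfree b t hL.1 hL.2
  | cons q L ih =>
    obtain ⟨x, w, v⟩ := q
    obtain ⟨h1, h2, h3⟩ := hL.tail
    rw [hfree x t hL.1.1 h3, ih h1, h2, transfer, map_mul, map_mul, Matrix.mulVec_mulVec,
      Matrix.mulVec_mulVec, Matrix.mulVec_mulVec]

/-- `solutionIVP` is an arbitrary choice, so a solution has to exist before anything is known about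
it; `solVec` provides one. -/
theorem solutionIVP_spec (a : ℝ) (z α β : ℂ) :
    IsSolution p.1 p.2 z (solutionIVP p.1 p.2 a z α β).1 (solutionIVP p.1 p.2 a z α β).2 ∧
      (solutionIVP p.1 p.2 a z α β).1 a = α ∧ (solutionIVP p.1 p.2 a z α β).2 a = β :=
  Classical.epsilon_spec (p := fun F : (ℝ → ℂ) × (ℝ → ℂ) =>
      IsSolution p.1 p.2 z F.1 F.2 ∧ F.1 a = α ∧ F.2 a = β)
    ⟨(_, _), isSolution_solVec hp a z ![α, β], congrFun (solVec_self _ z a ![α, β]) 0,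
      congrFun (solVec_self _ z a ![α, β]) 1⟩

theorem monodromy_eq_evolution (hℓ : 0 < ℓ) (a : ℝ) (z : ℂ) :
    monodromy ℓ a p.1 p.2 z = evolution (masses p) z a (a + ℓ) := by
  have key : ∀ α β, ![(solutionIVP p.1 p.2 a z α β).1 (a + ℓ),
      (solutionIVP p.1 p.2 a z α β).2 (a + ℓ)] =
        (evolution (masses p) z a (a + ℓ)).mulVec ![α, β] := fun α β => by
    obtain ⟨h, h1, h2⟩ := solutionIVP_spec hp a z α β
    rw [h.eq_evolution hp (lt_add_of_pos_right a hℓ), h1, h2]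
  have k1 := key 1 0
  have k2 := key 0 1
  ext i j
  fin_cases j
  · have := congrFun k1 i
    fin_cases i <;> simpa [monodromy, Matrix.mulVec, dotProduct, Fin.sum_univ_two] using this
  · have := congrFun k2 i
    fin_cases i <;> simpa [monodromy, Matrix.mulVec, dotProduct, Fin.sum_univ_two] using this

/-- If f(a) = 0, then f(a+ℓ) is the upper right entry times f'(a). The factor f'(a) is nonzero for
nontrivial f, since zero data at a propagate to both sides. -/
theorem mem_dirichletSpectrum_iff (hℓ : 0 < ℓ) (a : ℝ) (z : ℂ) :
    z ∈ dirichletSpectrum ℓ a p.1 p.2 ↔ evolution (masses p) z a (a + ℓ) 0 1 = 0 := by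
  have hlt : a < a + ℓ := lt_add_of_pos_right a hℓ
  constructor
  · rintro ⟨f, f', h, hne, ha, hb⟩
    have e := congrFun (h.eq_evolution hp hlt) 0
    simp only [Matrix.cons_val_zero, hb, ha, Matrix.mulVec, dotProduct, Fin.sum_univ_two,
      Matrix.cons_val_one, mul_zero, zero_add] at e
    refine (mul_eq_zero.1 e.symm).resolve_right fun h0 => hne (funext fun t => ?_)
    rcases lt_trichotomy a t with hat | hat | hat
    · have e1 := congrFun (h.eq_evolution hp hat) 0
      rw [ha, h0] at e1
      simpa [Matrix.mulVec, dotProduct, Fin.sum_univ_two] using e1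
    · rw [← hat, ha, Pi.zero_apply]
    · have e1 := h.eq_evolution hp hat
      have e2 : (![f a, f' a] : Fin 2 → ℂ) = 0 := by
        rw [ha, h0]
        ext i
        fin_cases i <;> rfl
      rw [e2] at e1
      have e3 := Matrix.eq_zero_of_mulVec_eq_zero
        (isUnit_det_evolution (masses p) z t a).ne_zero e1.symm
      exact congrFun e3 0
  · intro h0
    have h := isSolution_solVec hp a z ![0, 1]
    refine ⟨_, _, h, fun hz => ?_, by simp [solVec_self], ?_⟩
    · have e1 := h.eq_evolution hp (show a - 1 < a by linarith)
      have e2 := h.eq_evolution hp (show a < a + ℓ from hlt)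
      have hzero : ∀ t, solVec (masses p) z a ![0, 1] t 0 = 0 := fun t => congrFun hz t
      have hns : ∀ᶠ t in 𝓝[>] a, t ∉ singularSet p.1 p.2 :=
        nhdsGT_le_nhdsNE a (eventually_notMem_singularSet hp a)
      -- If f were identically zero, then f' would vanish off Σ just to the right of a; the
      -- invertible evolution carries this back to a, where f' = 1.
      have hd : ∀ᶠ t in 𝓝[>] a, solVec (masses p) z a ![0, 1] t 1 = 0 := by
        filter_upwards [hns] with t ht
        have := h.hasDerivAt t ht
        rw [hz] at this
        exact this.unique (hasDerivAt_const t (0 : ℂ))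
      obtain ⟨t, ht, hat⟩ := (hd.and self_mem_nhdsWithin).exists
      have e3 := h.eq_evolution hp (show a < t from hat)
      have e4 : (![solVec (masses p) z a ![0, 1] t 0, solVec (masses p) z a ![0, 1] t 1] :
          Fin 2 → ℂ) = 0 := by
        rw [ht, hzero]
        ext i
        fin_cases i <;> rfl
      rw [e4] at e3
      have e5 := congrFun (Matrix.eq_zero_of_mulVec_eq_zero
        (isUnit_det_evolution (masses p) z a t).ne_zero e3.symm) 1
      simp [solVec_self] at e5
    · have e1 := congrFun (h.eq_evolution hp hlt) 0
      simp only [solVec_self] at e1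
      simpa [Matrix.mulVec, dotProduct, Fin.sum_univ_two, h0] using e1

end PhaseSpace

/-! ### Linear factors and interpolation -/

/-- The origin is one node more than the zeros of A, which matches degree at most their number. -/
theorem eq_of_eval_eq {P Q : ℝ[X]} (R : Finset ℝ) (h0 : (0 : ℝ) ∉ R) (hP : P.natDegree ≤ R.card)
    (hQ : Q.natDegree ≤ R.card) (h : ∀ x ∈ R, P.eval x = Q.eval x)
    (h00 : P.eval 0 = Q.eval 0) : P = Q := by
  refine eq_of_natDegree_lt_card_of_eval_eq' P Q (insert 0 R) (fun x hx => ?_) ?_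
  · rcases Finset.mem_insert.1 hx with rfl | hx
    · exact h00
    · exact h x hx
  · rw [Finset.card_insert_of_notMem h0]
    omega

/-- The linear polynomial with root `k` and value `1` at `0`. -/
def linearFactor (k : ℝ) : ℝ[X] := 1 - C k⁻¹ * X

theorem linearFactor_eval (k x : ℝ) : (linearFactor k).eval x = 1 - x / k := by
  simp [linearFactor, div_eq_inv_mul]

theorem linearFactor_derivative (k : ℝ) : derivative (linearFactor k) = C (-k⁻¹) := by
  simp [linearFactor]

theorem linearFactor_eq (k : ℝ) : linearFactor k = C (-k⁻¹) * X + C 1 := by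
  rw [linearFactor, map_neg, map_one]
  ring

theorem natDegree_linearFactor {k : ℝ} (hk : k ≠ 0) : (linearFactor k).natDegree = 1 := by
  rw [linearFactor_eq]
  exact natDegree_linear (neg_ne_zero.2 (inv_ne_zero hk))

theorem leadingCoeff_linearFactor {k : ℝ} (hk : k ≠ 0) :
    (linearFactor k).leadingCoeff = -k⁻¹ := by
  rw [linearFactor_eq]
  exact leadingCoeff_linear (neg_ne_zero.2 (inv_ne_zero hk))

section Prod

variable {ι : Type*} {c : ℝ} {s : Finset ι} {k : ι → ℝ}

/-- The polynomial with roots `k i`, `i ∈ s`, and value `c` at `0`. -/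
def rootProd (c : ℝ) (s : Finset ι) (k : ι → ℝ) : ℝ[X] :=
  C c * ∏ i ∈ s, linearFactor (k i)

theorem rootProd_eval (x : ℝ) : (rootProd c s k).eval x = c * ∏ i ∈ s, (1 - x / k i) := by
  rw [rootProd, eval_mul, eval_C, eval_prod]
  simp only [linearFactor_eval]

theorem rootProd_eval_zero : (rootProd c s k).eval 0 = c := by
  simp [rootProd_eval]

theorem natDegree_rootProd (hc : c ≠ 0) (hk : ∀ i ∈ s, k i ≠ 0) :
    (rootProd c s k).natDegree = s.card := by
  rw [rootProd, natDegree_C_mul hc, natDegree_prod]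
  · rw [Finset.sum_congr rfl fun i hi => natDegree_linearFactor (hk i hi)]
    simp
  · intro i hi h0
    have := natDegree_linearFactor (hk i hi)
    rw [h0, natDegree_zero] at this
    omega

theorem leadingCoeff_rootProd (hk : ∀ i ∈ s, k i ≠ 0) :
    (rootProd c s k).leadingCoeff = c * ∏ i ∈ s, (-(k i)⁻¹) := by
  rw [rootProd, leadingCoeff_mul, leadingCoeff_C, leadingCoeff_prod]
  rw [Finset.prod_congr rfl fun i hi => leadingCoeff_linearFactor (hk i hi)]

theorem rootProd_eval_eq_zero_iff (hc : c ≠ 0) (hk : ∀ i ∈ s, k i ≠ 0) {x : ℝ} :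
    (rootProd c s k).eval x = 0 ↔ ∃ i ∈ s, k i = x := by
  rw [rootProd_eval, mul_eq_zero, or_iff_right hc, Finset.prod_eq_zero_iff]
  refine exists_congr fun i => and_congr_right fun hi => ?_
  rw [sub_eq_zero, eq_comm, div_eq_one_iff_eq (hk i hi), eq_comm]

theorem rootProd_im_eq_zero (hc : c ≠ 0) (hk : ∀ i ∈ s, k i ≠ 0) {z : ℂ}
    (hz : aeval z (rootProd c s k) = 0) : z.im = 0 := by
  rw [rootProd, map_mul, aeval_C, map_prod, mul_eq_zero, or_iff_right (by simpa using hc),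
    Finset.prod_eq_zero_iff] at hz
  obtain ⟨i, hi, hz⟩ := hz
  have hki : (k i : ℂ) ≠ 0 := by exact_mod_cast hk i hi
  have : z = (k i : ℂ) := by
    simp only [linearFactor, map_sub, map_one, map_mul, aeval_C, aeval_X] at hz
    rw [Complex.coe_algebraMap, Complex.ofReal_inv] at hz
    field_simp at hz
    linear_combination -hz
  rw [this, Complex.ofReal_im]

theorem derivative_rootProd_eval [DecidableEq ι] (hk : ∀ i ∈ s, k i ≠ 0) {i : ι} (hi : i ∈ s) :
    k i * (derivative (rootProd c s k)).eval (k i) =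
      -(c * ∏ j ∈ s.erase i, (1 - k i / k j)) := by
  have h : rootProd c s k = linearFactor (k i) * rootProd c (s.erase i) k := by
    rw [rootProd, rootProd, ← Finset.mul_prod_erase s _ hi]
    ring
  rw [h, derivative_mul, eval_add, eval_mul, eval_mul, linearFactor_eval, linearFactor_derivative,
    div_self (hk i hi), eval_C, rootProd_eval]
  field_simp [hk i hi]
  ring

end Prod

/-! ### Positions of points in the gaps -/

theorem ordConnected_gap (Δ : ℝ[X]) (i : ℤ) : (gap Δ i).OrdConnected := by
  rw [gap]
  split_ifs <;> exact Set.ordConnected_Icc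

theorem mem_gap_of_mem_Icc {Δ : ℝ[X]} {i : ℤ} {x y r : ℝ} (hx : (x : EReal) ∈ gap Δ i)
    (hy : (y : EReal) ∈ gap Δ i) (hr : r ∈ Set.Icc x y) : (r : EReal) ∈ gap Δ i :=
  (ordConnected_gap Δ i).out hx hy ⟨EReal.coe_le_coe_iff.2 hr.1, EReal.coe_le_coe_iff.2 hr.2⟩

theorem eq_numPos_of_top_mem_gap {Δ : ℝ[X]} {i : ℤ} (h : ⊤ ∈ gap Δ i) : i = numPos Δ := by
  rw [gap] at h
  split_ifs at h with h1 h2 h3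
  · exact absurd h.2 (by simp)
  · exact h2
  · exact absurd h.2 (by simp)
  · exact absurd h.2 (by simp)

theorem eq_numNeg_of_bot_mem_gap {Δ : ℝ[X]} {i : ℤ} (h : ⊥ ∈ gap Δ i) : i = -numNeg Δ := by
  rw [gap] at h
  split_ifs at h with h1 h2 h3
  · exact h1
  · exact absurd h.1 (by simp)
  · exact absurd h.1 (by simp)
  · exact absurd h.1 (by simp)

namespace GapData

variable {Δ : ℝ[X]} {T : ℤ → ℝ} (h : GapData Δ T) {i j : ℤ}
include h

theorem ne_zero (hi : i ∈ gapIndex Δ) : T i ≠ 0 := by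
  rcases lt_or_gt_of_ne hi.1 with h0 | h0
  · exact (h.neg i hi h0).ne
  · exact (h.pos i hi h0).ne'

theorem mul_pos (hi : i ∈ gapIndex Δ) {x : ℝ} (hx : (x : EReal) ∈ gap Δ i) : 0 < x * T i := by
  rcases lt_or_gt_of_ne hi.1 with h0 | h0
  · exact mul_pos_of_neg_of_neg ((h.lt_of_neg i hi h0 x hx).trans (h.neg i hi h0)) (h.neg i hi h0)
  · exact _root_.mul_pos ((h.pos i hi h0).trans (h.lt_of_pos i hi h0 x hx)) (h.pos i hi h0)

theorem mem_ne_zero (hi : i ∈ gapIndex Δ) {x : ℝ} (hx : (x : EReal) ∈ gap Δ i) : x ≠ 0 :=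
  left_ne_zero_of_mul (h.mul_pos hi hx).ne'

theorem one_sub_div_self_neg (hi : i ∈ gapIndex Δ) {x : ℝ} (hx : (x : EReal) ∈ gap Δ i) :
    1 - x / T i < 0 := by
  rw [sub_neg]
  rcases lt_or_gt_of_ne hi.1 with h0 | h0
  · exact (one_lt_div_of_neg (h.neg i hi h0)).2 (h.lt_of_neg i hi h0 x hx)
  · exact (one_lt_div (h.pos i hi h0)).2 (h.lt_of_pos i hi h0 x hx)

/-- The gap j and its zero T j lie on the same side of x as seen from the origin, so x/y and x/T j
are both above or both below 1. -/
theorem one_sub_div_mul_pos (hi : i ∈ gapIndex Δ) {x : ℝ} (hx : (x : EReal) ∈ gap Δ i)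
    (hj : j ∈ gapIndex Δ) {y : ℝ} (hy : (y : EReal) ∈ gap Δ j) (hij : i ≠ j) :
    0 < (1 - x / y) * (1 - x / T j) := by
  rcases lt_or_gt_of_ne hi.1 with hi0 | hi0 <;> rcases lt_or_gt_of_ne hj.1 with hj0 | hj0
  · have ti := h.neg i hi hi0
    have tj := h.neg j hj hj0
    have xi := h.lt_of_neg i hi hi0 x hx
    have yj := h.lt_of_neg j hj hj0 y hy
    rcases lt_or_gt_of_ne hij with hlt | hlt
    · have := h.prev_lt j hj hj0 y hy i hi hlt
      exact mul_pos_of_neg_of_neg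
        (sub_neg.2 ((one_lt_div_of_neg (by linarith)).2 (by linarith)))
        (sub_neg.2 ((one_lt_div_of_neg tj).2 (by linarith)))
    · have := h.prev_lt i hi hi0 x hx j hj hlt
      exact _root_.mul_pos (sub_pos.2 ((div_lt_one_of_neg (by linarith)).2 (by linarith)))
        (sub_pos.2 ((div_lt_one_of_neg tj).2 (by linarith)))
  · have ti := h.neg i hi hi0
    have tj := h.pos j hj hj0
    have xi := h.lt_of_neg i hi hi0 x hx
    have yj := h.lt_of_pos j hj hj0 y hy
    exact _root_.mul_pos (sub_pos.2 ((div_lt_one (by linarith)).2 (by linarith)))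
        (sub_pos.2 ((div_lt_one tj).2 (by linarith)))
  · have ti := h.pos i hi hi0
    have tj := h.neg j hj hj0
    have xi := h.lt_of_pos i hi hi0 x hx
    have yj := h.lt_of_neg j hj hj0 y hy
    exact _root_.mul_pos (sub_pos.2 ((div_lt_one_of_neg (by linarith)).2 (by linarith)))
        (sub_pos.2 ((div_lt_one_of_neg tj).2 (by linarith)))
  · have ti := h.pos i hi hi0
    have tj := h.pos j hj hj0
    have xi := h.lt_of_pos i hi hi0 x hx
    have yj := h.lt_of_pos j hj hj0 y hy
    rcases lt_or_gt_of_ne hij with hlt | hlt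
    · have := h.lt_next i hi hi0 x hx j hj hlt
      exact _root_.mul_pos (sub_pos.2 ((div_lt_one (by linarith)).2 (by linarith)))
        (sub_pos.2 ((div_lt_one tj).2 (by linarith)))
    · have := h.lt_next j hj hj0 y hy i hi hlt
      exact mul_pos_of_neg_of_neg
        (sub_neg.2 ((one_lt_div (by linarith)).2 (by linarith)))
        (sub_neg.2 ((one_lt_div tj).2 (by linarith)))

theorem one_sub_div_pos (hi : i ∈ gapIndex Δ) {x : ℝ} (hx : (x : EReal) ∈ gap Δ i)
    (hj : j ∈ gapIndex Δ) (hij : i ≠ j) (hout : j = numPos Δ ∨ j = -numNeg Δ) :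
    0 < 1 - x / T j := by
  rw [sub_pos]
  rcases hout with hout | hout
  · have hj0 : 0 < j := by have := hj.1; omega
    have tj := h.pos j hj hj0
    rw [div_lt_one tj]
    rcases lt_or_gt_of_ne hi.1 with hi0 | hi0
    · linarith [h.neg i hi hi0, h.lt_of_neg i hi hi0 x hx]
    · exact h.lt_next i hi hi0 x hx j hj (by have := hi.2.2; omega)
  · have hj0 : j < 0 := by have := hj.1; omega
    have tj := h.neg j hj hj0
    rw [div_lt_one_of_neg tj]
    rcases lt_or_gt_of_ne hi.1 with hi0 | hi0
    · exact h.prev_lt i hi hi0 x hx j hj (by have := hi.2.1; omega)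
    · linarith [h.pos i hi hi0, h.lt_of_pos i hi hi0 x hx]

theorem eq_of_mem_gap (hi : i ∈ gapIndex Δ) (hj : j ∈ gapIndex Δ) {x : ℝ}
    (hx : (x : EReal) ∈ gap Δ i) (hx' : (x : EReal) ∈ gap Δ j) : i = j := by
  by_contra hij
  -- For y = x the first factor 1 - x/y is zero.
  have := h.one_sub_div_mul_pos hi hx hj hx' hij
  rw [div_self (h.mem_ne_zero hi hx), sub_self, zero_mul] at this
  exact lt_irrefl _ this

end GapData

theorem gapIndex_finite (Δ : ℝ[X]) : (gapIndex Δ).Finite :=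
  (Set.finite_Icc (-(numNeg Δ : ℤ)) (numPos Δ)).subset fun _ hi => ⟨hi.2.1, hi.2.2⟩

instance (Δ : ℝ[X]) : Fintype (gapIndex Δ) := (gapIndex_finite Δ).fintype

theorem GapData.eq_rootProd {Δ : ℝ[X]} {T : ℤ → ℝ} (h : GapData Δ T) (hsplit : Δ.Splits)
    (hnodup : Δ.roots.Nodup) (h0 : Δ.eval 0 ≠ 0) :
    Δ = rootProd (Δ.eval 0) Finset.univ fun i : gapIndex Δ => T i := by
  classical
  have hΔ : Δ ≠ 0 := fun h' => h0 (by rw [h', eval_zero])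
  have hne : ∀ i ∈ (Finset.univ : Finset (gapIndex Δ)), T i ≠ 0 := fun i _ => h.ne_zero i.2
  have hR : Δ.roots.toFinset = Finset.univ.image fun i : gapIndex Δ => T i := by
    ext x
    rw [Multiset.mem_toFinset, mem_roots hΔ, IsRoot, h.root_iff]
    simp
  have hcard : Δ.natDegree = Fintype.card (gapIndex Δ) := by
    rw [hsplit.natDegree_eq_card_roots, ← Multiset.toFinset_card_of_nodup hnodup, hR,
      Finset.card_image_of_injective]
    · rfl
    · exact fun i j hij => Subtype.ext (h.injOn i.2 j.2 hij)
  have hRc : Δ.roots.toFinset.card = Δ.natDegree := by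
    rw [hsplit.natDegree_eq_card_roots, Multiset.toFinset_card_of_nodup hnodup]
  refine eq_of_eval_eq Δ.roots.toFinset (fun h' => ?_) hRc.ge ?_ (fun x hx => ?_) ?_
  · rw [Multiset.mem_toFinset, mem_roots hΔ] at h'
    exact h0 h'
  · rw [natDegree_rootProd h0 hne, hRc, hcard]
    rfl
  · have hx' : Δ.eval x = 0 := by
      rwa [Multiset.mem_toFinset, mem_roots hΔ] at hx
    rw [hx', eq_comm, rootProd_eval_eq_zero_iff h0 hne]
    obtain ⟨i, hi, e⟩ := (h.root_iff x).1 hx'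
    exact ⟨⟨i, hi⟩, Finset.mem_univ _, e⟩
  · rw [rootProd_eval_zero]

/-- A polynomial cannot cross zero in the same direction twice in a row. -/
theorem false_of_two_roots {P D : ℝ[X]} {x y : ℝ} (hxy : x < y) (hx : P.eval x = 0)
    (hy : P.eval y = 0)
    (hP : ∀ r ∈ Set.Icc x y, P.eval r = 0 → 0 < (derivative P).eval r * D.eval r)
    (hD : ∀ r ∈ Set.Icc x y, D.eval r ≠ 0) : False := by
  classical
  have hP0 : P ≠ 0 := fun h0 => by
    have := hP x ⟨le_rfl, hxy.le⟩ hx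
    rw [h0] at this
    simp at this
  -- r is the next root after x. Writing P = (X - x)(X - r)Q, the sign condition makes QD negative
  -- at x and positive at r, although it has no zero between them.
  obtain ⟨r, hr, hmin⟩ := (P.roots.toFinset.filter fun r => x < r).exists_min_image id
    ⟨y, by simp [hP0, hy, hxy]⟩
  simp only [Finset.mem_filter, Multiset.mem_toFinset, mem_roots hP0, IsRoot, id] at hr hmin
  have hry : r ≤ y := hmin y ⟨hy, hxy⟩
  obtain ⟨Q, hQ⟩ : (X - C x) * (X - C r) ∣ P := by
    obtain ⟨Q, hQ⟩ := dvd_iff_isRoot.2 hx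
    have hQr : Q.eval r = 0 := by
      have := hr.1
      rw [hQ, eval_mul, mul_eq_zero] at this
      refine this.resolve_left ?_
      rw [eval_sub, eval_X, eval_C]
      linarith [hr.2]
    obtain ⟨Q', hQ'⟩ := dvd_iff_isRoot.2 hQr
    exact ⟨Q', by rw [hQ, hQ', mul_assoc]⟩
  have hdx : (derivative P).eval x = (x - r) * Q.eval x := by
    rw [hQ]
    simp [derivative_mul]
  have hdr : (derivative P).eval r = (r - x) * Q.eval r := by
    rw [hQ]
    simp [derivative_mul]
  have h1 := hP x ⟨le_rfl, hxy.le⟩ hx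
  have h2 := hP r ⟨hr.2.le, hry⟩ hr.1
  rw [hdx] at h1
  rw [hdr] at h2
  have hne : ∀ s ∈ Set.Icc x r, (Q * D).eval s ≠ 0 := fun s hs hs0 => by
    rw [eval_mul] at hs0
    rcases hs.1.eq_or_lt with rfl | hlt
    · rw [mul_assoc, hs0, mul_zero] at h1
      exact lt_irrefl _ h1
    · have hQs := (mul_eq_zero.1 hs0).resolve_right (hD s ⟨hs.1, hs.2.trans hry⟩)
      have hPs : P.eval s = 0 := by rw [hQ, eval_mul, hQs, mul_zero]
      have := hmin s ⟨hPs, hlt⟩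
      rw [← le_antisymm hs.2 this, hQs, mul_zero, zero_mul] at h2
      exact lt_irrefl _ h2
  have hneg : (Q * D).eval x < 0 := by
    rw [eval_mul]
    nlinarith [hr.2]
  have hpos : 0 < (Q * D).eval r := by
    rw [eval_mul]
    nlinarith [hr.2]
  obtain ⟨s, hs, hs0⟩ := intermediate_value_Icc hr.2.le (Q * D).continuous.continuousOn
    (show (0 : ℝ) ∈ Set.Icc _ _ from ⟨hneg.le, hpos.le⟩)
  exact hne s hs hs0

/-! ### The spectral data in terms of the transfer matrix -/

theorem aeval_ofReal (P : ℝ[X]) (x : ℝ) : aeval (x : ℂ) P = ((P.eval x : ℝ) : ℂ) := by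
  rw [← Complex.coe_algebraMap, aeval_algebraMap_apply, coe_aeval_eq_eval]

/-- The divisors of a polynomial `A` with respect to `Δ` and `B`. -/
def IsDivisors (Δ A B : ℝ[X]) (κ : gapIndex Δ → EReal × ℝ) : Prop :=
  ∀ i : gapIndex Δ,
    (∃ k : ℝ, A.eval k = 0 ∧ (k : EReal) ∈ gap Δ i ∧ (κ i).1 = (k : EReal) ∧
      (κ i).2 = Δ.eval k - B.eval k) ∨
    ((∀ k : ℝ, A.eval k = 0 → (k : EReal) ∉ gap Δ i) ∧
      (((i : ℤ) = (numPos Δ : ℤ) ∧ κ i = (⊤, 0)) ∨ ((i : ℤ) = -(numNeg Δ : ℤ) ∧ κ i = (⊥, 0))))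

section PhaseSpace

variable {ℓ : ℝ} {p : (ℝ → ℝ) × Measure ℝ} (hp : p ∈ phaseSpace ℓ) (hℓ : 0 < ℓ) {a : ℝ}
  {L : List (ℝ × ℝ × ℝ)} (hL : Enumerates (masses p) a L (a + ℓ))
include hp hℓ hL

theorem monodromy_eq (z : ℂ) : monodromy ℓ a p.1 p.2 z =
    !![aeval z (transfer a L (a + ℓ) 0 0 - jumpPoly (masses p a).1 (masses p a).2 *
        transfer a L (a + ℓ) 0 1), aeval z (transfer a L (a + ℓ) 0 1);
      aeval z (transfer a L (a + ℓ) 1 0 - jumpPoly (masses p a).1 (masses p a).2 *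
        transfer a L (a + ℓ) 1 1), aeval z (transfer a L (a + ℓ) 1 1)] := by
  rw [monodromy_eq_evolution hp hℓ, hL.evolution_eq]
  ext i j
  fin_cases i <;> fin_cases j <;>
    simp [Matrix.mul_apply, Fin.sum_univ_two, jump, sub_eq_add_neg, mul_comm]

/-- The mass at a enters the trace only through its jump polynomial times A. -/
theorem floquetDiscriminant_iff (Δ : ℝ[X]) :
    (∀ z, floquetDiscriminant ℓ a p.1 p.2 z = aeval z Δ) ↔
      transfer a L (a + ℓ) 0 0 + transfer a L (a + ℓ) 1 1 -
        jumpPoly (masses p a).1 (masses p a).2 * transfer a L (a + ℓ) 0 1 = C 2 * Δ := by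
  have key : ∀ z, floquetDiscriminant ℓ a p.1 p.2 z = aeval z (transfer a L (a + ℓ) 0 0 +
      transfer a L (a + ℓ) 1 1 - jumpPoly (masses p a).1 (masses p a).2 *
        transfer a L (a + ℓ) 0 1) / 2 := fun z => by
    rw [floquetDiscriminant, monodromy_eq hp hℓ hL, Matrix.trace_fin_two_of, ← map_add]
    congr 2
    ring
  constructor
  · intro h
    refine funext fun x => ?_
    have h1 := h x
    rw [key, aeval_ofReal, aeval_ofReal] at h1
    rw [eval_mul, eval_C]
    have h2 : (((transfer a L (a + ℓ) 0 0 + transfer a L (a + ℓ) 1 1 -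
        jumpPoly (masses p a).1 (masses p a).2 * transfer a L (a + ℓ) 0 1).eval x / 2 : ℝ) : ℂ) =
        ((Δ.eval x : ℝ) : ℂ) := by
      rw [← h1]
      push_cast
      ring
    have h3 := Complex.ofReal_inj.1 h2
    linarith
  · intro h z
    rw [key, h, map_mul, aeval_C]
    simp

theorem isDirichletDivisors_iff (Δ : ℝ[X]) (κ : gapIndex Δ → EReal × ℝ) :
    IsDirichletDivisors ℓ a p.1 p.2 Δ κ ↔
      IsDivisors Δ (transfer a L (a + ℓ) 0 1) (transfer a L (a + ℓ) 1 1) κ := by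
  have h1 : ∀ k : ℝ, (k : ℂ) ∈ dirichletSpectrum ℓ a p.1 p.2 ↔
      (transfer a L (a + ℓ) 0 1).eval k = 0 := fun k => by
    rw [mem_dirichletSpectrum_iff hp hℓ, ← monodromy_eq_evolution hp hℓ, monodromy_eq hp hℓ hL]
    simp [aeval_ofReal]
  have h2 : ∀ k : ℝ, monodromy ℓ a p.1 p.2 k 1 1 =
      (((transfer a L (a + ℓ) 1 1).eval k : ℝ) : ℂ) := fun k => by
    rw [monodromy_eq hp hℓ hL]
    simp [aeval_ofReal]
  simp only [IsDirichletDivisors, IsDivisors, h1, h2, ← Complex.ofReal_sub, Complex.ofReal_inj]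

end PhaseSpace

theorem transfer_det_eval {b t : ℝ} (L : List (ℝ × ℝ × ℝ)) {x : ℝ}
    (hx : (transfer b L t 0 1).eval x = 0) :
    (transfer b L t 0 0).eval x * (transfer b L t 1 1).eval x = 1 := by
  have h := congrArg (eval x) (det_transfer b L t)
  rw [Matrix.det_fin_two, eval_sub, eval_mul, eval_mul, hx, zero_mul, sub_zero, eval_one] at h
  exact h

/-! ### Uniqueness -/

section Unique

variable {Δ : ℝ[X]} {T : ℤ → ℝ} (hT : GapData Δ T) (h0 : 1 < Δ.eval 0)
  {κ : gapIndex Δ → EReal × ℝ} {b t w v : ℝ} {L : List (ℝ × ℝ × ℝ)} (hL : IsString b L t)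
  (htr : transfer b L t 0 0 + transfer b L t 1 1 - jumpPoly w v * transfer b L t 0 1 = C 2 * Δ)

include hL htr in
-- At a zero of A the diagonal entries P and B satisfy PB = 1 and P + B = 2Δ. So |Δ| ≥ 1 and Δ has
-- the sign of B, which turns the sign condition for B into one for Δ.
theorem sign_of_transfer_root {x : ℝ} (hx : (transfer b L t 0 1).eval x = 0) :
    1 ≤ |Δ.eval x| ∧ 0 < x * (derivative (transfer b L t 0 1)).eval x * Δ.eval x := by
  have h1 := transfer_det_eval L hx
  have h2 := congrArg (eval x) htr
  rw [eval_sub, eval_add, eval_mul, hx, mul_zero, sub_zero, eval_mul, eval_C] at h2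
  have h3 := (transfer_isWeylPair hL).sign x hx
  set P := (transfer b L t 0 0).eval x
  set B := (transfer b L t 1 1).eval x
  set d := x * (derivative (transfer b L t 0 1)).eval x
  have hB : 0 < B ^ 2 := by
    have : B ≠ 0 := right_ne_zero_of_mul (h1.trans_ne one_ne_zero)
    positivity
  constructor
  · rw [← sq_le_sq₀ zero_le_one (abs_nonneg _), sq_abs]
    have e : Δ.eval x ^ 2 = (P - B) ^ 2 / 4 + P * B := by
      rw [show Δ.eval x = (P + B) / 2 by linarith]
      ring
    rw [e, h1]
    nlinarith [sq_nonneg (P - B)]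
  · have h4 : 0 < B * Δ.eval x := by
      have e : B * Δ.eval x = (P * B + B ^ 2) / 2 := by
        rw [show Δ.eval x = (P + B) / 2 by linarith]
        ring
      rw [e, h1]
      linarith
    have h5 : 0 < d * Δ.eval x * B ^ 2 := by
      have := mul_pos h3 h4
      linarith [show d * B * (B * Δ.eval x) = d * Δ.eval x * B ^ 2 by ring]
    exact (pos_iff_pos_of_mul_pos h5).2 hB

include hT h0 hL htr in
-- Only the interval around 0 has to be excluded. There XA already vanishes at 0 with derivative
-- A(0) > 0 while Δ > 0, so a further zero would be a second crossing in the same direction.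
theorem exists_gap_of_transfer_root {x : ℝ} (hx : (transfer b L t 0 1).eval x = 0) :
    ∃ i ∈ gapIndex Δ, (x : EReal) ∈ gap Δ i := by
  refine (hT.mem_gap x (sign_of_transfer_root hL htr hx).1).resolve_right fun hgap => ?_
  have hw := transfer_isWeylPair hL
  have hlt := hL.lt
  have hA0 : 0 < (transfer b L t 0 1).eval 0 := by
    rw [hw.eval_zero_left]
    have : 0 < Real.sinh ((t - b) / 2) := Real.sinh_pos_iff.2 (by linarith)
    linarith
  have hne : x ≠ 0 := fun h => by
    rw [h] at hx
    exact hA0.ne' hx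
  have hD : ∀ r ∈ Set.uIcc 0 x, Δ.eval r ≠ 0 := fun r hr hr0 => by
    have := hgap r hr
    rw [hr0, abs_zero] at this
    linarith
  have hP : ∀ r, (X * transfer b L t 0 1).eval r = 0 →
      0 < (derivative (X * transfer b L t 0 1)).eval r * Δ.eval r := fun r hr => by
    rw [derivative_mul, derivative_X, one_mul, eval_add, eval_mul, eval_X]
    rw [eval_mul, eval_X, mul_eq_zero] at hr
    rcases hr with rfl | hr
    · rw [zero_mul, add_zero]
      exact mul_pos hA0 (by linarith)
    · rw [hr, zero_add]
      exact (sign_of_transfer_root hL htr hr).2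
  rcases lt_or_gt_of_ne hne with hlt | hlt
  · refine false_of_two_roots (P := X * transfer b L t 0 1) (D := Δ) hlt (by simp [hx]) (by simp)
      (fun r _ => hP r) fun r hr => hD r ?_
    rwa [Set.uIcc_of_ge hlt.le]
  · refine false_of_two_roots (P := X * transfer b L t 0 1) (D := Δ) hlt (by simp) (by simp [hx])
      (fun r _ => hP r) fun r hr => hD r ?_
    rwa [Set.uIcc_of_le hlt.le]

include hT hL htr in
theorem transfer_root_unique {i : ℤ} (hi : i ∈ gapIndex Δ) {x y : ℝ}
    (hx : (transfer b L t 0 1).eval x = 0) (hxi : (x : EReal) ∈ gap Δ i)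
    (hy : (transfer b L t 0 1).eval y = 0) (hyi : (y : EReal) ∈ gap Δ i) : x = y := by
  wlog hxy : x ≤ y generalizing x y
  · exact (this hy hyi hx hxi (le_of_not_ge hxy)).symm
  refine hxy.eq_or_lt.resolve_right fun hlt => ?_
  have hmem : ∀ r ∈ Set.Icc x y, (r : EReal) ∈ gap Δ i := fun r hr => mem_gap_of_mem_Icc hxi hyi hr
  refine false_of_two_roots (P := X * transfer b L t 0 1) (D := Δ) hlt (by simp [hx]) (by simp [hy])
    (fun r hr hr0 => ?_) fun r hr hr0 => ?_
  · rw [eval_mul, eval_X, mul_eq_zero,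
      or_iff_right (hT.mem_ne_zero hi (hmem r hr))] at hr0
    rw [derivative_mul, derivative_X, one_mul, eval_add, eval_mul, eval_X, hr0, zero_add]
    exact (sign_of_transfer_root hL htr hr0).2
  · have := hT.one_le i hi r (hmem r hr)
    rw [hr0, abs_zero] at this
    linarith

include hT h0 hL htr in
theorem transfer_root_iff (hκ : IsDivisors Δ (transfer b L t 0 1) (transfer b L t 1 1) κ) (x : ℝ) :
    (transfer b L t 0 1).eval x = 0 ↔ ∃ i, (κ i).1 = (x : EReal) := by
  constructor
  · intro hx
    obtain ⟨i, hi, hxi⟩ := exists_gap_of_transfer_root hT h0 hL htr hx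
    rcases hκ ⟨i, hi⟩ with ⟨k, hk, hki, e, -⟩ | ⟨hno, -⟩
    · refine ⟨⟨i, hi⟩, ?_⟩
      rw [e, transfer_root_unique hT hL htr hi hx hxi hk hki]
    · exact absurd hxi (hno x hx)
  · rintro ⟨i, e⟩
    rcases hκ i with ⟨k, hk, -, e', -⟩ | ⟨-, ⟨-, e'⟩ | ⟨-, e'⟩⟩
    · rw [e, EReal.coe_eq_coe_iff] at e'
      rwa [e']
    · rw [e'] at e
      exact absurd e (by simp)
    · rw [e'] at e
      exact absurd e (by simp)

theorem IsDivisors.eval_eq {A B : ℝ[X]} (hκ : IsDivisors Δ A B κ) {i : gapIndex Δ} {x : ℝ}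
    (e : (κ i).1 = (x : EReal)) : B.eval x = Δ.eval x - (κ i).2 := by
  rcases hκ i with ⟨k, -, -, e', h⟩ | ⟨-, ⟨-, e'⟩ | ⟨-, e'⟩⟩
  · rw [e, EReal.coe_eq_coe_iff] at e'
    rw [h, e']
    ring
  · rw [e'] at e
    exact absurd e (by simp)
  · rw [e'] at e
    exact absurd e (by simp)

include hT h0 hL htr in
-- The divisors fix the zeros of A and the values of B there, and the values at 0 are known; so A
-- and B agree for both strings. The strings then agree by `transfer_injective`, and cancelling A in
-- the trace identity gives the mass at the left endpoint.
theorem string_unique {w' v' : ℝ} {L' : List (ℝ × ℝ × ℝ)} (hL' : IsString b L' t)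
    (htr' : transfer b L' t 0 0 + transfer b L' t 1 1 - jumpPoly w' v' * transfer b L' t 0 1 =
      C 2 * Δ)
    (hκ : IsDivisors Δ (transfer b L t 0 1) (transfer b L t 1 1) κ)
    (hκ' : IsDivisors Δ (transfer b L' t 0 1) (transfer b L' t 1 1) κ) :
    L = L' ∧ w = w' ∧ v = v' := by
  have hW := transfer_isWeylPair hL
  have hW' := transfer_isWeylPair hL'
  have hlt : 0 < t - b := sub_pos.2 hL.lt
  have hA : transfer b L t 0 1 ≠ 0 := hW.ne_zero
  have hA' : transfer b L' t 0 1 ≠ 0 := hW'.ne_zero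
  set R := (transfer b L t 0 1).roots.toFinset with hR
  have hRR : R = (transfer b L' t 0 1).roots.toFinset := by
    ext x
    rw [hR, Multiset.mem_toFinset, Multiset.mem_toFinset, mem_roots hA, mem_roots hA', IsRoot,
      IsRoot, transfer_root_iff hT h0 hL htr hκ, transfer_root_iff hT h0 hL' htr' hκ']
  have hc : R.card = (transfer b L t 0 1).natDegree :=
    card_roots_toFinset_eq_natDegree hA hW.im_eq_zero hW.derivative_ne_zero
  have hc' : R.card = (transfer b L' t 0 1).natDegree := by
    rw [hRR]
    exact card_roots_toFinset_eq_natDegree hA' hW'.im_eq_zero hW'.derivative_ne_zero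
  have hmem : ∀ x ∈ R, (transfer b L t 0 1).eval x = 0 := fun x hx => by
    rwa [hR, Multiset.mem_toFinset, mem_roots hA] at hx
  have h0R : (0 : ℝ) ∉ R := fun h => by
    have h1 := hmem 0 h
    have := Real.sinh_pos_iff.2 (half_pos hlt)
    rw [hW.eval_zero_left] at h1
    linarith
  have hAA : transfer b L t 0 1 = transfer b L' t 0 1 := by
    refine eq_of_eval_eq R h0R hc.ge hc'.ge (fun x hx => ?_) ?_
    · rw [hmem x hx, eq_comm, transfer_root_iff hT h0 hL' htr' hκ',
        ← transfer_root_iff hT h0 hL htr hκ]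
      exact hmem x hx
    · rw [hW.eval_zero_left, hW'.eval_zero_left]
  have hBB : transfer b L t 1 1 = transfer b L' t 1 1 := by
    refine eq_of_eval_eq R h0R (hW.natDegree_le.trans hc.ge) (hW'.natDegree_le.trans hc'.ge)
      (fun x hx => ?_) ?_
    · obtain ⟨i, e⟩ := (transfer_root_iff hT h0 hL htr hκ x).1 (hmem x hx)
      rw [hκ.eval_eq e, hκ'.eval_eq e]
    · rw [hW.eval_zero_right, hW'.eval_zero_right]
  have hLL := transfer_injective hL hL' hAA hBB
  subst hLL
  refine ⟨rfl, jumpPoly_injective (mul_right_cancel₀ hA ?_)⟩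
  linear_combination htr' - htr

end Unique

/-! ### Existence -/

theorem dvd_of_eval_eq_zero {A N : ℝ[X]} (hA : A ≠ 0) (R : Finset ℝ) (hR : A.natDegree ≤ R.card)
    (hAR : ∀ x ∈ R, A.eval x = 0) (hN : ∀ x ∈ R, N.eval x = 0) : A ∣ N := by
  refine EuclideanDomain.mod_eq_zero.1 ?_
  refine eq_zero_of_degree_lt_of_eval_finset_eq_zero R ?_ fun x hx => ?_
  · refine (EuclideanDomain.mod_lt N hA).trans_le ?_
    rw [degree_eq_natDegree hA]
    exact_mod_cast hR
  · have := congrArg (eval x) (EuclideanDomain.div_add_mod N A)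
    rwa [eval_add, eval_mul, hAR x hx, zero_mul, zero_add, hN x hx] at this

section Exist

variable {Δ : ℝ[X]} {T : ℤ → ℝ} (hT : GapData Δ T) {κ : gapIndex Δ → EReal × ℝ}
  (hκ : κ ∈ torus Δ)

/-- The indices of the finite members of a family of divisors. -/
def finiteIndex (κ : gapIndex Δ → EReal × ℝ) : Finset (gapIndex Δ) :=
  open Classical in Finset.univ.filter fun i => (κ i).1 ≠ ⊤ ∧ (κ i).1 ≠ ⊥

/-- The finite members of a family of divisors. -/
def finitePart (κ : gapIndex Δ → EReal × ℝ) (i : gapIndex Δ) : ℝ := (κ i).1.toReal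

theorem mem_finiteIndex {i : gapIndex Δ} : i ∈ finiteIndex κ ↔ (κ i).1 ≠ ⊤ ∧ (κ i).1 ≠ ⊥ := by
  simp [finiteIndex]

theorem coe_finitePart {i : gapIndex Δ} (hi : i ∈ finiteIndex κ) :
    (finitePart κ i : EReal) = (κ i).1 :=
  EReal.coe_toReal (mem_finiteIndex.1 hi).1 (mem_finiteIndex.1 hi).2

include hκ

theorem finitePart_mem_gap {i : gapIndex Δ} (hi : i ∈ finiteIndex κ) :
    (finitePart κ i : EReal) ∈ gap Δ i := by
  rw [coe_finitePart hi]
  exact (hκ i).1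

theorem divisor_snd_sq {i : gapIndex Δ} (hi : i ∈ finiteIndex κ) :
    (κ i).2 ^ 2 = Δ.eval (finitePart κ i) ^ 2 - 1 := by
  have h := (hκ i).2
  have h' := mem_finiteIndex.1 hi
  rwa [evalExt, if_neg (by tauto)] at h

/-- Only the outermost gaps reach ±∞, and ζ = 0 there because of the convention Δ(±∞) = 1. -/
theorem divisor_of_notMem {i : gapIndex Δ} (hi : i ∉ finiteIndex κ) :
    ((i : ℤ) = (numPos Δ : ℤ) ∧ κ i = (⊤, 0)) ∨ ((i : ℤ) = -(numNeg Δ : ℤ) ∧ κ i = (⊥, 0)) := by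
  rw [mem_finiteIndex, not_and_or, not_not, not_not] at hi
  obtain ⟨h1, h2⟩ := hκ i
  rw [evalExt, if_pos (by tauto), one_pow, sub_self, sq_eq_zero_iff] at h2
  rcases hi with hi | hi
  · rw [hi] at h1
    exact Or.inl ⟨eq_numPos_of_top_mem_gap h1, Prod.ext hi h2⟩
  · rw [hi] at h1
    exact Or.inr ⟨eq_numNeg_of_bot_mem_gap h1, Prod.ext hi h2⟩

theorem card_compl_finiteIndex_le [DecidableEq (gapIndex Δ)] : (finiteIndex κ)ᶜ.card ≤ 2 := by
  have h : (finiteIndex κ)ᶜ.image (fun i : gapIndex Δ => (i : ℤ)) ⊆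
      {(numPos Δ : ℤ), -(numNeg Δ : ℤ)} := by
    intro j hj
    obtain ⟨i, hi, rfl⟩ := Finset.mem_image.1 hj
    rw [Finset.mem_compl] at hi
    rw [Finset.mem_insert, Finset.mem_singleton]
    exact (divisor_of_notMem hκ hi).imp And.left And.left
  rw [← Finset.card_image_of_injective _ Subtype.coe_injective]
  exact (Finset.card_le_card h).trans Finset.card_le_two

include hT

theorem finitePart_ne_zero {i : gapIndex Δ} (hi : i ∈ finiteIndex κ) : finitePart κ i ≠ 0 :=
  hT.mem_ne_zero i.2 (finitePart_mem_gap hκ hi)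

theorem finitePart_injOn : Set.InjOn (finitePart κ) (finiteIndex κ) := fun i hi j hj h =>
  Subtype.ext (hT.eq_of_mem_gap i.2 j.2 (finitePart_mem_gap hκ hi)
    (h ▸ finitePart_mem_gap hκ hj))

/-- Two infinite divisors occupy both outermost gaps, whose zeros T have opposite signs. -/
theorem prod_compl_neg [DecidableEq (gapIndex Δ)] (h2 : (finiteIndex κ)ᶜ.card = 2) :
    ∏ i ∈ (finiteIndex κ)ᶜ, (-(T i)⁻¹) < 0 := by
  obtain ⟨i, j, hij, e⟩ := Finset.card_eq_two.1 h2
  have hi := divisor_of_notMem hκ (Finset.mem_compl.1 (e ▸ Finset.mem_insert_self i {j}))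
  have hj := divisor_of_notMem hκ (Finset.mem_compl.1
    (e ▸ Finset.mem_insert_of_mem (Finset.mem_singleton_self j)))
  rw [e, Finset.prod_pair hij, neg_mul_neg]
  have hsign : ∀ i j : gapIndex Δ, (i : ℤ) = (numPos Δ : ℤ) → (j : ℤ) = -(numNeg Δ : ℤ) →
      (T i)⁻¹ * (T j)⁻¹ < 0 := fun i j h1 h2 => by
    have hi0 := i.2.1
    have hj0 := j.2.1
    exact mul_neg_of_pos_of_neg (inv_pos.2 (hT.pos i i.2 (by omega)))
      (inv_lt_zero.2 (hT.neg j j.2 (by omega)))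
  rcases hi with ⟨hi, -⟩ | ⟨hi, -⟩ <;> rcases hj with ⟨hj, -⟩ | ⟨hj, -⟩
  · exact absurd (Subtype.ext (hi.trans hj.symm)) hij
  · exact hsign i j hi hj
  · rw [mul_comm]
    exact hsign j i hj hi
  · exact absurd (Subtype.ext (hi.trans hj.symm)) hij

/-- A'(x) and Δ(x) are compared factor by factor. Factors of other finite divisors agree in sign,
those of infinite ones are positive, and 1 - x/T i < 0 offsets the minus sign in the derivative. -/
theorem sign_rootProd (hΔ : Δ = rootProd (Δ.eval 0) Finset.univ fun i : gapIndex Δ => T i)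
    (h0 : 0 < Δ.eval 0) {c : ℝ} (hc : 0 < c) {i : gapIndex Δ} (hi : i ∈ finiteIndex κ) :
    0 < finitePart κ i * (derivative (rootProd c (finiteIndex κ) (finitePart κ))).eval
      (finitePart κ i) * Δ.eval (finitePart κ i) := by
  classical
  set x := finitePart κ i with hx
  have hxi := finitePart_mem_gap hκ hi
  rw [derivative_rootProd_eval (fun j hj => finitePart_ne_zero hT hκ hj) hi]
  have e : Δ.eval x = Δ.eval 0 * ((1 - x / T i) * ((∏ j ∈ (finiteIndex κ).erase i, (1 - x / T j)) *
      ∏ j ∈ (finiteIndex κ)ᶜ, (1 - x / T j))) := by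
    conv_lhs => rw [hΔ, rootProd_eval]
    rw [← mul_assoc (1 - x / T i), Finset.mul_prod_erase (finiteIndex κ) (fun j => 1 - x / T j) hi,
      Finset.prod_mul_prod_compl]
  have p1 := hT.one_sub_div_self_neg i.2 hxi
  have p2 : 0 < (∏ j ∈ (finiteIndex κ).erase i, (1 - x / finitePart κ j)) *
      ∏ j ∈ (finiteIndex κ).erase i, (1 - x / T j) := by
    rw [← Finset.prod_mul_distrib]
    refine Finset.prod_pos fun j hj => ?_
    exact hT.one_sub_div_mul_pos i.2 hxi j.2
      (finitePart_mem_gap hκ (Finset.mem_of_mem_erase hj))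
      fun h => Finset.ne_of_mem_erase hj (Subtype.ext h.symm)
  have p3 : 0 < ∏ j ∈ (finiteIndex κ)ᶜ, (1 - x / T j) := by
    refine Finset.prod_pos fun j hj => ?_
    rw [Finset.mem_compl] at hj
    exact hT.one_sub_div_pos i.2 hxi j.2 (fun h => hj (Subtype.ext h ▸ hi))
      ((divisor_of_notMem hκ hj).imp And.left And.left)
  rw [e]
  have := mul_pos (mul_pos (mul_pos hc h0) (neg_pos.2 p1)) (mul_pos p2 p3)
  linarith [this]

theorem exists_weylPair (hΔ : Δ = rootProd (Δ.eval 0) Finset.univ fun i : gapIndex Δ => T i)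
    {d : ℝ} (hd : 0 < d) (h0 : 0 < Δ.eval 0) : ∃ B : ℝ[X],
      IsWeylPair (rootProd (2 * Real.sinh (d / 2)) (finiteIndex κ) (finitePart κ)) B d ∧
      ∀ i ∈ finiteIndex κ, B.eval (finitePart κ i) = Δ.eval (finitePart κ i) - (κ i).2 := by
  classical
  have hc : 0 < 2 * Real.sinh (d / 2) := by
    have := Real.sinh_pos_iff.2 (half_pos hd)
    linarith
  have hne : ∀ i ∈ finiteIndex κ, finitePart κ i ≠ 0 := fun i hi => finitePart_ne_zero hT hκ hi
  -- `none` is the extra node 0 with value cosh(d/2).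
  let node : Option (gapIndex Δ) → ℝ := fun o => o.elim 0 (finitePart κ)
  let val : Option (gapIndex Δ) → ℝ := fun o =>
    o.elim (Real.cosh (d / 2)) fun i => Δ.eval (finitePart κ i) - (κ i).2
  have hinj : Set.InjOn node (Finset.insertNone (finiteIndex κ)) := by
    rintro (_ | i) hi (_ | j) hj h
    · rfl
    · exact absurd h.symm (hne j (by simpa using hj))
    · exact absurd h (hne i (by simpa using hi))
    · exact congrArg some (finitePart_injOn hT hκ (by simpa using hi) (by simpa using hj) h)
  set B := Lagrange.interpolate (Finset.insertNone (finiteIndex κ)) node val with hB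
  have hB0 : B.eval 0 = Real.cosh (d / 2) :=
    Lagrange.eval_interpolate_at_node val hinj (i := none) (by simp)
  have hBi : ∀ i ∈ finiteIndex κ, B.eval (finitePart κ i) = Δ.eval (finitePart κ i) - (κ i).2 :=
    fun i hi => Lagrange.eval_interpolate_at_node val hinj (i := some i) (by simpa using hi)
  refine ⟨B, ⟨rootProd_eval_zero, hB0, ?_, fun z hz => rootProd_im_eq_zero hc.ne' hne hz,
    fun x hx => ?_⟩, hBi⟩
  · rw [natDegree_rootProd hc.ne' hne]
    have := Lagrange.degree_interpolate_lt val hinj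
    rw [← hB, Finset.card_insertNone] at this
    refine Nat.lt_succ_iff.1 ((natDegree_lt_iff_degree_lt fun h => ?_).2 this)
    rw [h, eval_zero] at hB0
    exact (Real.cosh_pos _).ne hB0
  · obtain ⟨i, hi, rfl⟩ := (rootProd_eval_eq_zero_iff hc.ne' hne).1 hx
    have h1 := sign_rootProd hT hκ hΔ h0 hc hi
    have h2 := divisor_snd_sq hκ hi
    rw [hBi i hi]
    set D := Δ.eval (finitePart κ i)
    set s := finitePart κ i * (derivative (rootProd (2 * Real.sinh (d / 2)) (finiteIndex κ)
      (finitePart κ))).eval (finitePart κ i)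
    -- As ζ² = D² - 1, this product equals ((D - ζ)² + 1)/2; so B has the sign of Δ at the node.
    have h3 : 0 < (D - (κ i).2) * D := by nlinarith [sq_nonneg (D - (κ i).2)]
    have h4 : 0 < s * (D - (κ i).2) * D ^ 2 := by
      have := mul_pos h1 h3
      linarith [show s * D * ((D - (κ i).2) * D) = s * (D - (κ i).2) * D ^ 2 by ring]
    exact (pos_iff_pos_of_mul_pos h4).2 (by
      have : D ≠ 0 := right_ne_zero_of_mul h1.ne'
      positivity)

/-- Interpolation and the inverse problem produce the string; what remains is a mass at b with v ≥ 0
that makes the trace equal to 2Δ. -/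
theorem exists_string (hΔ : Δ = rootProd (Δ.eval 0) Finset.univ fun i : gapIndex Δ => T i)
    {b t : ℝ} (hbt : b < t) (h0 : Δ.eval 0 = Real.cosh ((t - b) / 2)) :
    ∃ (L : List (ℝ × ℝ × ℝ)) (w v : ℝ), IsString b L t ∧ 0 ≤ v ∧
      transfer b L t 0 0 + transfer b L t 1 1 - jumpPoly w v * transfer b L t 0 1 = C 2 * Δ ∧
      IsDivisors Δ (transfer b L t 0 1) (transfer b L t 1 1) κ := by
  classical
  have h0' : 0 < Δ.eval 0 := h0 ▸ Real.cosh_pos _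
  have hc : 0 < 2 * Real.sinh ((t - b) / 2) := by
    have := Real.sinh_pos_iff.2 (half_pos (sub_pos.2 hbt))
    linarith
  have hne : ∀ i ∈ finiteIndex κ, finitePart κ i ≠ 0 := fun i hi => finitePart_ne_zero hT hκ hi
  have hneT : ∀ i ∈ (Finset.univ : Finset (gapIndex Δ)), T i ≠ 0 := fun i _ => hT.ne_zero i.2
  obtain ⟨B, hW, hB⟩ := exists_weylPair hT hκ hΔ (sub_pos.2 hbt) h0'
  obtain ⟨L, hL, hLA, hLB⟩ := hW.exists_string hbt
  obtain ⟨n, hn⟩ := natDegree_transfer hL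
  have hdA : (transfer b L t 0 1).natDegree = (finiteIndex κ).card := by
    rw [hLA, natDegree_rootProd hc.ne' hne]
  have hnn : n = (finiteIndex κ).card := (hn 1).2.1.symm.trans hdA
  have hroot : ∀ x, (transfer b L t 0 1).eval x = 0 ↔ ∃ i ∈ finiteIndex κ, finitePart κ i = x :=
    fun x => by rw [hLA, rootProd_eval_eq_zero_iff hc.ne' hne]
  have hdΔ : Δ.natDegree = (finiteIndex κ).card + (finiteIndex κ)ᶜ.card := by
    refine (congrArg natDegree hΔ).trans ?_
    rw [natDegree_rootProd h0'.ne' hneT, Finset.card_add_card_compl, Finset.card_univ]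
  have hcompl := card_compl_finiteIndex_le hκ
  set N : ℝ[X] := C 2 * Δ - (transfer b L t 0 0 + transfer b L t 1 1) with hN
  have hNroot : ∀ x ∈ (finiteIndex κ).image (finitePart κ), N.eval x = 0 := fun x hx => by
    obtain ⟨i, hi, rfl⟩ := Finset.mem_image.1 hx
    have h1 := transfer_det_eval L ((hroot _).2 ⟨i, hi, rfl⟩)
    have h2 := hB i hi
    rw [← hLB] at h2
    have h3 := divisor_snd_sq hκ hi
    rw [hN, eval_sub, eval_add, eval_mul, eval_C]
    have hne' : (transfer b L t 1 1).eval (finitePart κ i) ≠ 0 :=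
      right_ne_zero_of_mul (h1.trans_ne one_ne_zero)
    refine (mul_eq_zero.1 ?_).resolve_right hne'
    rw [h2] at h1 ⊢
    -- With B = Δ - ζ and ζ² = Δ² - 1 one has 2ΔB = B² + 1, so 2Δ minus the trace of the string,
    -- multiplied by B, is zero at the divisor.
    linear_combination -h1 - h3
  obtain ⟨P, hP⟩ : transfer b L t 0 1 ∣ N := by
    refine dvd_of_eval_eq_zero (hn 1).1 ((finiteIndex κ).image (finitePart κ)) ?_ (fun x hx => ?_)
      hNroot
    · rw [Finset.card_image_of_injOn (finitePart_injOn hT hκ), hdA]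
    · obtain ⟨i, hi, e⟩ := Finset.mem_image.1 hx
      exact (hroot x).2 ⟨i, hi, e⟩
  have hP0 : P.eval 0 = 0 := by
    have h1 := congrArg (eval 0) hP
    rw [hN, eval_sub, eval_add, eval_mul, eval_C, eval_mul, hLA, rootProd_eval_zero, h0,
      transfer_eval_zero_apply, transfer_eval_zero_apply] at h1
    simp only [propagator, Matrix.of_apply, Matrix.cons_val', Matrix.cons_val_zero,
      Matrix.cons_val_one, eval_C] at h1
    refine (mul_eq_zero.1 (?_ : 2 * Real.sinh ((t - b) / 2) * P.eval 0 = 0)).resolve_left hc.ne'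
    rw [← h1]
    ring
  have hdBC : (transfer b L t 0 0 + transfer b L t 1 1).natDegree ≤ n :=
    (natDegree_add_le _ _).trans (max_le (hn 0).2.1.le (hn 1).2.2)
  have hdN : N.natDegree ≤ n + (finiteIndex κ)ᶜ.card := by
    refine (natDegree_sub_le _ _).trans (max_le ?_ (hdBC.trans (Nat.le_add_right _ _)))
    rw [natDegree_C_mul two_ne_zero, hdΔ, hnn]
  have hdP : P.natDegree ≤ (finiteIndex κ)ᶜ.card := by
    by_cases hPz : P = 0
    · simp [hPz]
    · rw [hP, natDegree_mul (hn 1).1 hPz, (hn 1).2.1] at hdN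
      omega
  have hPform : P = C (P.coeff 1) * X + C (P.coeff 2) * X ^ 2 := by
    conv_lhs => rw [P.as_sum_range_C_mul_X_pow' (show P.natDegree < 3 by omega)]
    rw [Finset.sum_range_succ, Finset.sum_range_succ, Finset.sum_range_one,
      coeff_zero_eq_eval_zero, hP0]
    simp
  -- If positive, both outermost divisors are infinite. Comparing top coefficients of 2Δ and AP, the
  -- finite divisors match zeros of Δ in sign, while the two unmatched zeros of Δ have opposite
  -- signs; this forces a negative coefficient.
  have hv : P.coeff 2 ≤ 0 := by
    by_contra hpos
    push Not at hpos
    have hP2 : P.natDegree = 2 := le_antisymm (hdP.trans hcompl) (le_natDegree_of_ne_zero hpos.ne')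
    have h2 : (finiteIndex κ)ᶜ.card = 2 := by omega
    have hlead := congrArg (fun Q => coeff Q (n + 2)) hP
    have e1 : ((transfer b L t 0 1) * P).coeff (n + 2) =
        (transfer b L t 0 1).leadingCoeff * P.coeff 2 := by
      rw [leadingCoeff, (hn 1).2.1]
      exact coeff_mul_add_eq_of_natDegree_le (hn 1).2.1.le hP2.le
    have e2 : (transfer b L t 0 0 + transfer b L t 1 1).coeff (n + 2) = 0 :=
      coeff_eq_zero_of_natDegree_lt (by omega)
    have e3 : Δ.coeff (n + 2) = Δ.leadingCoeff := by
      rw [leadingCoeff, hdΔ, hnn, h2]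
    have e4 : Δ.leadingCoeff = Δ.eval 0 * ((∏ i ∈ finiteIndex κ, (-(T i)⁻¹)) *
        ∏ i ∈ (finiteIndex κ)ᶜ, (-(T i)⁻¹)) := by
      conv_lhs => rw [hΔ, leadingCoeff_rootProd hneT]
      rw [Finset.prod_mul_prod_compl]
    simp only [hN, coeff_sub, coeff_C_mul, e2, sub_zero] at hlead
    rw [e1, e3, e4, hLA, leadingCoeff_rootProd hne] at hlead
    have p1 := prod_compl_neg hT hκ h2
    have p2 : 0 < (∏ i ∈ finiteIndex κ, (-(finitePart κ i)⁻¹)) *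
        ∏ i ∈ finiteIndex κ, (-(T i)⁻¹) := by
      rw [← Finset.prod_mul_distrib]
      refine Finset.prod_pos fun i hi => ?_
      rw [neg_mul_neg, ← mul_inv]
      exact inv_pos.2 (hT.mul_pos i.2 (finitePart_mem_gap hκ hi))
    set u := ∏ i ∈ finiteIndex κ, (-(finitePart κ i)⁻¹)
    set r := ∏ i ∈ finiteIndex κ, (-(T i)⁻¹)
    set q := ∏ i ∈ (finiteIndex κ)ᶜ, (-(T i)⁻¹)
    have p3 : u ≠ 0 := left_ne_zero_of_mul p2.ne'
    have h3 : 2 * Δ.eval 0 * (u * r) * q = 2 * Real.sinh ((t - b) / 2) * u ^ 2 * P.coeff 2 := by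
      linear_combination u * hlead
    have h4 : 2 * Δ.eval 0 * (u * r) * q < 0 :=
      mul_neg_of_pos_of_neg (mul_pos (by linarith) p2) p1
    have h5 : 0 < 2 * Real.sinh ((t - b) / 2) * u ^ 2 * P.coeff 2 :=
      mul_pos (mul_pos hc (by positivity)) hpos
    linarith
  refine ⟨L, -P.coeff 1, -P.coeff 2, hL, neg_nonneg.2 hv, ?_, fun i => ?_⟩
  · have hj : jumpPoly (-P.coeff 1) (-P.coeff 2) = -P := by
      conv_rhs => rw [hPform]
      rw [jumpPoly, map_neg, map_neg]
      ring
    rw [hj]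
    linear_combination -hP + hN
  · by_cases hi : i ∈ finiteIndex κ
    · refine Or.inl ⟨finitePart κ i, (hroot _).2 ⟨i, hi, rfl⟩, finitePart_mem_gap hκ hi,
        (coe_finitePart hi).symm, ?_⟩
      rw [hLB, hB i hi]
      ring
    · refine Or.inr ⟨fun k hk hki => ?_, divisor_of_notMem hκ hi⟩
      obtain ⟨j, hj, rfl⟩ := (hroot k).1 hk
      exact hi (Subtype.ext (hT.eq_of_mem_gap i.2 j.2 hki (finitePart_mem_gap hκ hj)) ▸ hj)

end Exist

/-! ### From strings back to the phase space -/

/-- A string together with a mass at its left endpoint comes from a pair in the phase space. -/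
theorem exists_phaseSpace_of_isString {ℓ : ℝ} (hℓ : 0 < ℓ) {a w v : ℝ} {L : List (ℝ × ℝ × ℝ)}
    (hL : IsString a L (a + ℓ)) (hv : 0 ≤ v) :
    ∃ p ∈ phaseSpace ℓ, Enumerates (masses p) a L (a + ℓ) ∧ masses p a = (w, v) := by
  classical
  set n : ℝ → ℝ × ℝ := fun y => massAt L y + if y = a then (w, v) else 0 with hn
  set F : Finset ℝ := ((L.map Prod.fst).toFinset ∪ {a}).filter (· ∈ Set.Ico a (a + ℓ)) with hF
  have hself : ∀ x ∈ Set.Ico a (a + ℓ), toIcoMod hℓ a x = x := fun x hx =>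
    (toIcoMod_eq_self hℓ).2 hx
  have hzero : ∀ x ∈ Set.Ico a (a + ℓ), x ∉ F → n (toIcoMod hℓ a x) = 0 := fun x hx hxF => by
    rw [hself x hx]
    simp only [hF, Finset.mem_filter, Finset.mem_union, List.mem_toFinset, Finset.mem_singleton,
      hx, and_true, not_or] at hxF
    simp only [hn, if_neg hxF.2, massAt_eq_zero_of_notMem hxF.1, add_zero]
  have hnn : ∀ x, 0 ≤ (n x).2 := fun x => by
    simp only [hn, Prod.snd_add]
    refine add_nonneg (massAt_snd_nonneg hL _) ?_
    split_ifs
    · exact hv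
    · exact le_rfl
  obtain ⟨p, hp, hω, hυ⟩ := exists_phaseSpace hℓ a F (w := fun x => (n (toIcoMod hℓ a x)).1)
    (v := fun x => (n (toIcoMod hℓ a x)).2) (fun x hx => (Finset.mem_filter.1 hx).2)
    (fun x => by simp only [toIcoMod_add_right]) (fun x => by simp only [toIcoMod_add_right])
    (fun x => hnn _) (fun x hx hxF => by rw [hzero x hx hxF, Prod.fst_zero])
    (fun x hx hxF => by rw [hzero x hx hxF, Prod.snd_zero])
  have hm : ∀ x ∈ Set.Ico a (a + ℓ), masses p x = n x := fun x hx => by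
    rw [masses, hω, hυ, hself x hx]
  refine ⟨p, hp, ⟨hL, fun y hy => ?_⟩, ?_⟩
  · rw [hm y (Set.Ioo_subset_Ico_self hy)]
    simp only [hn, if_neg hy.1.ne', add_zero]
  · rw [hm a ⟨le_rfl, hL.lt⟩]
    simp only [hn, if_true, massAt_eq_zero_of_ge hL le_rfl, zero_add]

/-- The masses are periodic, so they are determined by the list on (a, a+ℓ) and the mass at a. -/
theorem phaseSpace_ext_of_enumerates {ℓ : ℝ} (hℓ : 0 < ℓ) {a : ℝ} {p p' : (ℝ → ℝ) × Measure ℝ}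
    (hp : p ∈ phaseSpace ℓ) (hp' : p' ∈ phaseSpace ℓ) {L : List (ℝ × ℝ × ℝ)}
    (hL : Enumerates (masses p) a L (a + ℓ)) (hL' : Enumerates (masses p') a L (a + ℓ))
    (ha : masses p a = masses p' a) : p = p' := by
  have h : ∀ x, masses p x = masses p' x := fun x => by
    have h1 : ∀ {q : (ℝ → ℝ) × Measure ℝ}, q ∈ phaseSpace ℓ →
        masses q x = masses q (toIcoMod hℓ a x) := fun {q} hq => by
      conv_lhs => rw [← toIcoMod_add_toIcoDiv_zsmul hℓ a x]
      exact Function.Periodic.zsmul (masses_add_period hq) _ _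
    rw [h1 hp, h1 hp']
    have hx := toIcoMod_mem_Ico hℓ a x
    rcases hx.1.eq_or_lt with e | hlt
    · rw [← e, ha]
    · rw [hL.2 _ ⟨hlt, hx.2⟩, hL'.2 _ ⟨hlt, hx.2⟩]
  exact phaseSpace_ext hℓ hp hp' (fun x => congrArg Prod.fst (h x))
    fun x => congrArg Prod.snd (h x)

end MultiPeakon

end

/-! ### The theorem -/

theorem mainTheorem1 (ℓ : ℝ) (hℓ : 0 < ℓ) (a : ℝ) (Δ : Polynomial ℝ)
    (hroots : ∀ z : ℂ, Polynomial.aeval z Δ = 0 →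
      z.im = 0 ∧ z ≠ 0 ∧ Polynomial.aeval z (Polynomial.derivative Δ) ≠ 0)
    (hzero : Δ.eval 0 = Real.cosh (ℓ / 2))
    (hcrit : ∀ z : ℂ, Polynomial.aeval z (Polynomial.derivative Δ) = 0 →
      1 ≤ ‖Polynomial.aeval z Δ‖)
    (κ : MultiPeakon.gapIndex Δ → EReal × ℝ) (hκ : κ ∈ MultiPeakon.torus Δ) :
    ∃! p : (ℝ → ℝ) × MeasureTheory.Measure ℝ, p ∈ MultiPeakon.phaseSpace ℓ ∧
      (∀ z : ℂ, MultiPeakon.floquetDiscriminant ℓ a p.1 p.2 z = Polynomial.aeval z Δ) ∧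
      MultiPeakon.IsDirichletDivisors ℓ a p.1 p.2 Δ κ := by
  have h0 : 1 < Δ.eval 0 := by
    rw [hzero]
    exact Real.one_lt_cosh.2 (half_pos hℓ).ne'
  have hΔ0 : Δ ≠ 0 := fun h => by
    rw [h, Polynomial.eval_zero] at h0
    linarith
  have hsplit := MultiPeakon.splits_of_forall_im_eq_zero fun z hz => (hroots z hz).1
  have hnodup := MultiPeakon.nodup_roots_of_derivative_ne_zero hΔ0 fun x hx hx' =>
    (hroots x (by rw [MultiPeakon.aeval_ofReal, hx, Complex.ofReal_zero])).2.2
      (by rw [MultiPeakon.aeval_ofReal, hx', Complex.ofReal_zero])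
  obtain ⟨T, hT⟩ := MultiPeakon.exists_gapData hsplit hnodup h0 fun x hx => by
    have h := hcrit x (by rw [MultiPeakon.aeval_ofReal, hx, Complex.ofReal_zero])
    rwa [MultiPeakon.aeval_ofReal, Complex.norm_real, Real.norm_eq_abs] at h
  have hlt : a < a + ℓ := lt_add_of_pos_right a hℓ
  obtain ⟨L, w, v, hL, hv, htr, hdiv⟩ := MultiPeakon.exists_string hT hκ
    (hT.eq_rootProd hsplit hnodup (by linarith)) hlt (by rw [hzero, add_sub_cancel_left])
  obtain ⟨p, hp, hpL, hpa⟩ := MultiPeakon.exists_phaseSpace_of_isString hℓ (w := w) hL hv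
  refine ⟨p, ⟨hp, ?_, ?_⟩, ?_⟩
  · rw [MultiPeakon.floquetDiscriminant_iff hp hℓ hpL, hpa]
    exact htr
  · rw [MultiPeakon.isDirichletDivisors_iff hp hℓ hpL]
    exact hdiv
  · rintro p' ⟨hp', hF, hD⟩
    obtain ⟨L', hL'⟩ := MultiPeakon.exists_enumerates (MultiPeakon.masses_snd_nonneg p')
      (MultiPeakon.eventually_masses_eq_zero hp') hlt
    rw [MultiPeakon.floquetDiscriminant_iff hp' hℓ hL'] at hF
    rw [MultiPeakon.isDirichletDivisors_iff hp' hℓ hL'] at hD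
    obtain ⟨rfl, hw, hv'⟩ := MultiPeakon.string_unique hT h0 hL'.1 hF hL htr hD hdiv
    exact MultiPeakon.phaseSpace_ext_of_enumerates hℓ hp' hp hL' hpL
      (by rw [hpa]; exact Prod.ext hw hv')
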